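/- Let $\Gamma$ be the chain graph made of rings indexed by $j\in\mathbb Z$; the $j$-th ring consists of an upper and a lower semicircle, each identified with $[0,\pi]$ and joining the vertex $j$ ($x=0$) to the vertex $j+1$ ($x=\pi$). Let $A\in\mathbb R$ and let $\mathcal D=\frac{d}{dx}+iA$ on the upper semicircles and $\mathcal D=\frac{d}{dx}-iA$ on the lower ones. For a real sequence $\boldsymbol\beta=(\beta_j)_{j\in\mathbb Z}$ let $-\Delta_{\boldsymbol\beta}$ be the operator in $L^2(\Gamma)$ (the Hilbert sum of the spaces $L^2(0,\pi)$ over all semicircles) that acts as $-\mathcal D^2$ on each semicircle. Its domain consists of all $f\in L^2(\Gamma)$ whose component $\psi_j$ on the upper and $\varphi_j$ on the lower semicircle of the $j$-th ring belong to $H^2(0,\pi)$ for every $j$, which satisfy $-\mathcal D^2f\in L^2(\Gamma)$, and for which, for every $j\in\mathbb Z$, $$\psi_j(0)=\varphi_j(0)=\psi_{j-1}(\pi)=\varphi_{j-1}(\pi),\qquad \mathcal D\psi_j(0)+\mathcal D\varphi_j(0)-\mathcal D\psi_{j-1}(\pi)-\mathcal D\varphi_{j-1}(\pi)=\beta_j\,\psi_j(0).$$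 The essential spectrum is the spectrum without the isolated eigenvalues of finite multiplicity. The gaps of the essential spectrum are the connected components of its complement in $\mathbb R$, numbered $1,2,3,\dots$ from left to right, so that the first gap is the one below the essential spectrum. **Theorem.** Let $A\in\mathbb R\setminus\mathbb Z$ and $\alpha,\gamma_1,\gamma_2\in\mathbb R$. Denote by $-\Delta_\alpha$ the operator with $\beta_j=\alpha$ for all $j$, and by $-\Delta_{\boldsymbol\alpha+\boldsymbol\gamma^{(2)}}$ the operator with $\beta_1=\alpha+\gamma_1$, $\beta_2=\alpha+\gamma_2$ and $\beta_j=\alpha$ for all other $j$. Then the essential spectrum of $-\Delta_{\boldsymbol\alpha+\boldsymbol\gamma^{(2)}}$ coincides with that of $-\Delta_\alpha$. If $\gamma_1+\gamma_2<0$, then $-\Delta_{\boldsymbol\alpha+\boldsymbol\gamma^{(2)}}$ has at least one and at most two eigenvalues, counted with multiplicity, in every odd gap of its essential spectrum. If $\gamma_1+\gamma_2>0$, then it has at least one and at most two eigenvalues, counted with multiplicity, in every even gap of its essential spectrum. -/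

import Mathlib

/-! General notions for unbounded operators on a complex Banach space. -/

namespace UnboundedOperator

variable {H : Type*} [NormedAddCommGroup H] [NormedSpace ℂ H]

/-- The eigenspace `{f ∈ dom T : T f = z f}`. -/
def eigenspace (T : H →ₗ.[ℂ] H) (z : ℂ) : Submodule ℂ H :=
  (LinearMap.ker (T.toFun - z • T.domain.subtype)).map T.domain.subtype

/-- The resolvent set: those `z` for which `T - z : dom T → H` has a bounded two-sided inverse. -/
def resolventSet (T : H →ₗ.[ℂ] H) : Set ℂ :=
  {z | ∃ R : H →L[ℂ] H,
    (∀ f : H, ∃ h : R f ∈ T.domain, T ⟨R f, h⟩ - z • R f = f) ∧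
    ∀ u : T.domain, R (T u - z • (u : H)) = u}

/-- The spectrum. -/
def spectrum (T : H →ₗ.[ℂ] H) : Set ℂ := (resolventSet T)ᶜ

/-- The discrete spectrum: eigenvalues of finite multiplicity that are isolated points of the
spectrum. -/
def discreteSpectrum (T : H →ₗ.[ℂ] H) : Set ℂ :=
  {z | z ∈ spectrum T ∧ ¬ AccPt z (Filter.principal (spectrum T)) ∧
    eigenspace T z ≠ ⊥ ∧ FiniteDimensional ℂ (eigenspace T z)}

/-- The essential spectrum (of a self-adjoint operator): the spectrum without the discrete
spectrum. -/
def essentialSpectrum (T : H →ₗ.[ℂ] H) : Set ℂ := spectrum T \ discreteSpectrum T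

/-- The real points of the essential spectrum. -/
def realEssentialSpectrum (T : H →ₗ.[ℂ] H) : Set ℝ := {E : ℝ | (E : ℂ) ∈ essentialSpectrum T}

/-- The eigenvalues of `T` in the set `I` of real numbers. -/
def eigenvaluesIn (T : H →ₗ.[ℂ] H) (I : Set ℝ) : Set ℝ :=
  {E | E ∈ I ∧ eigenspace T (E : ℂ) ≠ ⊥}

/-- The span of all eigenfunctions of `T` with eigenvalue in `I`; its dimension is the number
of eigenvalues in `I`, counted with multiplicity. -/
def eigenfunctionsIn (T : H →ₗ.[ℂ] H) (I : Set ℝ) : Submodule ℂ H :=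
  ⨆ E ∈ I, eigenspace T (E : ℂ)

/-- `T` has at least one and at most two eigenvalues in `I`; the upper bound holds also when the
eigenvalues are counted with multiplicity. -/
def HasOneOrTwoEigenvaluesIn (T : H →ₗ.[ℂ] H) (I : Set ℝ) : Prop :=
  1 ≤ (eigenvaluesIn T I).encard ∧ (eigenvaluesIn T I).encard ≤ 2 ∧
    Module.rank ℂ (eigenfunctionsIn T I) ≤ 2

end UnboundedOperator

/-- A gap of a set `S` of real numbers: a connected component of its complement. -/
def IsGap (S I : Set ℝ) : Prop := ∃ x ∈ Sᶜ, I = connectedComponentIn Sᶜ x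

/-- `I` is the `n`-th gap of `S`, counted from the left and starting with `n = 1`: exactly
`n - 1` gaps lie to the left of it. (If `S` is bounded below and non-empty, the first gap is
the unbounded one below `S`.) -/
def IsNthGap (S : Set ℝ) (n : ℕ) (I : Set ℝ) : Prop :=
  IsGap S I ∧ {J | IsGap S J ∧ ∀ x ∈ J, ∀ y ∈ I, x < y}.encard + 1 = n

/-! The chain graph and the magnetic Hamiltonian with delta couplings. -/

namespace MagneticChain

open MeasureTheory Set

/-- `L²(0, π)`, the state space of a single semicircle. -/
abbrev EdgeL2 : Type := Lp ℂ 2 (volume.restrict (Ioo (0 : ℝ) Real.pi))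

/-- The edges of the chain: `(j, true)` is the upper and `(j, false)` the lower semicircle of
the `j`-th ring. Both are parametrized by `x ∈ [0, π]`, from the `j`-th vertex (`x = 0`) to the
`(j+1)`-st vertex (`x = π`). -/
abbrev Edge : Type := ℤ × Bool

/-- `L²(Γ)`, the Hilbert sum over the edges of `L²(0, π)`. -/
abbrev ChainL2 : Type := lp (fun _ : Edge => EdgeL2) 2

/-- `u` is a function of the Sobolev class `H²(0, π)`, with derivative `v` and weak second
derivative `g`: `u` is continuously differentiable on `[0, π]`, and `u' = v` is absolutely
continuous with `v' = g ∈ L²(0, π)`. -/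
structure IsH2 (u v : ℝ → ℂ) (g : EdgeL2) : Prop where
  deriv : ∀ x ∈ Icc (0 : ℝ) Real.pi, HasDerivWithinAt u (v x) (Icc (0 : ℝ) Real.pi) x
  deriv₂ : ∀ x ∈ Icc (0 : ℝ) Real.pi, v x = v 0 + ∫ t in (0 : ℝ)..x, g t

/-- The constant `a` in the quasiderivative `D = d/dx + i a`: it is `A` on the upper and `-A` on
the lower semicircles (the tangential component of the vector potential is `-a`). -/
def pot (A : ℝ) (e : Edge) : ℝ := if e.2 then A else -A

/-- The quasiderivative `D u = u' + i a u` at `x` on the edge `e`, where `v = u'`. -/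
def quasiDeriv (A : ℝ) (e : Edge) (u v : ℝ → ℂ) (x : ℝ) : ℂ :=
  v x + Complex.I * (pot A e : ℂ) * u x

/-- `f` is in the domain of the Hamiltonian with vector potential `A` and coupling constants
`α j`, with edge components `u`, first derivatives `v` and second derivatives `g`, and the
Hamiltonian maps `f` to `h`. -/
structure IsAction (A : ℝ) (α : ℤ → ℝ) (f h : ChainL2)
    (u v : Edge → ℝ → ℂ) (g : Edge → EdgeL2) : Prop where
  sobolev : ∀ e, IsH2 (u e) (v e) (g e)
  repr : ∀ e, (f e : ℝ → ℂ) =ᵐ[volume.restrict (Ioo (0 : ℝ) Real.pi)] u e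
  /-- `h = -D² u = -(u'' + 2 i a u' - a² u)` on each edge -/
  action : ∀ e, (h e : ℝ → ℂ) =ᵐ[volume.restrict (Ioo (0 : ℝ) Real.pi)] fun x =>
    -(g e x + 2 * Complex.I * (pot A e : ℂ) * v e x - (pot A e : ℂ) ^ 2 * u e x)
  /-- continuity at the vertices -/
  continuity : ∀ j : ℤ, u (j, true) 0 = u (j, false) 0 ∧
    u (j, true) 0 = u (j - 1, true) Real.pi ∧ u (j, true) 0 = u (j - 1, false) Real.pi
  /-- the delta coupling at the vertices -/
  coupling : ∀ j : ℤ,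
    quasiDeriv A (j, true) (u (j, true)) (v (j, true)) 0 +
      quasiDeriv A (j, false) (u (j, false)) (v (j, false)) 0 -
      quasiDeriv A (j - 1, true) (u (j - 1, true)) (v (j - 1, true)) Real.pi -
      quasiDeriv A (j - 1, false) (u (j - 1, false)) (v (j - 1, false)) Real.pi =
    (α j : ℂ) * u (j, true) 0

theorem EdgeL2.integrableOn (g : EdgeL2) : IntegrableOn g (Ioo (0 : ℝ) Real.pi) volume :=
  (Lp.memLp g).integrable (by norm_num)

theorem EdgeL2.intervalIntegrable (g : EdgeL2) {a b : ℝ} (ha : a ∈ Icc (0 : ℝ) Real.pi)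
    (hb : b ∈ Icc (0 : ℝ) Real.pi) : IntervalIntegrable g volume a b := by
  have h : IntegrableOn g (Icc (0 : ℝ) Real.pi) volume :=
    (integrableOn_Icc_iff_integrableOn_Ioo (by simp) (by simp)).2 g.integrableOn
  exact (h.mono_set (uIcc_subset_Icc ha hb)).intervalIntegrable

theorem EdgeL2.integral_congr {g : EdgeL2} {k : ℝ → ℂ}
    (h : (g : ℝ → ℂ) =ᵐ[volume.restrict (Ioo (0 : ℝ) Real.pi)] k) {x : ℝ}
    (hx : x ∈ Icc (0 : ℝ) Real.pi) : ∫ t in (0 : ℝ)..x, g t = ∫ t in (0 : ℝ)..x, k t := by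
  rw [intervalIntegral.integral_of_le hx.1, intervalIntegral.integral_of_le hx.1,
    integral_Ioc_eq_integral_Ioo, integral_Ioc_eq_integral_Ioo]
  exact integral_congr_ae (ae_restrict_of_ae_restrict_of_subset (Ioo_subset_Ioo_right hx.2) h)

theorem IsH2.zero : IsH2 0 0 0 where
  deriv x _ := hasDerivWithinAt_const x _ (0 : ℂ)
  deriv₂ x hx := by
    rw [EdgeL2.integral_congr (Lp.coeFn_zero _ _ _) hx]; simp

theorem IsH2.add {u v u' v' : ℝ → ℂ} {g g' : EdgeL2} (h : IsH2 u v g) (h' : IsH2 u' v' g') :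
    IsH2 (u + u') (v + v') (g + g') where
  deriv x hx := (h.deriv x hx).add (h'.deriv x hx)
  deriv₂ x hx := by
    have h0 : (0 : ℝ) ∈ Icc (0 : ℝ) Real.pi := ⟨le_rfl, Real.pi_pos.le⟩
    rw [EdgeL2.integral_congr (Lp.coeFn_add g g') hx]
    simp only [Pi.add_apply]
    rw [intervalIntegral.integral_add (g.intervalIntegrable h0 hx) (g'.intervalIntegrable h0 hx),
      h.deriv₂ x hx, h'.deriv₂ x hx]
    ring

theorem IsH2.smul {u v : ℝ → ℂ} {g : EdgeL2} (h : IsH2 u v g) (c : ℂ) :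
    IsH2 (c • u) (c • v) (c • g) where
  deriv x hx := (h.deriv x hx).const_smul c
  deriv₂ x hx := by
    rw [EdgeL2.integral_congr (Lp.coeFn_smul c g) hx]
    simp only [Pi.smul_apply, smul_eq_mul]
    rw [intervalIntegral.integral_const_mul, h.deriv₂ x hx]
    ring

/-- The graph of the Hamiltonian. -/
def graph (A : ℝ) (α : ℤ → ℝ) : Submodule ℂ (ChainL2 × ChainL2) where
  carrier := {p | ∃ u v g, IsAction A α p.1 p.2 u v g}
  zero_mem' := by
    refine ⟨0, 0, 0, fun _ => IsH2.zero, fun e => ?_, fun e => ?_, fun j => by simp,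
      fun j => by simp [quasiDeriv]⟩
    · exact Lp.coeFn_zero _ _ _
    · filter_upwards [Lp.coeFn_zero ℂ 2 (volume.restrict (Ioo (0 : ℝ) Real.pi))] with x hx
      have hx' : (0 : EdgeL2) x = (0 : ℂ) := hx
      simp only [Prod.snd_zero, lp.coeFn_zero, Pi.zero_apply, hx']
      simp
  add_mem' := by
    rintro p q ⟨u, v, g, h⟩ ⟨u', v', g', h'⟩
    refine ⟨u + u', v + v', g + g', fun e => (h.sobolev e).add (h'.sobolev e), fun e => ?_,
      fun e => ?_, fun j => ?_, fun j => ?_⟩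
    · filter_upwards [Lp.coeFn_add (p.1 e) (q.1 e), h.repr e, h'.repr e] with x h1 h2 h3
      rw [Prod.fst_add, lp.coeFn_add, Pi.add_apply, h1, Pi.add_apply, h2, h3]
      rfl
    · filter_upwards [Lp.coeFn_add (p.2 e) (q.2 e), h.action e, h'.action e,
        Lp.coeFn_add (g e) (g' e)] with x h1 h2 h3 h4
      rw [Prod.snd_add, lp.coeFn_add, Pi.add_apply, h1, Pi.add_apply, h2, h3]
      simp only [Pi.add_apply] at h4 ⊢
      rw [h4]
      ring
    · obtain ⟨h1, h2, h3⟩ := h.continuity j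
      obtain ⟨h1', h2', h3'⟩ := h'.continuity j
      simp only [Pi.add_apply]
      exact ⟨by rw [h1, h1'], by rw [h2, h2'], by rw [h3, h3']⟩
    · have e1 := h.coupling j
      have e2 := h'.coupling j
      simp only [quasiDeriv, Pi.add_apply] at e1 e2 ⊢
      linear_combination e1 + e2
  smul_mem' := by
    rintro c p ⟨u, v, g, h⟩
    refine ⟨c • u, c • v, c • g, fun e => (h.sobolev e).smul c, fun e => ?_,
      fun e => ?_, fun j => ?_, fun j => ?_⟩
    · filter_upwards [Lp.coeFn_smul c (p.1 e), h.repr e] with x h1 h2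
      rw [Prod.smul_fst, lp.coeFn_smul, Pi.smul_apply, h1, Pi.smul_apply, h2]
      rfl
    · filter_upwards [Lp.coeFn_smul c (p.2 e), h.action e, Lp.coeFn_smul c (g e)] with x h1 h2 h4
      rw [Prod.smul_snd, lp.coeFn_smul, Pi.smul_apply, h1, Pi.smul_apply, h2]
      simp only [Pi.smul_apply, smul_eq_mul] at h4 ⊢
      rw [h4]
      ring
    · obtain ⟨h1, h2, h3⟩ := h.continuity j
      simp only [Pi.smul_apply]
      exact ⟨by rw [h1], by rw [h2], by rw [h3]⟩
    · have e1 := h.coupling j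
      simp only [quasiDeriv, Pi.smul_apply, smul_eq_mul] at e1 ⊢
      linear_combination c * e1

/-- The magnetic Hamiltonian of the chain, acting as `-D²` on each edge, with delta coupling of
strength `α j` at the `j`-th vertex; the domain consists of all `f ∈ L²(Γ)` that are `H²` on
each edge, satisfy the vertex conditions, and have `-D² f ∈ L²(Γ)`. -/
noncomputable def hamiltonian (A : ℝ) (α : ℤ → ℝ) : ChainL2 →ₗ.[ℂ] ChainL2 :=
  (graph A α).toLinearPMap

/-- `graph A α` is the graph of a function, so it is the graph of `hamiltonian A α`. -/
theorem hamiltonian_graph (A : ℝ) (α : ℤ → ℝ) : (hamiltonian A α).graph = graph A α := by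
  refine Submodule.toLinearPMap_graph_eq _ ?_
  rintro ⟨f, h⟩ ⟨u, v, g, H⟩ hf
  change f = 0 at hf
  subst hf
  have hpi := Real.pi_pos
  have huniq : UniqueDiffOn ℝ (Icc (0 : ℝ) Real.pi) := uniqueDiffOn_Icc hpi
  refine lp.ext (funext fun e => ?_)
  have hu0 : ∀ x ∈ Icc (0 : ℝ) Real.pi, u e x = 0 := by
    have hc : ContinuousOn (u e) (Icc (0 : ℝ) Real.pi) :=
      fun x hx => ((H.sobolev e).deriv x hx).continuousWithinAt
    have hae : u e =ᵐ[volume.restrict (Ioo (0 : ℝ) Real.pi)] fun _ => (0 : ℂ) := by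
      filter_upwards [H.repr e, Lp.coeFn_zero ℂ 2 (volume.restrict (Ioo (0 : ℝ) Real.pi))]
        with x h1 h2
      rw [← h1]
      exact h2
    have hae' : u e =ᵐ[volume.restrict (Icc (0 : ℝ) Real.pi)] fun _ => (0 : ℂ) := by
      rw [← restrict_Ioo_eq_restrict_Icc]
      exact hae
    exact Measure.eqOn_Icc_of_ae_eq volume hpi.ne hae' hc continuousOn_const
  have hv0 : ∀ x ∈ Icc (0 : ℝ) Real.pi, v e x = 0 := fun x hx => by
    have h1 := ((H.sobolev e).deriv x hx).congr (fun y hy => (hu0 y hy).symm) (hu0 x hx).symm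
    exact (huniq x hx).eq_deriv _ h1 (hasDerivWithinAt_const x _ (0 : ℂ))
  have h0 : (0 : ℝ) ∈ Icc (0 : ℝ) Real.pi := ⟨le_rfl, hpi.le⟩
  have hg0 : ∀ᵐ x ∂(volume.restrict (Ioo (0 : ℝ) Real.pi)), g e x = 0 := by
    have hint : ∀ x ∈ Icc (0 : ℝ) Real.pi, ∫ t in (0 : ℝ)..x, g e t = 0 := fun x hx => by
      have := (H.sobolev e).deriv₂ x hx
      rw [hv0 x hx, hv0 0 h0, zero_add] at this
      exact this.symm
    have hL := ((g e).intervalIntegrable h0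
      (⟨hpi.le, le_rfl⟩ : Real.pi ∈ Icc (0 : ℝ) Real.pi)).ae_hasDerivAt_integral
    rw [ae_restrict_iff' measurableSet_Ioo]
    filter_upwards [hL] with x hx hxI
    have hd := hx (by rw [uIcc_of_le hpi.le]; exact Ioo_subset_Icc_self hxI) 0
      (by rw [uIcc_of_le hpi.le]; exact h0)
    have hz : HasDerivAt (fun y => ∫ t in (0 : ℝ)..y, g e t) 0 x :=
      (hasDerivAt_const x (0 : ℂ)).congr_of_eventuallyEq (by
        filter_upwards [Ioo_mem_nhds hxI.1 hxI.2] with y hy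
        exact hint y (Ioo_subset_Icc_self hy))
    exact hd.unique hz
  refine Lp.ext ?_
  filter_upwards [H.action e, hg0, ae_restrict_mem measurableSet_Ioo,
    Lp.coeFn_zero ℂ 2 (volume.restrict (Ioo (0 : ℝ) Real.pi))] with x h1 h2 h3 h4
  rw [h1, h2, hu0 x (Ioo_subset_Icc_self h3), hv0 x (Ioo_subset_Icc_self h3)]
  rw [lp.coeFn_zero, Pi.zero_apply, h4]
  simp

/-- The coupling constants of a chain with coupling `α` at all vertices, perturbed by `γ₁` and
`γ₂` at the vertices `1` and `2`. -/
def twoImpurities (α γ₁ γ₂ : ℝ) (j : ℤ) : ℝ :=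
  if j = 1 then α + γ₁ else if j = 2 then α + γ₂ else α

end MagneticChain

/-! Put `C = cos (√E π)`, `S = sin (√E π) / √E` and `ξ = C + (α / 4) S`. After a gauge
transformation an eigenfunction solves `-w'' = E w` on every semicircle, so if `S ≠ 0` it is
determined by its values `y j` at the vertices, and the vertex conditions become the Jacobi equation
`2 cos (A π) (y (j + 1) + y (j - 1)) = (4 C + β j S) y j`. For `β = α` the associated operator on
`ℓ²(ℤ)` is invertible if and only if `|ξ| > |cos (A π)|`, and finitely many impurities perturb it by
an operator of finite rank. If `S = 0`, that is `E = n ^ 2`, there are infinitely many independent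
eigenfunctions supported on two adjacent rings. So the essential spectrum consists of the bands
`|ξ| ≤ |cos (A π)|` and the points `n ^ 2`.

At most two eigenvalues: on a combination `u` of eigenfunctions with eigenvalues in a gap which
vanishes at both impurities, the perturbed and the unperturbed operator agree. If `m` is the
midpoint of the eigenvalues involved, the former forces `‖(T - m) u‖ ≤ ρ ‖u‖` with a smaller `ρ`
than the latter allows, since the unperturbed operator has no spectrum in the gap. So `u = 0`, and
evaluation at the two impurities is injective.

At least one: a monotonicity argument shows that between consecutive points `n ^ 2` there is exactly
one band, so that the odd gaps lie to its left and the even gaps to its right. In a gap, sequences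
decaying geometrically away from the impurities solve the Jacobi equation when a secular function
vanishes. It is negative at the band edge if `γ₁ + γ₂` has the sign belonging to the gap, and
positive at the other end of the gap. -/

section Primitive

open MeasureTheory Set Filter Topology
open scoped Interval

theorem absolutelyContinuousOnInterval_of_dist_le {X Y : Type*} [PseudoMetricSpace X]
    [PseudoMetricSpace Y] {f : ℝ → X} {g : ℝ → Y} {a b : ℝ}
    (hg : AbsolutelyContinuousOnInterval g a b)
    (h : ∀ x ∈ uIcc a b, ∀ y ∈ uIcc a b, dist (f x) (f y) ≤ dist (g x) (g y)) :
    AbsolutelyContinuousOnInterval f a b := by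
  rw [absolutelyContinuousOnInterval_iff] at hg ⊢
  intro ε hε
  obtain ⟨δ, hδ, H⟩ := hg ε hε
  refine ⟨δ, hδ, fun E hE hs => lt_of_le_of_lt (Finset.sum_le_sum fun i hi => ?_) (H E hE hs)⟩
  exact h _ (hE.1 i hi).1 _ (hE.1 i hi).2

/-- `u` is an indefinite integral of `v` on the interval between `a` and `b`. This is how absolute
continuity with derivative `v` enters the definition of `H²(0, π)`. -/
structure IsPrimitive {F : Type*} [NormedAddCommGroup F] [NormedSpace ℝ F] (u v : ℝ → F)
    (a b : ℝ) : Prop where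
  intervalIntegrable : IntervalIntegrable v volume a b
  eq_add_integral : ∀ x ∈ uIcc a b, u x = u a + ∫ t in a..x, v t

namespace IsPrimitive

variable {F : Type*} [NormedAddCommGroup F] [NormedSpace ℝ F] {u v u' v' : ℝ → F} {a b x y : ℝ}

theorem intervalIntegrable_of_mem (h : IsPrimitive u v a b) (hx : x ∈ uIcc a b)
    (hy : y ∈ uIcc a b) : IntervalIntegrable v volume x y :=
  h.intervalIntegrable.mono_set (uIcc_subset_uIcc hx hy)

theorem integral_eq_sub (h : IsPrimitive u v a b) : ∫ t in a..b, v t = u b - u a := by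
  rw [h.eq_add_integral b right_mem_uIcc, add_sub_cancel_left]

theorem of_intervalIntegrable (hv : IntervalIntegrable v volume a b) :
    IsPrimitive (fun x => ∫ t in a..x, v t) v a b :=
  ⟨hv, fun x _ => by rw [intervalIntegral.integral_same, zero_add]⟩

theorem congr (h : IsPrimitive u v a b) (hu : EqOn u' u (uIcc a b))
    (hv : v' =ᵐ[volume.restrict (Ι a b)] v) : IsPrimitive u' v' a b where
  intervalIntegrable := h.intervalIntegrable.congr_ae hv.symm
  eq_add_integral x hx := by
    have hv' : ∀ᵐ t, t ∈ Ι a x → v' t = v t := by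
      rw [EventuallyEq, ae_restrict_iff' measurableSet_uIoc] at hv
      filter_upwards [hv] with t ht htx
      exact ht (uIoc_subset_uIoc_of_uIcc_subset_uIcc (uIcc_subset_uIcc_left hx) htx)
    rw [hu hx, hu left_mem_uIcc, intervalIntegral.integral_congr_ae hv', h.eq_add_integral x hx]

theorem add (h : IsPrimitive u v a b) (h' : IsPrimitive u' v' a b) :
    IsPrimitive (fun x => u x + u' x) (fun x => v x + v' x) a b where
  intervalIntegrable := h.intervalIntegrable.add h'.intervalIntegrable
  eq_add_integral x hx := by
    rw [intervalIntegral.integral_add (h.intervalIntegrable_of_mem left_mem_uIcc hx)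
      (h'.intervalIntegrable_of_mem left_mem_uIcc hx), h.eq_add_integral x hx,
      h'.eq_add_integral x hx]
    abel

theorem neg (h : IsPrimitive u v a b) : IsPrimitive (fun x => -u x) (fun x => -v x) a b where
  intervalIntegrable := h.intervalIntegrable.neg
  eq_add_integral x hx := by
    rw [intervalIntegral.integral_neg, h.eq_add_integral x hx]
    abel

theorem sub (h : IsPrimitive u v a b) (h' : IsPrimitive u' v' a b) :
    IsPrimitive (fun x => u x - u' x) (fun x => v x - v' x) a b := by
  simpa only [sub_eq_add_neg] using h.add h'.neg

theorem absolutelyContinuousOnInterval (h : IsPrimitive u v a b) :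
    AbsolutelyContinuousOnInterval u a b := by
  refine absolutelyContinuousOnInterval_of_dist_le
    (h.intervalIntegrable.norm.absolutelyContinuousOnInterval_intervalIntegral left_mem_uIcc)
    fun x hx y hy => ?_
  have hx' := h.intervalIntegrable_of_mem left_mem_uIcc hx
  have hy' := h.intervalIntegrable_of_mem left_mem_uIcc hy
  rw [h.eq_add_integral x hx, h.eq_add_integral y hy, dist_add_left, dist_comm, dist_eq_norm,
    dist_comm, Real.dist_eq, intervalIntegral.integral_interval_sub_left hy' hx',
    intervalIntegral.integral_interval_sub_left hy'.norm hx'.norm]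
  exact intervalIntegral.norm_integral_le_abs_integral_norm

theorem continuousOn (h : IsPrimitive u v a b) : ContinuousOn u (uIcc a b) :=
  h.absolutelyContinuousOnInterval.continuousOn

variable [CompleteSpace F]

theorem ae_hasDerivAt (h : IsPrimitive u v a b) : ∀ᵐ x, x ∈ uIcc a b → HasDerivAt u (v x) x := by
  have hne (c : ℝ) : ∀ᵐ x : ℝ, x ≠ c := by simp [ae_iff, measure_singleton]
  filter_upwards [h.intervalIntegrable.ae_hasDerivAt_integral, hne (min a b), hne (max a b)]
    with x hx hmin hmax hxI
  refine ((hx hxI a left_mem_uIcc).const_add (u a)).congr_of_eventuallyEq ?_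
  filter_upwards [Icc_mem_nhds (hxI.1.lt_of_ne hmin.symm) (hxI.2.lt_of_ne hmax)] with y hy
  exact h.eq_add_integral y hy

theorem of_ae_hasDerivAt (hu : AbsolutelyContinuousOnInterval u a b)
    (hv : IntervalIntegrable v volume a b) (h : ∀ᵐ x, x ∈ uIcc a b → HasDerivAt u (v x) x) :
    IsPrimitive u v a b := by
  have hI := of_intervalIntegrable hv
  obtain ⟨c, hc⟩ := (hu.sub hI.absolutelyContinuousOnInterval).const_of_ae_hasDerivAt_zero <| by
    filter_upwards [h, hI.ae_hasDerivAt] with x hx hx' hxI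
    simpa only [sub_self] using (hx hxI).sub (hx' hxI)
  refine ⟨hv, fun x hx => ?_⟩
  have hxa := (hc x hx).trans (hc a left_mem_uIcc).symm
  simpa only [Pi.sub_apply, intervalIntegral.integral_same, sub_zero, sub_eq_iff_eq_add]
    using hxa

theorem of_hasDerivWithinAt (h : ∀ x ∈ uIcc a b, HasDerivWithinAt u (v x) (uIcc a b) x)
    (hv : ContinuousOn v (uIcc a b)) : IsPrimitive u v a b where
  intervalIntegrable := hv.intervalIntegrable
  eq_add_integral x hx := by
    have hsub := uIcc_subset_uIcc_left hx
    rw [intervalIntegral.integral_eq_sub_of_hasDeriv_right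
      (fun y hy => (h y (hsub hy)).continuousWithinAt.mono hsub)
      (fun y hy => (((h y (hsub (Ioo_subset_Icc_self hy))).mono hsub).hasDerivAt
        (Icc_mem_nhds hy.1 hy.2)).hasDerivWithinAt) (hv.mono hsub).intervalIntegrable,
      add_sub_cancel]

theorem of_hasDerivAt (h : ∀ x, HasDerivAt u (v x) x) (hv : Continuous v) : IsPrimitive u v a b :=
  of_hasDerivWithinAt (fun x _ => (h x).hasDerivWithinAt) hv.continuousOn

theorem hasDerivWithinAt (h : IsPrimitive u v a b) (hv : ContinuousOn v (uIcc a b))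
    (hx : x ∈ uIcc a b) : HasDerivWithinAt u (v x) (uIcc a b) x := by
  have : Fact (x ∈ Icc (a ⊓ b) (a ⊔ b)) := ⟨hx⟩
  have hd : HasDerivWithinAt (fun y => ∫ t in a..y, v t) (v x) (Icc (a ⊓ b) (a ⊔ b)) x :=
    intervalIntegral.integral_hasDerivWithinAt_right
      (h.intervalIntegrable_of_mem left_mem_uIcc hx)
      (hv.stronglyMeasurableAtFilter_nhdsWithin measurableSet_Icc x) (hv x hx)
  exact (hd.const_add (u a)).congr (fun y hy => h.eq_add_integral y hy) (h.eq_add_integral x hx)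

section RCLike

variable {𝕜 : Type*} [RCLike 𝕜] {w w' p p' : ℝ → 𝕜}

theorem mul (h : IsPrimitive w w' a b) (k : IsPrimitive p p' a b) :
    IsPrimitive (fun x => w x * p x) (fun x => w' x * p x + w x * p' x) a b := by
  refine of_ae_hasDerivAt ?_ ?_ ?_
  · exact h.absolutelyContinuousOnInterval.fun_smul k.absolutelyContinuousOnInterval
  · exact (h.intervalIntegrable.mul_continuousOn k.continuousOn).add
      (k.intervalIntegrable.continuousOn_mul h.continuousOn)
  · filter_upwards [h.ae_hasDerivAt, k.ae_hasDerivAt] with x hx kx hxI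
    exact (hx hxI).mul (kx hxI)

theorem const_mul (h : IsPrimitive w w' a b) (c : 𝕜) :
    IsPrimitive (fun x => c * w x) (fun x => c * w' x) a b where
  intervalIntegrable := h.intervalIntegrable.const_mul c
  eq_add_integral x hx := by
    rw [intervalIntegral.integral_const_mul, h.eq_add_integral x hx, mul_add]

theorem conj (h : IsPrimitive w w' a b) :
    IsPrimitive (fun x => starRingEnd 𝕜 (w x)) (fun x => starRingEnd 𝕜 (w' x)) a b where
  intervalIntegrable := by
    rw [intervalIntegrable_iff]
    exact (ContinuousLinearEquiv.integrable_comp_iff (RCLike.conjCLE : 𝕜 ≃L[ℝ] 𝕜)).2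
      (intervalIntegrable_iff.1 h.intervalIntegrable)
  eq_add_integral x hx := by
    rw [h.eq_add_integral x hx, map_add, intervalIntegral.intervalIntegral_conj]

theorem ofReal {p p' : ℝ → ℝ} (h : IsPrimitive p p' a b) :
    IsPrimitive (fun x => (p x : 𝕜)) (fun x => (p' x : 𝕜)) a b where
  intervalIntegrable := by
    rw [intervalIntegrable_iff]
    exact (intervalIntegrable_iff.1 h.intervalIntegrable).ofReal
  eq_add_integral x hx := by
    rw [h.eq_add_integral x hx, RCLike.intervalIntegral_ofReal, RCLike.ofReal_add]

variable {w₁ w₂ p₁ p₂ : ℝ → 𝕜}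

theorem wronskian (h : IsPrimitive w w₁ a b) (h₁ : IsPrimitive w₁ w₂ a b)
    (k : IsPrimitive p p₁ a b) (k₁ : IsPrimitive p₁ p₂ a b) :
    IsPrimitive (fun x => w₁ x * p x - w x * p₁ x) (fun x => w₂ x * p x - w x * p₂ x) a b :=
  ((h₁.mul k).sub (h.mul k₁)).congr (fun _ _ => rfl) (Eventually.of_forall fun _ => by ring)

theorem integral_green (h : IsPrimitive w w₁ a b) (h₁ : IsPrimitive w₁ w₂ a b)
    (k : IsPrimitive p p₁ a b) (k₁ : IsPrimitive p₁ p₂ a b) :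
    ∫ x in a..b, (w₂ x * p x - w x * p₂ x) =
      (w₁ b * p b - w b * p₁ b) - (w₁ a * p a - w a * p₁ a) :=
  (h.wronskian h₁ k k₁).integral_eq_sub

end RCLike

end IsPrimitive

end Primitive

section IntegralBounds

open MeasureTheory Set Filter

theorem integral_norm_le_sqrt_mul_norm {α F : Type*} [MeasurableSpace α] {μ : Measure α}
    [IsFiniteMeasure μ] [NormedAddCommGroup F] (f : Lp F 2 μ) :
    ∫ x, ‖f x‖ ∂μ ≤ √(μ.real Set.univ) * ‖f‖ := by
  have h := eLpNorm_le_eLpNorm_mul_rpow_measure_univ (μ := μ) (f := f)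
    (p := 1) (q := 2) (by norm_num) (Lp.aestronglyMeasurable f)
  have htop : μ Set.univ ^ (1 / (1 : ENNReal).toReal - 1 / (2 : ENNReal).toReal) ≠ ⊤ :=
    ENNReal.rpow_ne_top_of_nonneg (by norm_num) (measure_ne_top _ _)
  have h' := ENNReal.toReal_mono (ENNReal.mul_ne_top (Lp.eLpNorm_ne_top f) htop) h
  rw [ENNReal.toReal_mul, ← ENNReal.toReal_rpow, ← Lp.norm_def, eLpNorm_one_eq_lintegral_enorm,
    ← integral_norm_eq_lintegral_enorm (Lp.aestronglyMeasurable f), mul_comm] at h'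
  convert h' using 2
  rw [Real.sqrt_eq_rpow]
  norm_num [Measure.real]

theorem norm_integral_mul_le_mul_integral_norm {R : Type*} [NormedRing R] [NormedSpace ℝ R]
    {φ ρ : ℝ → R} {M c x : ℝ} (hφ : ∀ t ∈ Icc 0 c, ‖φ t‖ ≤ M)
    (hρ : IntervalIntegrable ρ volume 0 c) (hx : x ∈ Icc 0 c) :
    ‖∫ t in (0 : ℝ)..x, φ t * ρ t‖ ≤ M * ∫ t in (0 : ℝ)..c, ‖ρ t‖ := by
  have hM : 0 ≤ M := (norm_nonneg _).trans (hφ x hx)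
  have hρx : IntervalIntegrable ρ volume 0 x := hρ.mono_set (by
    rw [uIcc_of_le hx.1, uIcc_of_le (hx.1.trans hx.2)]
    exact Icc_subset_Icc_right hx.2)
  calc ‖∫ t in (0 : ℝ)..x, φ t * ρ t‖ ≤ ∫ t in (0 : ℝ)..x, M * ‖ρ t‖ :=
        intervalIntegral.norm_integral_le_of_norm_le hx.1
          (Eventually.of_forall fun t ht => (norm_mul_le _ _).trans
            (mul_le_mul_of_nonneg_right (hφ t ⟨ht.1.le, ht.2.trans hx.2⟩) (norm_nonneg _)))
          (hρx.norm.const_mul M)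
    _ = M * ∫ t in (0 : ℝ)..x, ‖ρ t‖ := intervalIntegral.integral_const_mul _ _
    _ ≤ M * ∫ t in (0 : ℝ)..c, ‖ρ t‖ := mul_le_mul_of_nonneg_left
        (intervalIntegral.integral_mono_interval le_rfl hx.1 hx.2
          (Eventually.of_forall fun _ => norm_nonneg _) hρ.norm) hM

end IntegralBounds

section SquareSummable

variable {ι κ X : Type*} [NormedAddCommGroup X] {F : ι → X}

theorem memℓp_two_iff_summable {Y : ι → Type*} [∀ i, NormedAddCommGroup (Y i)] {F : ∀ i, Y i} :
    Memℓp F 2 ↔ Summable fun i => ‖F i‖ ^ 2 := by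
  rw [memℓp_gen_iff (by norm_num)]
  norm_num

theorem memℓp_two_comp_injective (hF : Memℓp F 2) {φ : κ → ι} (hφ : Function.Injective φ) :
    Memℓp (fun k => F (φ k)) 2 := by
  rw [memℓp_two_iff_summable] at hF ⊢
  exact hF.comp_injective hφ

theorem memℓp_two_comp_fst [Finite κ] (hF : Memℓp F 2) :
    Memℓp (fun e : ι × κ => F e.1) 2 := by
  have := Fintype.ofFinite κ
  rw [memℓp_two_iff_summable] at hF ⊢
  refine (summable_prod_of_nonneg fun _ => by positivity).2
    ⟨fun _ => (hasSum_fintype _).summable, ?_⟩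
  simpa using hF.mul_left (Fintype.card κ : ℝ)

theorem summable_mul_of_memℓp_two {G G' : ι → ℝ} (hG : Memℓp G 2) (hG' : Memℓp G' 2) :
    Summable fun i => G i * G' i := by
  rw [memℓp_two_iff_summable] at hG hG'
  refine Summable.of_norm_bounded (hG.add hG') fun i => ?_
  rw [norm_mul]
  nlinarith [sq_nonneg (‖G i‖ - ‖G' i‖), sq_nonneg (‖G i‖), sq_nonneg (‖G' i‖)]

end SquareSummable

theorem norm_le_of_forall_mem_spectrum {A : Type*} [CStarAlgebra A] {a : A}
    (ha : IsSelfAdjoint a) {C : ℝ} (hC : 0 ≤ C) (h : ∀ k ∈ spectrum ℂ a, ‖k‖ ≤ C) : ‖a‖ ≤ C := by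
  have hrad : spectralRadius ℂ a ≤ (Real.toNNReal C : ENNReal) :=
    iSup₂_le fun k hk => ENNReal.coe_le_coe.2 (NNReal.le_toNNReal_of_coe_le (h k hk))
  rw [ha.spectralRadius_eq_nnnorm, ENNReal.coe_le_coe] at hrad
  simpa only [coe_nnnorm, Real.coe_toNNReal _ hC] using NNReal.coe_le_coe.2 hrad

theorem exists_subset_closedBall_ball_subset {s : Finset ℝ} (hs : s.Nonempty) {I : Set ℝ}
    (hI : IsOpen I) (hIc : I.OrdConnected) (hsI : ↑s ⊆ I) :
    ∃ m ρ r : ℝ, 0 ≤ ρ ∧ ρ < r ∧ ↑s ⊆ Metric.closedBall m ρ ∧ Metric.ball m r ⊆ I := by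
  have hIcc : Set.Icc (s.min' hs) (s.max' hs) ⊆ I :=
    hIc.out (hsI (s.min'_mem hs)) (hsI (s.max'_mem hs))
  obtain ⟨ε, hε, hεI⟩ := isCompact_Icc.exists_thickening_subset_open hI hIcc
  have hρ : 0 ≤ (s.max' hs - s.min' hs) / 2 :=
    div_nonneg (sub_nonneg.2 (s.min'_le_max' hs)) zero_le_two
  rw [Real.Icc_eq_closedBall, thickening_closedBall hε hρ] at hεI
  refine ⟨_, _, _, hρ, lt_add_of_pos_left _ hε, fun E hE => ?_, hεI⟩
  rw [← Real.Icc_eq_closedBall]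
  exact ⟨s.min'_le E hE, s.le_max' E hE⟩

theorem exists_finset_sum_of_mem_biSup {ι K V : Type*} [Semiring K] [AddCommMonoid V] [Module K V]
    (p : ι → Submodule K V) (I : Set ι) {f : V} (hf : f ∈ ⨆ i ∈ I, p i) :
    ∃ (s : Finset ι) (g : ∀ i, p i), ↑s ⊆ I ∧ f = ∑ i ∈ s, (g i : V) := by
  classical
  rw [iSup_subtype'] at hf
  obtain ⟨g, hg, rfl⟩ := (Submodule.mem_iSup_iff_exists_finsupp _ _).1 hf
  refine ⟨g.support.map (Function.Embedding.subtype _),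
    fun i => if h : i ∈ I then ⟨g ⟨i, h⟩, hg ⟨i, h⟩⟩ else 0, by simp, ?_⟩
  simp [Finsupp.sum]

namespace UnboundedOperator

section Banach

variable {H : Type*} [NormedAddCommGroup H] [NormedSpace ℂ H] {T : H →ₗ.[ℂ] H} {z w : ℂ}
  {R Q : H →L[ℂ] H}

theorem mem_eigenspace_iff {f : H} :
    f ∈ eigenspace T z ↔ ∃ u : T.domain, (u : H) = f ∧ T u = z • f := by
  simp only [eigenspace, Submodule.mem_map, LinearMap.mem_ker]
  constructor
  · rintro ⟨u, hu, rfl⟩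
    exact ⟨u, rfl, sub_eq_zero.1 hu⟩
  · rintro ⟨u, rfl, hu⟩
    exact ⟨u, sub_eq_zero.2 hu, rfl⟩

theorem mem_eigenspace_iff_graph {f : H} : f ∈ eigenspace T z ↔ (f, z • f) ∈ T.graph := by
  rw [mem_eigenspace_iff, LinearPMap.mem_graph_iff]

theorem eigenspace_le_eigenfunctionsIn {E : ℝ} {I : Set ℝ} (hE : E ∈ I) :
    eigenspace T (E : ℂ) ≤ eigenfunctionsIn T I :=
  le_iSup₂ (f := fun (E : ℝ) (_ : E ∈ I) => eigenspace T (E : ℂ)) E hE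

theorem eigenfunctionsIn_le_domain (T : H →ₗ.[ℂ] H) (I : Set ℝ) :
    eigenfunctionsIn T I ≤ T.domain := by
  refine iSup₂_le fun E _ f hf => ?_
  obtain ⟨u, rfl, -⟩ := mem_eigenspace_iff.1 hf
  exact u.2

/-- `R` is the resolvent `(T - z)⁻¹` of `T` at `z`, a bounded operator of the whole space. -/
structure IsResolvent (T : H →ₗ.[ℂ] H) (z : ℂ) (R : H →L[ℂ] H) : Prop where
  apply_sub : ∀ f : H, ∃ h : R f ∈ T.domain, T ⟨R f, h⟩ - z • R f = f
  sub_apply : ∀ u : T.domain, R (T u - z • (u : H)) = u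

theorem mem_resolventSet_iff : z ∈ resolventSet T ↔ ∃ R, IsResolvent T z R :=
  exists_congr fun _ => ⟨fun h => ⟨h.1, h.2⟩, fun h => ⟨h.1, h.2⟩⟩

theorem eigenspace_eq_bot_of_mem_resolventSet (hz : z ∈ resolventSet T) : eigenspace T z = ⊥ := by
  obtain ⟨R, hR⟩ := mem_resolventSet_iff.1 hz
  refine (Submodule.eq_bot_iff _).2 fun f hf => ?_
  obtain ⟨u, rfl, hu⟩ := mem_eigenspace_iff.1 hf
  simpa only [hu, sub_self, map_zero, eq_comm] using hR.sub_apply u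

theorem IsResolvent.sub_eq (hR : IsResolvent T z R) (hQ : IsResolvent T w Q) :
    Q - R = (w - z) • (R * Q) := by
  ext f
  obtain ⟨hf, hTf⟩ := hQ.apply_sub f
  have hshift : T ⟨Q f, hf⟩ - z • Q f = f + (w - z) • Q f := by
    linear_combination (norm := module) hTf
  have hQf : R (f + (w - z) • Q f) = Q f := hshift ▸ hR.sub_apply ⟨Q f, hf⟩
  rw [map_add, map_smul] at hQf
  exact sub_eq_iff_eq_add'.2 hQf.symm

theorem IsResolvent.isUnit_one_sub_smul (hR : IsResolvent T z R) (hQ : IsResolvent T w Q) :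
    IsUnit (1 - (w - z) • R) := by
  have hQR : Q = R + (w - z) • (R * Q) := sub_eq_iff_eq_add'.1 (hR.sub_eq hQ)
  have hRQ : R = Q + (z - w) • (Q * R) := sub_eq_iff_eq_add'.1 (hQ.sub_eq hR)
  refine ⟨⟨1 - (w - z) • R, 1 + (w - z) • Q, ?_, ?_⟩, rfl⟩
  · simp only [sub_mul, mul_add, one_mul, mul_one, smul_mul_assoc, mul_smul_comm]
    linear_combination (norm := module) (w - z) • hQR
  · simp only [add_mul, mul_sub, one_mul, mul_one, smul_mul_assoc, mul_smul_comm]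
    linear_combination (norm := module) (z - w) • hRQ

theorem IsResolvent.mul_inv (hR : IsResolvent T z R) {W : (H →L[ℂ] H)ˣ}
    (hW : (W : H →L[ℂ] H) = 1 - (w - z) • R) :
    IsResolvent T w (R * (W⁻¹ : (H →L[ℂ] H)ˣ).val) := by
  have hWinv (f : H) : (W⁻¹ : (H →L[ℂ] H)ˣ).val f -
      (w - z) • R ((W⁻¹ : (H →L[ℂ] H)ˣ).val f) = f := by
    simpa [hW] using DFunLike.congr_fun W.mul_inv f
  have hinvW (f : H) : (W⁻¹ : (H →L[ℂ] H)ˣ).val (f - (w - z) • R f) = f := by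
    simpa [hW] using DFunLike.congr_fun W.inv_mul f
  refine ⟨fun f => ?_, fun u => ?_⟩
  · obtain ⟨h, hT⟩ := hR.apply_sub ((W⁻¹ : (H →L[ℂ] H)ˣ).val f)
    refine ⟨h, ?_⟩
    simp only [mul_apply_eq_comp]
    linear_combination (norm := module) hT + hWinv f
  · have hshift : T u - w • (u : H) =
        (T u - z • (u : H)) - (w - z) • R (T u - z • (u : H)) := by
      rw [hR.sub_apply]
      module
    rw [mul_apply_eq_comp, hshift, hinvW, hR.sub_apply]

theorem IsResolvent.mem_resolventSet_iff (hR : IsResolvent T z R) :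
    w ∈ resolventSet T ↔ IsUnit (1 - (w - z) • R) := by
  rw [UnboundedOperator.mem_resolventSet_iff]
  exact ⟨fun ⟨_, hQ⟩ => hR.isUnit_one_sub_smul hQ, fun ⟨_, hW⟩ => ⟨_, hR.mul_inv hW⟩⟩

theorem IsResolvent.mem_resolventSet_iff_inv_notMem_spectrum (hR : IsResolvent T z R)
    (hw : w ≠ z) : w ∈ resolventSet T ↔ (w - z)⁻¹ ∉ _root_.spectrum ℂ R := by
  have hwz : w - z ≠ 0 := sub_ne_zero.2 hw
  have hfactor : 1 - (w - z) • R =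
      Units.mk0 (w - z) hwz • (algebraMap ℂ (H →L[ℂ] H) (w - z)⁻¹ - R) := by
    rw [Units.smul_mk0, smul_sub, Algebra.algebraMap_eq_smul_one, smul_smul,
      mul_inv_cancel₀ hwz, one_smul]
  rw [hR.mem_resolventSet_iff, spectrum.notMem_iff, hfactor, isUnit_smul_iff]

end Banach

section Hilbert

variable {H : Type*} [NormedAddCommGroup H] [InnerProductSpace ℂ H]

/-- Symmetry of an unbounded operator, which need not be densely defined. -/
def IsSymmetric (T : H →ₗ.[ℂ] H) : Prop :=
  ∀ u v : T.domain, inner ℂ (T u) (v : H) = inner ℂ (u : H) (T v)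

namespace IsSymmetric

variable {T T₀ : H →ₗ.[ℂ] H} {E : ℝ} {I : Set ℝ}

theorem orthogonalFamily_eigenspace (hT : IsSymmetric T) :
    OrthogonalFamily ℂ (fun E : ℝ => eigenspace T (E : ℂ))
      fun E => (eigenspace T (E : ℂ)).subtypeₗᵢ := by
  rintro E E' hE ⟨f, hf⟩ ⟨f', hf'⟩
  obtain ⟨u, rfl, hu⟩ := mem_eigenspace_iff.1 hf
  obtain ⟨u', rfl, hu'⟩ := mem_eigenspace_iff.1 hf'
  have h := hT u u'
  rw [hu, hu', inner_smul_left, inner_smul_right, Complex.conj_ofReal] at h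
  have hmul : ((E : ℂ) - E') * inner ℂ (u : H) (u' : H) = 0 := by linear_combination h
  exact (mul_eq_zero.1 hmul).resolve_left (sub_ne_zero.2 (Complex.ofReal_injective.ne hE))

theorem norm_sub_le_mul_norm (hT : IsSymmetric T) {m ρ : ℝ} (hρ : 0 ≤ ρ) {s : Finset ℝ}
    (hs : ↑s ⊆ Metric.closedBall m ρ) (g : ∀ E : ℝ, eigenspace T (E : ℂ)) {u : T.domain}
    (hu : (u : H) = ∑ E ∈ s, (g E : H)) :
    ‖T u - (m : ℂ) • (u : H)‖ ≤ ρ * ‖(u : H)‖ := by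
  choose w hw hTw using fun E => mem_eigenspace_iff.1 (g E).2
  have huw : u = ∑ E ∈ s, w E := Subtype.ext (by simp only [hu, Submodule.coe_sum, hw])
  have hTu : T u - (m : ℂ) • (u : H) = ∑ E ∈ s, ((((E - m : ℝ) : ℂ) • g E :
      eigenspace T (E : ℂ)) : H) := by
    rw [hu, huw, ← LinearPMap.toFun_eq_coe, map_sum, Finset.smul_sum, ← Finset.sum_sub_distrib]
    simp only [LinearPMap.toFun_eq_coe, hTw, Complex.ofReal_sub, sub_smul,
      Submodule.coe_sub, Submodule.coe_smul]
  have horth := hT.orthogonalFamily_eigenspace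
  have hnorm : ‖(u : H)‖ ^ 2 = ∑ E ∈ s, ‖g E‖ ^ 2 := hu ▸ horth.norm_sum g s
  have hTnorm : ‖T u - (m : ℂ) • (u : H)‖ ^ 2 = ∑ E ∈ s, ‖((E - m : ℝ) : ℂ) • g E‖ ^ 2 :=
    hTu ▸ horth.norm_sum (fun E => ((E - m : ℝ) : ℂ) • g E) s
  refine (sq_le_sq₀ (norm_nonneg _) (by positivity)).1 ?_
  rw [hTnorm, mul_pow, hnorm, Finset.mul_sum]
  refine Finset.sum_le_sum fun E hE => ?_
  rw [norm_smul, mul_pow, Complex.norm_real, ← dist_eq_norm]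
  gcongr
  exact hs hE

theorem encard_eigenvaluesIn_le (hT : IsSymmetric T) {n : ℕ}
    (h : Module.rank ℂ (eigenfunctionsIn T I) ≤ n) : (eigenvaluesIn T I).encard ≤ n := by
  choose v hv hv0 using fun E : eigenvaluesIn T I => Submodule.exists_mem_ne_zero_of_ne_bot E.2.2
  have hli : LinearIndependent ℂ v := linearIndependent_of_ne_zero_of_inner_eq_zero hv0
    fun E E' hE => hT.orthogonalFamily_eigenspace (Subtype.coe_injective.ne hE)
      ⟨v E, hv E⟩ ⟨v E', hv E'⟩
  have hmem (E : eigenvaluesIn T I) : v E ∈ eigenfunctionsIn T I :=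
    eigenspace_le_eigenfunctionsIn E.2.1 (hv E)
  have hli' : LinearIndependent ℂ fun E => (⟨v E, hmem E⟩ : eigenfunctionsIn T I) :=
    LinearIndependent.of_comp (eigenfunctionsIn T I).subtype hli
  have hcard : Cardinal.mk (eigenvaluesIn T I) ≤ n := by
    simpa using hli'.cardinal_lift_le_rank.trans (Cardinal.lift_le.2 h)
  rw [← Set.toENat_cardinalMk]
  simpa using Cardinal.toENat.monotone' hcard

theorem exists_mem_resolventSet (hT : IsSymmetric T) (hI : IsOpen I) (hI₀ : I.Nonempty) {n : ℕ}
    (hrank : Module.rank ℂ (eigenfunctionsIn T I) ≤ n)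
    (hreg : ∀ x ∈ I, eigenspace T (x : ℂ) = ⊥ → (x : ℂ) ∈ resolventSet T) :
    ∃ x ∈ I, (x : ℂ) ∈ resolventSet T := by
  obtain ⟨y, hy⟩ := hI₀
  obtain ⟨x, hx, hne⟩ := (infinite_of_mem_nhds y (hI.mem_nhds hy)).exists_notMem_finite
    (Set.finite_of_encard_le_coe (hT.encard_eigenvaluesIn_le hrank))
  exact ⟨x, hx, hreg x hx (by_contra fun h => hne ⟨hx, h⟩)⟩

theorem inner_sub_smul (hT : IsSymmetric T) (E : ℝ) (u v : T.domain) :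
    inner ℂ (T u - (E : ℂ) • (u : H)) (v : H) = inner ℂ (u : H) (T v - (E : ℂ) • (v : H)) := by
  rw [inner_sub_left, inner_sub_right, hT, inner_smul_left, inner_smul_right, Complex.conj_ofReal]

theorem mem_resolventSet [CompleteSpace H] (hT : IsSymmetric T)
    (inj : ∀ u : T.domain, T u = (E : ℂ) • (u : H) → u = 0)
    (surj : ∀ f : H, ∃ u : T.domain, T u - (E : ℂ) • (u : H) = f) :
    (E : ℂ) ∈ resolventSet T := by
  let L : T.domain →ₗ[ℂ] H := T.toFun - (E : ℂ) • T.domain.subtype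
  have hL : Function.Bijective L := by
    refine ⟨?_, surj⟩
    rw [← LinearMap.ker_eq_bot, Submodule.eq_bot_iff]
    exact fun u hu => inj u (sub_eq_zero.1 hu)
  let e := LinearEquiv.ofBijective L hL
  let R₀ : H →ₗ[ℂ] H := T.domain.subtype ∘ₗ e.symm.toLinearMap
  have hTe (f : H) : T (e.symm f) - (E : ℂ) • (e.symm f : H) = f := e.apply_symm_apply f
  have hR₀ : R₀.IsSymmetric := fun f g => by
    have h := hT.inner_sub_smul E (e.symm f) (e.symm g)
    rw [hTe, hTe] at h
    exact h.symm
  -- the Hellinger–Toeplitz theorem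
  have hcont : Continuous R₀ := hR₀.continuous
  exact ⟨⟨R₀, hcont⟩, fun f => ⟨(e.symm f).2, hTe f⟩,
    fun u => congrArg Subtype.val (e.symm_apply_apply u)⟩

variable [CompleteSpace H]

theorem isSelfAdjoint_resolvent (hT : IsSymmetric T) {R : H →L[ℂ] H} (hR : IsResolvent T E R) :
    IsSelfAdjoint R := by
  rw [ContinuousLinearMap.isSelfAdjoint_iff_isSymmetric]
  intro f g
  obtain ⟨hf, hTf⟩ := hR.apply_sub f
  obtain ⟨hg, hTg⟩ := hR.apply_sub g
  have h := hT.inner_sub_smul E ⟨R f, hf⟩ ⟨R g, hg⟩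
  rw [hTf, hTg] at h
  exact h.symm

theorem mem_resolventSet_of_im_ne_zero (hT : IsSymmetric T) (hE : (E : ℂ) ∈ resolventSet T)
    {z : ℂ} (hz : z.im ≠ 0) : z ∈ resolventSet T := by
  obtain ⟨R, hR⟩ := mem_resolventSet_iff.1 hE
  have hzE : z ≠ E := fun h => hz (by rw [h, Complex.ofReal_im])
  rw [hR.mem_resolventSet_iff_inv_notMem_spectrum hzE]
  intro hmem
  have hreal := congrArg Complex.im ((hT.isSelfAdjoint_resolvent hR).mem_spectrum_eq_re hmem)
  rw [Complex.ofReal_im, Complex.inv_im, div_eq_zero_iff, neg_eq_zero, Complex.sub_im,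
    Complex.ofReal_im, sub_zero, Complex.normSq_eq_zero, sub_eq_zero] at hreal
  exact hreal.elim hz hzE

theorem mul_norm_le_norm_sub (hT : IsSymmetric T) {r : ℝ} (hr : 0 < r)
    (hE : ∀ x ∈ Metric.ball E r, (x : ℂ) ∈ resolventSet T) (u : T.domain) :
    r * ‖(u : H)‖ ≤ ‖T u - (E : ℂ) • (u : H)‖ := by
  obtain ⟨R, hR⟩ := mem_resolventSet_iff.1 (hE E (Metric.mem_ball_self hr))
  have hRsa := hT.isSelfAdjoint_resolvent hR
  have hspec : ∀ k ∈ _root_.spectrum ℂ R, ‖k‖ ≤ r⁻¹ := by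
    intro k hk
    by_contra! hlt
    have hknorm : 0 < ‖k‖ := (inv_pos.2 hr).trans hlt
    obtain ⟨κ, rfl⟩ : ∃ κ : ℝ, k = κ := ⟨k.re, hRsa.mem_spectrum_eq_re hk⟩
    rw [Complex.norm_real] at hlt hknorm
    have hball : E + κ⁻¹ ∈ Metric.ball E r := by
      rw [Metric.mem_ball, dist_self_add_left, norm_inv]
      exact inv_lt_of_inv_lt₀ hr hlt
    have hne : ((E + κ⁻¹ : ℝ) : ℂ) ≠ E := by simpa using norm_pos_iff.1 hknorm
    refine (hR.mem_resolventSet_iff_inv_notMem_spectrum hne).1 (hE _ hball) ?_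
    simpa using hk
  have hbound : ‖R‖ ≤ r⁻¹ := norm_le_of_forall_mem_spectrum hRsa (inv_pos.2 hr).le hspec
  have hu := R.le_of_opNorm_le hbound (T u - (E : ℂ) • (u : H))
  rwa [hR.sub_apply, inv_mul_eq_div, le_div_iff₀ hr, mul_comm] at hu

/-- Near the finitely many eigenvalues involved, `‖(T - m) u‖` is at most half the diameter of
their range, whereas the regular points of `T₀` force it to be larger. -/
theorem eq_zero_of_mem_eigenfunctionsIn (hT : IsSymmetric T) (hT₀ : IsSymmetric T₀)
    (hI : IsOpen I) (hIc : I.OrdConnected) (hres : ∀ x ∈ I, (x : ℂ) ∈ resolventSet T₀)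
    {u : T.domain} (hu : (u : H) ∈ eigenfunctionsIn T I)
    (hu₀ : ∃ u₀ : T₀.domain, (u₀ : H) = u ∧ T₀ u₀ = T u) : u = 0 := by
  obtain ⟨s, g, hsI, hsum⟩ := exists_finset_sum_of_mem_biSup _ I hu
  rcases s.eq_empty_or_nonempty with rfl | hs
  · exact Subtype.ext (by simpa using hsum)
  obtain ⟨m, ρ, r, hρ, hρr, hsρ, hr⟩ := exists_subset_closedBall_ball_subset hs hI hIc hsI
  obtain ⟨u₀, hu₀, hTu₀⟩ := hu₀
  have hlower := hT₀.mul_norm_le_norm_sub (hρ.trans_lt hρr) (fun x hx => hres x (hr hx)) u₀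
  rw [hu₀, hTu₀] at hlower
  have hupper := hT.norm_sub_le_mul_norm hρ hsρ g hsum
  have hzero : (r - ρ) * ‖(u : H)‖ ≤ 0 := by linarith
  exact Subtype.ext (norm_le_zero_iff.1 (nonpos_of_mul_nonpos_right hzero (sub_pos.2 hρr)))

theorem rank_eigenfunctionsIn_le (hT : IsSymmetric T) (hT₀ : IsSymmetric T₀) (hI : IsOpen I)
    (hIc : I.OrdConnected) (hres : ∀ x ∈ I, (x : ℂ) ∈ resolventSet T₀) {ι : Type*}
    [Fintype ι] (ℓ : T.domain →ₗ[ℂ] (ι → ℂ))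
    (hℓ : ∀ u : T.domain, ℓ u = 0 → ∃ u₀ : T₀.domain, (u₀ : H) = u ∧ T₀ u₀ = T u) :
    Module.rank ℂ (eigenfunctionsIn T I) ≤ Fintype.card ι := by
  let incl := Submodule.inclusion (eigenfunctionsIn_le_domain T I)
  have hinj : Function.Injective (ℓ ∘ₗ incl) := by
    rw [← LinearMap.ker_eq_bot, Submodule.eq_bot_iff]
    intro f hf
    have hzero := hT.eq_zero_of_mem_eigenfunctionsIn hT₀ hI hIc hres (u := incl f) f.2 (hℓ _ hf)
    exact Subtype.ext (congrArg (fun x : T.domain => (x : H)) hzero)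
  simpa using LinearMap.lift_rank_le_of_injective _ hinj

theorem mem_discreteSpectrum (hT : IsSymmetric T) (hI : IsOpen I) {n : ℕ}
    (hrank : Module.rank ℂ (eigenfunctionsIn T I) ≤ n)
    (hreg : ∀ x ∈ I, eigenspace T (x : ℂ) = ⊥ → (x : ℂ) ∈ resolventSet T) (hE : E ∈ I)
    (hspec : (E : ℂ) ∈ spectrum T) : (E : ℂ) ∈ discreteSpectrum T := by
  obtain ⟨x, -, hx⟩ := hT.exists_mem_resolventSet hI ⟨E, hE⟩ hrank hreg
  have hsub : Complex.re ⁻¹' I ∩ spectrum T ⊆ Complex.ofReal '' eigenvaluesIn T I := by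
    rintro w ⟨hwI, hw⟩
    have him : w.im = 0 := by_contra fun h => hw (hT.mem_resolventSet_of_im_ne_zero hx h)
    obtain ⟨y, rfl⟩ : ∃ y : ℝ, (y : ℂ) = w := ⟨w.re, Complex.ext rfl him.symm⟩
    exact ⟨y, ⟨hwI, fun h => hw (hreg y hwI h)⟩, rfl⟩
  have hfinite :=
    (Set.finite_of_encard_le_coe (hT.encard_eigenvaluesIn_le hrank)).image Complex.ofReal
  have : FiniteDimensional ℂ (eigenfunctionsIn T I) :=
    Module.rank_lt_aleph0_iff.1 (hrank.trans_lt Cardinal.natCast_lt_aleph0)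
  exact ⟨hspec, fun hacc => Set.Infinite.of_accPt (hacc.nhds_inter
      ((hI.preimage Complex.continuous_re).mem_nhds hE)) (hfinite.subset hsub),
    fun h => hspec (hreg E hE h),
    Submodule.finiteDimensional_of_le (eigenspace_le_eigenfunctionsIn hE)⟩

end IsSymmetric

end Hilbert

end UnboundedOperator

section LogDerivative

open MeasureTheory Set Filter Topology

theorem wronskian_eq_sub_mul_integral {E E' : ℝ} {w p w' p' : ℝ → ℝ}
    (hw : ∀ x, HasDerivAt w (p x) x) (hp : ∀ x, HasDerivAt p (-E * w x) x)
    (hw' : ∀ x, HasDerivAt w' (p' x) x) (hp' : ∀ x, HasDerivAt p' (-E' * w' x) x) {a : ℝ}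
    (ha : p a * w' a - w a * p' a = 0) (b : ℝ) :
    p b * w' b - w b * p' b = (E' - E) * ∫ x in a..b, w x * w' x := by
  have hc : Continuous fun x => w x * w' x :=
    (continuous_iff_continuousAt.2 fun x => (hw x).continuousAt).mul
      (continuous_iff_continuousAt.2 fun x => (hw' x).continuousAt)
  rw [← intervalIntegral.integral_const_mul, intervalIntegral.integral_eq_sub_of_hasDerivAt
    (f := fun x => p x * w' x - w x * p' x) (fun x _ => ?_)
    ((hc.const_mul _).intervalIntegrable a b), ha, sub_zero]
  exact (((hp x).mul (hw' x)).sub ((hw x).mul (hp' x))).congr_deriv (by ring)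

variable {w p : ℝ → ℝ → ℝ} {a b : ℝ}

theorem hasDerivAt_logDeriv (hcont : Continuous fun q : ℝ × ℝ => w q.1 q.2)
    (hw : ∀ E x, HasDerivAt (w E) (p E x) x) (hp : ∀ E x, HasDerivAt (p E) (-E * w E x) x)
    (ha : ∀ E E', p E a * w E' a - w E a * p E' a = 0) {E : ℝ} (hE : w E b ≠ 0) :
    HasDerivAt (fun E => p E b / w E b)
      (-((∫ x in a..b, w E x * w E x) / (w E b * w E b))) E := by
  have hw_left : Continuous fun E => w E b := hcont.comp (Continuous.prodMk_left b)
  have hquot : ContinuousAt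
      (fun E' => -((∫ x in a..b, w E' x * w E x) / (w E' b * w E b))) E := by
    refine (ContinuousAt.div ?_ (hw_left.mul continuous_const).continuousAt
      (mul_ne_zero hE hE)).neg
    refine (intervalIntegral.continuous_parametric_intervalIntegral_of_continuous'
      (f := fun E' x => w E' x * w E x) ?_ a b).continuousAt
    exact hcont.mul (hcont.comp (continuous_const.prodMk continuous_snd))
  rw [hasDerivAt_iff_tendsto_slope]
  refine (hquot.tendsto.mono_left nhdsWithin_le_nhds).congr' ?_
  filter_upwards [self_mem_nhdsWithin,
    nhdsWithin_le_nhds (hw_left.continuousAt.eventually_ne hE)] with E' hne hE'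
  have hsub : E' - E ≠ 0 := sub_ne_zero.2 hne
  have hgreen := wronskian_eq_sub_mul_integral (hw E) (hp E) (hw E') (hp E') (ha E E') b
  rw [slope_def_field]
  simp only [mul_comm (w E' _) (w E _)]
  field_simp
  linear_combination hgreen

theorem strictAntiOn_logDeriv (hab : a < b) (hcont : Continuous fun q : ℝ × ℝ => w q.1 q.2)
    (hw : ∀ E x, HasDerivAt (w E) (p E x) x) (hp : ∀ E x, HasDerivAt (p E) (-E * w E x) x)
    (ha : ∀ E E', p E a * w E' a - w E a * p E' a = 0) {K : Set ℝ} (hK : K.OrdConnected)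
    (hne : ∀ E ∈ K, w E b ≠ 0) : StrictAntiOn (fun E => p E b / w E b) K := by
  have hderiv (E : ℝ) (hE : E ∈ K) := hasDerivAt_logDeriv hcont hw hp ha (hne E hE)
  refine strictAntiOn_of_deriv_neg hK.convex
    (fun E hE => (hderiv E hE).continuousAt.continuousWithinAt) fun E hE => ?_
  have hE := interior_subset hE
  have hwE : Continuous (w E) := hcont.comp (Continuous.prodMk_right E)
  have hint : 0 < ∫ x in a..b, w E x * w E x :=
    intervalIntegral.integral_pos hab (hwE.mul hwE).continuousOn
      (fun x _ => mul_self_nonneg _) ⟨b, ⟨hab.le, le_rfl⟩, mul_self_pos.2 (hne E hE)⟩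
  rw [(hderiv E hE).deriv]
  exact neg_neg_of_pos (div_pos hint (mul_self_pos.2 (hne E hE)))

end LogDerivative

section Gaps

open Set

variable {l r : ℕ → ℝ}

/-- The gaps of the union of the increasing sequence of intervals `[l m, r m]`, numbered from
`0`: the `m`-th gap lies directly below `[l m, r m]`. -/
def gapSet (l r : ℕ → ℝ) : ℕ → Set ℝ
  | 0 => Iio (l 0)
  | m + 1 => Ioo (r m) (l (m + 1))

theorem ordConnected_gapSet (l r : ℕ → ℝ) : ∀ m, (gapSet l r m).OrdConnected
  | 0 => ordConnected_Iio
  | _ + 1 => ordConnected_Ioo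

theorem isOpen_gapSet (l r : ℕ → ℝ) : ∀ m, IsOpen (gapSet l r m)
  | 0 => isOpen_Iio
  | _ + 1 => isOpen_Ioo

theorem lt_of_mem_gapSet : ∀ {m : ℕ} {x : ℝ}, x ∈ gapSet l r m → x < l m
  | 0, _, hx => hx
  | _ + 1, _, hx => hx.2

theorem nonempty_gapSet (hrl : ∀ m, r m < l (m + 1)) : ∀ m, (gapSet l r m).Nonempty
  | 0 => nonempty_Iio
  | _ + 1 => nonempty_Ioo.2 (hrl _)

theorem strictMono_of_interlacing (hlr : ∀ m, l m ≤ r m) (hrl : ∀ m, r m < l (m + 1)) :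
    StrictMono l :=
  strictMono_nat_of_lt_succ fun m => (hlr m).trans_lt (hrl m)

theorem right_lt_of_mem_gapSet (hlr : ∀ m, l m ≤ r m) (hrl : ∀ m, r m < l (m + 1)) {i m : ℕ}
    (him : i < m) {x : ℝ} (hx : x ∈ gapSet l r m) : r i < x := by
  obtain ⟨k, rfl⟩ : ∃ k, m = k + 1 := ⟨m - 1, by omega⟩
  rcases Nat.lt_or_eq_of_le (Nat.lt_succ_iff.1 him) with h | rfl
  · calc r i < l (i + 1) := hrl i
      _ ≤ l k := (strictMono_of_interlacing hlr hrl).monotone h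
      _ ≤ r k := hlr k
      _ < x := hx.1
  · exact hx.1

theorem lt_of_mem_gapSet_of_lt (hlr : ∀ m, l m ≤ r m) (hrl : ∀ m, r m < l (m + 1)) {i j : ℕ}
    (hij : i < j) {x y : ℝ} (hx : x ∈ gapSet l r i) (hy : y ∈ gapSet l r j) : x < y :=
  (lt_of_mem_gapSet hx).trans_le ((hlr i).trans (right_lt_of_mem_gapSet hlr hrl hij hy).le)

theorem gapSet_injective (hlr : ∀ m, l m ≤ r m) (hrl : ∀ m, r m < l (m + 1)) :
    Function.Injective (gapSet l r) := by
  intro i j hij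
  obtain ⟨x, hx⟩ := nonempty_gapSet (r := r) hrl i
  have hx' : x ∈ gapSet l r j := hij ▸ hx
  by_contra hne
  rcases lt_or_gt_of_ne hne with h | h
  · exact (lt_of_mem_gapSet_of_lt hlr hrl h hx hx').false
  · exact (lt_of_mem_gapSet_of_lt hlr hrl h hx' hx).false

theorem disjoint_gapSet (hlr : ∀ m, l m ≤ r m) (hrl : ∀ m, r m < l (m + 1)) (m : ℕ) :
    Disjoint (gapSet l r m) (⋃ k, Icc (l k) (r k)) := by
  refine disjoint_left.2 fun x hx h => ?_
  obtain ⟨k, hk⟩ := mem_iUnion.1 h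
  rcases lt_or_ge k m with h | h
  · exact hk.2.not_gt (right_lt_of_mem_gapSet hlr hrl h hx)
  · exact hk.1.not_gt ((lt_of_mem_gapSet hx).trans_le
      ((strictMono_of_interlacing hlr hrl).monotone h))

theorem exists_mem_gapSet (hl : ∀ x, ∃ m, x < l m) {x : ℝ} (hx : x ∉ ⋃ k, Icc (l k) (r k)) :
    ∃ m, x ∈ gapSet l r m := by
  classical
  refine ⟨Nat.find (hl x), ?_⟩
  have hspec := Nat.find_spec (hl x)
  rcases hfind : Nat.find (hl x) with _ | m <;> rw [hfind] at hspec
  · exact hspec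
  · refine ⟨?_, hspec⟩
    have hmin := Nat.find_min (hl x) (m := m) (by omega)
    by_contra! hle
    exact hx (mem_iUnion.2 ⟨m, not_lt.1 hmin, hle⟩)

theorem connectedComponentIn_eq_gapSet (hlr : ∀ m, l m ≤ r m) (hrl : ∀ m, r m < l (m + 1))
    (hl : ∀ x, ∃ m, x < l m) {m : ℕ} {x : ℝ} (hx : x ∈ gapSet l r m) :
    connectedComponentIn (⋃ k, Icc (l k) (r k))ᶜ x = gapSet l r m := by
  set S := ⋃ k, Icc (l k) (r k)
  have hmem (k : ℕ) : l k ∈ S := mem_iUnion.2 ⟨k, le_rfl, hlr k⟩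
  have hsub : gapSet l r m ⊆ Sᶜ := fun y hy => disjoint_left.1 (disjoint_gapSet hlr hrl m) hy
  refine Subset.antisymm (fun y hy => ?_)
    ((ordConnected_gapSet l r m).isPreconnected.subset_connectedComponentIn hx hsub)
  have hoc := (isPreconnected_connectedComponentIn (x := x) (F := Sᶜ)).ordConnected
  have hxc := mem_connectedComponentIn (hsub hx)
  have hcS := connectedComponentIn_subset Sᶜ x
  obtain ⟨k, hk⟩ := exists_mem_gapSet hl (hcS hy)
  rcases lt_trichotomy k m with h | rfl | h
  · exact absurd (hmem k) (hcS (hoc.out hy hxc ⟨(lt_of_mem_gapSet hk).le,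
      (hlr k).trans (right_lt_of_mem_gapSet hlr hrl h hx).le⟩))
  · exact hk
  · exact absurd (hmem m) (hcS (hoc.out hxc hy ⟨(lt_of_mem_gapSet hx).le,
      (hlr m).trans (right_lt_of_mem_gapSet hlr hrl h hk).le⟩))

theorem isGap_iUnion_Icc_iff (hlr : ∀ m, l m ≤ r m) (hrl : ∀ m, r m < l (m + 1))
    (hl : ∀ x, ∃ m, x < l m) {I : Set ℝ} :
    IsGap (⋃ k, Icc (l k) (r k)) I ↔ ∃ m, I = gapSet l r m := by
  constructor
  · rintro ⟨x, hx, rfl⟩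
    obtain ⟨m, hm⟩ := exists_mem_gapSet hl hx
    exact ⟨m, connectedComponentIn_eq_gapSet hlr hrl hl hm⟩
  · rintro ⟨m, rfl⟩
    obtain ⟨x, hx⟩ := nonempty_gapSet hrl m
    exact ⟨x, disjoint_left.1 (disjoint_gapSet hlr hrl m) hx,
      (connectedComponentIn_eq_gapSet hlr hrl hl hx).symm⟩

theorem setOf_isGap_lt_gapSet (hlr : ∀ m, l m ≤ r m) (hrl : ∀ m, r m < l (m + 1))
    (hl : ∀ x, ∃ m, x < l m) (m : ℕ) :
    {J | IsGap (⋃ k, Icc (l k) (r k)) J ∧ ∀ x ∈ J, ∀ y ∈ gapSet l r m, x < y} =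
      gapSet l r '' Iio m := by
  ext J
  constructor
  · rintro ⟨hJ, hJm⟩
    obtain ⟨i, rfl⟩ := (isGap_iUnion_Icc_iff hlr hrl hl).1 hJ
    refine ⟨i, mem_Iio.2 (not_le.1 fun hmi => ?_), rfl⟩
    obtain ⟨x, hx⟩ := nonempty_gapSet (r := r) hrl i
    obtain ⟨y, hy⟩ := nonempty_gapSet (r := r) hrl m
    rcases hmi.lt_or_eq with h | rfl
    · exact (lt_of_mem_gapSet_of_lt hlr hrl h hy hx).asymm (hJm x hx y hy)
    · exact (hJm x hx x hx).false
  · rintro ⟨i, hi, rfl⟩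
    exact ⟨(isGap_iUnion_Icc_iff hlr hrl hl).2 ⟨i, rfl⟩,
      fun x hx y hy => lt_of_mem_gapSet_of_lt hlr hrl hi hx hy⟩

theorem IsNthGap.exists_eq_gapSet (hlr : ∀ m, l m ≤ r m) (hrl : ∀ m, r m < l (m + 1))
    (hl : ∀ x, ∃ m, x < l m) {n : ℕ} {I : Set ℝ} (h : IsNthGap (⋃ k, Icc (l k) (r k)) n I) :
    ∃ m, n = m + 1 ∧ I = gapSet l r m := by
  obtain ⟨hI, hcard⟩ := h
  obtain ⟨m, rfl⟩ := (isGap_iUnion_Icc_iff hlr hrl hl).1 hI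
  rw [setOf_isGap_lt_gapSet hlr hrl hl, (gapSet_injective hlr hrl).encard_image,
    ← Finset.coe_Iio, encard_coe_eq_coe_finsetCard, Nat.card_Iio] at hcard
  exact ⟨m, by exact_mod_cast hcard.symm, rfl⟩

end Gaps

namespace MagneticChain

open MeasureTheory Set Filter Topology UnboundedOperator
open scoped Interval

section FundamentalSolutions

variable {E x : ℝ}

/-- The solution `C` of `-w'' = E w` with `w 0 = 1` and `w' 0 = 0`. One of the two factors is
always `1`, since `√` vanishes on negative numbers: `cosE E x` is `cos (√E x)` for `0 ≤ E` and
`cosh (√(-E) x)` for `E ≤ 0`. -/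
noncomputable def cosE (E x : ℝ) : ℝ := Real.cos (√E * x) * Real.cosh (√(-E) * x)

/-- The solution `S` of `-w'' = E w` with `w 0 = 0` and `w' 0 = 1`. -/
noncomputable def sinE (E x : ℝ) : ℝ := ∫ t in (0 : ℝ)..x, cosE E t

theorem continuous_uncurry_cosE : Continuous fun p : ℝ × ℝ => cosE p.1 p.2 := by
  unfold cosE; fun_prop

theorem continuous_uncurry_sinE : Continuous fun p : ℝ × ℝ => sinE p.1 p.2 :=
  intervalIntegral.continuous_parametric_primitive_of_continuous (f := cosE) continuous_uncurry_cosE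

theorem continuous_cosE (E : ℝ) : Continuous (cosE E) :=
  continuous_uncurry_cosE.comp (Continuous.prodMk_right E)

theorem continuous_sinE (E : ℝ) : Continuous (sinE E) :=
  continuous_uncurry_sinE.comp (Continuous.prodMk_right E)

theorem continuous_cosE_left (x : ℝ) : Continuous fun E => cosE E x :=
  continuous_uncurry_cosE.comp (Continuous.prodMk_left x)

theorem continuous_sinE_left (x : ℝ) : Continuous fun E => sinE E x :=
  continuous_uncurry_sinE.comp (Continuous.prodMk_left x)

@[simp] theorem cosE_zero_right (E : ℝ) : cosE E 0 = 1 := by simp [cosE]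

@[simp] theorem sinE_zero_right (E : ℝ) : sinE E 0 = 0 := by simp [sinE]

theorem cosE_of_nonneg (h : 0 ≤ E) (x : ℝ) : cosE E x = Real.cos (√E * x) := by
  simp [cosE, Real.sqrt_eq_zero_of_nonpos (neg_nonpos.2 h)]

theorem cosE_of_nonpos (h : E ≤ 0) (x : ℝ) : cosE E x = Real.cosh (√(-E) * x) := by
  simp [cosE, Real.sqrt_eq_zero_of_nonpos h]

theorem hasDerivAt_sinE (E x : ℝ) : HasDerivAt (sinE E) (cosE E x) x :=
  ((continuous_cosE E).integral_hasStrictDerivAt 0 x).hasDerivAt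

theorem sqrt_mul_sinE (h : 0 ≤ E) (x : ℝ) : √E * sinE E x = Real.sin (√E * x) := by
  simp only [sinE, cosE_of_nonneg h, intervalIntegral.mul_integral_comp_mul_left, integral_cos,
    mul_zero, Real.sin_zero, sub_zero]

theorem sqrt_neg_mul_sinE (h : E ≤ 0) (x : ℝ) : √(-E) * sinE E x = Real.sinh (√(-E) * x) := by
  simp only [sinE, cosE_of_nonpos h, intervalIntegral.mul_integral_comp_mul_left]
  rw [intervalIntegral.integral_eq_sub_of_hasDerivAt (fun t _ => Real.hasDerivAt_sinh t)
    (Real.continuous_cosh.intervalIntegrable _ _), mul_zero, Real.sinh_zero, sub_zero]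

theorem hasDerivAt_cosE (E x : ℝ) : HasDerivAt (cosE E) (-E * sinE E x) x := by
  rcases le_total 0 E with h | h
  · rw [funext (cosE_of_nonneg h)]
    refine (((hasDerivAt_id x).const_mul √E).cos).congr_deriv ?_
    simp only [id_eq, mul_one]
    rw [← sqrt_mul_sinE h]
    linear_combination (-sinE E x) * Real.mul_self_sqrt h
  · rw [funext (cosE_of_nonpos h)]
    refine (((hasDerivAt_id x).const_mul √(-E)).cosh).congr_deriv ?_
    simp only [id_eq, mul_one]
    rw [← sqrt_neg_mul_sinE h]
    linear_combination sinE E x * Real.mul_self_sqrt (neg_nonneg.2 h)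

theorem eq_of_forall_hasDerivAt_zero {f : ℝ → ℝ} (h : ∀ x, HasDerivAt f 0 x) (x y : ℝ) :
    f x = f y :=
  is_const_of_deriv_eq_zero (fun z => (h z).differentiableAt) (fun z => (h z).deriv) x y

theorem cosE_sq_add (E x : ℝ) : cosE E x ^ 2 + E * sinE E x ^ 2 = 1 := by
  have hconst (z : ℝ) : HasDerivAt (fun t => cosE E t ^ 2 + E * sinE E t ^ 2) 0 z := by
    refine (((hasDerivAt_cosE E z).pow 2).add
      (((hasDerivAt_sinE E z).pow 2).const_mul E)).congr_deriv ?_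
    ring
  simpa using eq_of_forall_hasDerivAt_zero hconst x 0

theorem eq_cosE_add_sinE {w v : ℝ → ℝ} (hw : ∀ x, HasDerivAt w (v x) x)
    (hv : ∀ x, HasDerivAt v (-E * w x) x) (x : ℝ) :
    w x = w 0 * cosE E x + v 0 * sinE E x := by
  have hval (z : ℝ) : HasDerivAt (fun t => w t * cosE E t - v t * sinE E t) 0 z := by
    refine (((hw z).mul (hasDerivAt_cosE E z)).sub
      ((hv z).mul (hasDerivAt_sinE E z))).congr_deriv ?_
    ring
  have hslope (z : ℝ) : HasDerivAt (fun t => E * (w t * sinE E t) + v t * cosE E t) 0 z := by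
    refine ((((hw z).mul (hasDerivAt_sinE E z)).const_mul E).add
      ((hv z).mul (hasDerivAt_cosE E z))).congr_deriv ?_
    ring
  have h1 := eq_of_forall_hasDerivAt_zero hval x 0
  have h2 := eq_of_forall_hasDerivAt_zero hslope x 0
  simp only [cosE_zero_right, sinE_zero_right, mul_zero, mul_one, sub_zero, zero_add] at h1 h2
  linear_combination cosE E x * h1 + sinE E x * h2 - w x * cosE_sq_add E x

theorem cosE_add (E x y : ℝ) :
    cosE E (x + y) = cosE E x * cosE E y - E * (sinE E x * sinE E y) := by
  have h := eq_cosE_add_sinE (fun t => (hasDerivAt_cosE E (x + t)).comp_const_add x t)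
    (fun t => ((hasDerivAt_sinE E (x + t)).comp_const_add x t).const_mul (-E)) y
  rw [add_zero] at h
  linear_combination h

theorem sinE_add (E x y : ℝ) : sinE E (x + y) = sinE E x * cosE E y + cosE E x * sinE E y := by
  have h := eq_cosE_add_sinE (fun t => (hasDerivAt_sinE E (x + t)).comp_const_add x t)
    (fun t => (hasDerivAt_cosE E (x + t)).comp_const_add x t) y
  rwa [add_zero] at h

theorem one_le_cosE (h : E ≤ 0) (x : ℝ) : 1 ≤ cosE E x :=
  cosE_of_nonpos h x ▸ Real.one_le_cosh _

theorem sinE_pos_of_nonpos (h : E ≤ 0) (hx : 0 < x) : 0 < sinE E x :=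
  intervalIntegral.intervalIntegral_pos_of_pos ((continuous_cosE E).intervalIntegrable _ _)
    (fun t => zero_lt_one.trans_le (one_le_cosE h t)) hx

theorem sqrt_neg_mul_sinE_le (h : E ≤ 0) (x : ℝ) : √(-E) * sinE E x ≤ cosE E x := by
  rw [sqrt_neg_mul_sinE h, cosE_of_nonpos h]
  exact (Real.sinh_lt_cosh _).le

theorem cosE_sq_pi (n : ℕ) : cosE ((n : ℝ) ^ 2) Real.pi = (-1) ^ n := by
  rw [cosE_of_nonneg (by positivity), Real.sqrt_sq (by positivity), Real.cos_nat_mul_pi]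

theorem sinE_sq_pi {n : ℕ} (hn : n ≠ 0) : sinE ((n : ℝ) ^ 2) Real.pi = 0 := by
  have h := sqrt_mul_sinE (E := (n : ℝ) ^ 2) (by positivity) Real.pi
  rw [Real.sqrt_sq (by positivity), Real.sin_nat_mul_pi] at h
  exact (mul_eq_zero.1 h).resolve_left (Nat.cast_ne_zero.2 hn)

theorem neg_one_pow_mul_sinE_pi_pos {n : ℕ} (h : (n : ℝ) ^ 2 < E) (h' : E < ((n : ℝ) + 1) ^ 2) :
    0 < (-1) ^ n * sinE E Real.pi := by
  have hE : 0 < E := lt_of_le_of_lt (by positivity) h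
  have hlo : (n : ℝ) < √E := Real.lt_sqrt_of_sq_lt h
  have hhi : √E < n + 1 := (Real.sqrt_lt' (by positivity)).2 h'
  have hsin : 0 < Real.sin (√E * Real.pi - n * Real.pi) :=
    Real.sin_pos_of_pos_of_lt_pi (by nlinarith [Real.pi_pos]) (by nlinarith [Real.pi_pos])
  rw [Real.sin_sub_nat_mul_pi, ← sqrt_mul_sinE hE.le, mul_left_comm] at hsin
  exact pos_of_mul_pos_right hsin (Real.sqrt_nonneg E)

theorem sinE_pi_pos_of_lt_one (h : E < 1) : 0 < sinE E Real.pi := by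
  rcases le_or_gt E 0 with h0 | h0
  · exact sinE_pos_of_nonpos h0 Real.pi_pos
  · simpa using neg_one_pow_mul_sinE_pi_pos (n := 0) (E := E) (by simpa using h0) (by simpa using h)

theorem exists_nat_sq_le (hE : 1 ≤ E) :
    ∃ n : ℕ, n ≠ 0 ∧ (n : ℝ) ^ 2 ≤ E ∧ E < ((n : ℝ) + 1) ^ 2 := by
  refine ⟨⌊√E⌋₊, (Nat.floor_pos.2 (Real.one_le_sqrt.2 hE)).ne', ?_, ?_⟩
  · exact (Real.le_sqrt (by positivity) (by linarith)).1 (Nat.floor_le (Real.sqrt_nonneg E))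
  · exact (Real.sqrt_lt' (by positivity)).1 (Nat.lt_floor_add_one √E)

theorem sinE_pi_eq_zero_iff : sinE E Real.pi = 0 ↔ ∃ n : ℕ, n ≠ 0 ∧ E = (n : ℝ) ^ 2 := by
  refine ⟨fun hS => ?_, fun ⟨n, hn, hE⟩ => hE ▸ sinE_sq_pi hn⟩
  rcases lt_or_ge E 1 with h | h
  · exact absurd hS (sinE_pi_pos_of_lt_one h).ne'
  · obtain ⟨n, hn, hle, hlt⟩ := exists_nat_sq_le h
    refine ⟨n, hn, by_contra fun hne => ?_⟩
    have hpos := neg_one_pow_mul_sinE_pi_pos (lt_of_le_of_ne' hle hne) hlt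
    rw [hS, mul_zero] at hpos
    exact lt_irrefl _ hpos

end FundamentalSolutions

section EdgeFunctions

/-- Lebesgue measure on the interval `(0, π)`. -/
noncomputable abbrev edgeMeasure : Measure ℝ := volume.restrict (Ioo (0 : ℝ) Real.pi)

theorem zero_mem_Icc_pi : (0 : ℝ) ∈ Icc (0 : ℝ) Real.pi := ⟨le_rfl, Real.pi_pos.le⟩

theorem pi_mem_Icc_pi : Real.pi ∈ Icc (0 : ℝ) Real.pi := ⟨Real.pi_pos.le, le_rfl⟩

theorem uIcc_zero_pi : uIcc 0 Real.pi = Icc 0 Real.pi := uIcc_of_le Real.pi_pos.le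

theorem restrict_uIoc_zero_pi : volume.restrict (Ι 0 Real.pi) = edgeMeasure := by
  rw [uIoc_of_le Real.pi_pos.le, edgeMeasure, restrict_Ioo_eq_restrict_Ioc]

theorem integral_zero_pi_eq {F : Type*} [NormedAddCommGroup F] [NormedSpace ℝ F] (φ : ℝ → F) :
    ∫ x in (0 : ℝ)..Real.pi, φ x = ∫ x, φ x ∂edgeMeasure := by
  rw [intervalIntegral.integral_of_le Real.pi_pos.le, edgeMeasure, restrict_Ioo_eq_restrict_Ioc]

theorem intervalIntegral_congr_edgeMeasure {φ ψ : ℝ → ℂ} (h : φ =ᵐ[edgeMeasure] ψ) :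
    ∫ x in (0 : ℝ)..Real.pi, φ x = ∫ x in (0 : ℝ)..Real.pi, ψ x := by
  rw [integral_zero_pi_eq, integral_zero_pi_eq, integral_congr_ae h]

theorem ae_edgeMeasure_of_forall {p : ℝ → Prop} (h : ∀ x ∈ Icc (0 : ℝ) Real.pi, p x) :
    ∀ᵐ x ∂edgeMeasure, p x :=
  (ae_restrict_mem measurableSet_Ioo).mono fun x hx => h x (Ioo_subset_Icc_self hx)

variable {φ : ℝ → ℂ} {f : EdgeL2} {B M : ℝ}

theorem EdgeL2.exists_ae_eq (h : ContinuousOn φ (Icc 0 Real.pi)) :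
    ∃ f : EdgeL2, (f : ℝ → ℂ) =ᵐ[edgeMeasure] φ := by
  obtain ⟨M, hM⟩ := isCompact_Icc.exists_bound_of_continuousOn h
  have hφ : MemLp φ 2 edgeMeasure := MemLp.of_bound
    ((h.mono Ioo_subset_Icc_self).aestronglyMeasurable measurableSet_Ioo) M
    (ae_edgeMeasure_of_forall hM)
  exact ⟨hφ.toLp φ, hφ.coeFn_toLp⟩

theorem EdgeL2.norm_le_of_forall_le (hB : 0 ≤ B) (hf : (f : ℝ → ℂ) =ᵐ[edgeMeasure] φ)
    (hφ : ∀ x ∈ Icc (0 : ℝ) Real.pi, ‖φ x‖ ≤ B) : ‖f‖ ≤ √Real.pi * B := by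
  have hae : ∀ᵐ x ∂edgeMeasure, ‖f x‖ ≤ B := by
    filter_upwards [hf, ae_edgeMeasure_of_forall hφ] with x h1 h2
    rwa [h1]
  refine (Lp.norm_le_of_ae_bound hB hae).trans_eq ?_
  simp [measureUnivNNReal, Real.sqrt_eq_rpow, ENNReal.coe_toNNReal_eq_toReal, Real.pi_pos.le]

theorem EdgeL2.integral_norm_le (r : EdgeL2) :
    ∫ x in (0 : ℝ)..Real.pi, ‖r x‖ ≤ √Real.pi * ‖r‖ := by
  have h := integral_norm_le_sqrt_mul_norm r
  rwa [measureReal_restrict_apply_univ, Real.volume_real_Ioo_of_le Real.pi_pos.le, sub_zero,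
    ← integral_zero_pi_eq] at h

theorem EdgeL2.intervalIntegrable_zero_pi (r : EdgeL2) : IntervalIntegrable r volume 0 Real.pi :=
  r.intervalIntegrable zero_mem_Icc_pi pi_mem_Icc_pi

theorem EdgeL2.intervalIntegrable_mul (hφ : ContinuousOn φ (Icc 0 Real.pi)) (r : EdgeL2) :
    IntervalIntegrable (fun x => φ x * r x) volume 0 Real.pi :=
  r.intervalIntegrable_zero_pi.continuousOn_mul (by rwa [uIcc_zero_pi])

theorem EdgeL2.norm_integral_mul_le (hφ : ∀ x ∈ Icc (0 : ℝ) Real.pi, ‖φ x‖ ≤ M) (r : EdgeL2) :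
    ‖∫ x in (0 : ℝ)..Real.pi, φ x * r x‖ ≤ M * √Real.pi * ‖r‖ := by
  have hM : 0 ≤ M := (norm_nonneg _).trans (hφ 0 zero_mem_Icc_pi)
  rw [mul_assoc]
  exact (norm_integral_mul_le_mul_integral_norm hφ r.intervalIntegrable_zero_pi pi_mem_Icc_pi).trans
    (mul_le_mul_of_nonneg_left r.integral_norm_le hM)

theorem EdgeL2.coeFn_smul_add (E : ℂ) (f r : EdgeL2) :
    ((E • f + r : EdgeL2) : ℝ → ℂ) =ᵐ[edgeMeasure] fun x => E * f x + r x := by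
  filter_upwards [Lp.coeFn_add (E • f) r, Lp.coeFn_smul E f] with x h1 h2
  rw [h1, Pi.add_apply, h2, Pi.smul_apply, smul_eq_mul]

theorem IsH2.isPrimitive₂ {u v : ℝ → ℂ} {g : EdgeL2} (h : IsH2 u v g) :
    IsPrimitive v g 0 Real.pi :=
  ⟨g.intervalIntegrable_zero_pi, by rw [uIcc_zero_pi]; exact h.deriv₂⟩

theorem IsH2.isPrimitive {u v : ℝ → ℂ} {g : EdgeL2} (h : IsH2 u v g) :
    IsPrimitive u v 0 Real.pi :=
  IsPrimitive.of_hasDerivWithinAt (by rw [uIcc_zero_pi]; exact h.deriv) h.isPrimitive₂.continuousOn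

theorem isH2_of_isPrimitive {u v : ℝ → ℂ} {g : EdgeL2} (hu : IsPrimitive u v 0 Real.pi)
    (hv : IsPrimitive v g 0 Real.pi) : IsH2 u v g where
  deriv x hx := by
    rw [← uIcc_zero_pi] at hx ⊢
    exact hu.hasDerivWithinAt hv.continuousOn hx
  deriv₂ x hx := hv.eq_add_integral x (by rwa [uIcc_zero_pi])

end EdgeFunctions

section Phase

/-- The gauge factor `e^{iax}`: conjugation by it turns `d/dx + i a` into `d/dx`. -/
noncomputable def phase (a x : ℝ) : ℂ := Complex.exp (Complex.I * a * x)

theorem phase_zero (a : ℝ) : phase a 0 = 1 := by simp [phase]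

theorem phase_neg_mul_phase (a x : ℝ) : phase (-a) x * phase a x = 1 := by
  rw [phase, phase, ← Complex.exp_add]; simp

theorem conj_phase (a x : ℝ) : starRingEnd ℂ (phase a x) = phase (-a) x := by
  rw [phase, phase, ← Complex.exp_conj]; simp

theorem norm_phase (a x : ℝ) : ‖phase a x‖ = 1 := by
  rw [phase, show Complex.I * a * x = ((a * x : ℝ) : ℂ) * Complex.I by push_cast; ring]
  exact Complex.norm_exp_ofReal_mul_I _

theorem continuous_phase (a : ℝ) : Continuous (phase a) := by unfold phase; fun_prop

theorem EdgeL2.intervalIntegrable_mul_phase {φ : ℝ → ℂ} (hφ : ContinuousOn φ (Icc 0 Real.pi))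
    (a : ℝ) (r : EdgeL2) : IntervalIntegrable (fun x => φ x * phase a x * r x) volume 0 Real.pi :=
  r.intervalIntegrable_mul (hφ.mul (continuous_phase a).continuousOn)

theorem isPrimitive_phase (a b c : ℝ) :
    IsPrimitive (phase a) (fun x => Complex.I * a * phase a x) b c := by
  refine IsPrimitive.of_hasDerivAt (fun x => ?_) (continuous_const.mul (continuous_phase a))
  have h : HasDerivAt (fun x : ℝ => Complex.I * a * (x : ℂ)) (Complex.I * a) x := by
    simpa using (Complex.ofRealCLM.hasDerivAt (x := x)).const_mul (Complex.I * (a : ℂ))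
  exact h.cexp.congr_deriv (by rw [phase]; ring)

end Phase

section FundamentalSolutions

variable (E b c d : ℝ)

theorem isPrimitive_cosE :
    IsPrimitive (fun x => (cosE E x : ℂ)) (fun x => -E * (sinE E x : ℂ)) b c := by
  simpa using (IsPrimitive.of_hasDerivAt (hasDerivAt_cosE E)
    ((continuous_sinE E).const_mul (-E))).ofReal (𝕜 := ℂ) (a := b) (b := c)

theorem isPrimitive_sinE : IsPrimitive (fun x => (sinE E x : ℂ)) (fun x => (cosE E x : ℂ)) b c :=
  (IsPrimitive.of_hasDerivAt (hasDerivAt_sinE E) (continuous_cosE E)).ofReal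

theorem isPrimitive_cosE_const_sub :
    IsPrimitive (fun x => (cosE E (d - x) : ℂ)) (fun x => E * (sinE E (d - x) : ℂ)) b c := by
  have hd (x : ℝ) : HasDerivAt (fun x => cosE E (d - x)) (E * sinE E (d - x)) x :=
    ((hasDerivAt_cosE E (d - x)).comp_const_sub d x).congr_deriv (by ring)
  simpa using (IsPrimitive.of_hasDerivAt hd
    (((continuous_sinE E).comp (by fun_prop)).const_mul E)).ofReal (𝕜 := ℂ) (a := b) (b := c)

theorem isPrimitive_sinE_const_sub :
    IsPrimitive (fun x => (sinE E (d - x) : ℂ)) (fun x => -(cosE E (d - x) : ℂ)) b c := by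
  have hd (x : ℝ) : HasDerivAt (fun x => sinE E (d - x)) (-cosE E (d - x)) x :=
    (hasDerivAt_sinE E (d - x)).comp_const_sub d x
  simpa using (IsPrimitive.of_hasDerivAt hd
    ((continuous_cosE E).comp (by fun_prop)).neg).ofReal (𝕜 := ℂ) (a := b) (b := c)

end FundamentalSolutions

section EdgeAction

/-- `h = -D² f` on a single edge with `D = d/dx + i a`: the part of `IsAction` that concerns one
edge only. -/
structure IsEdgeAction (a : ℝ) (f h : EdgeL2) (u v : ℝ → ℂ) (g : EdgeL2) : Prop where
  sobolev : IsH2 u v g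
  repr : (f : ℝ → ℂ) =ᵐ[edgeMeasure] u
  action : (h : ℝ → ℂ) =ᵐ[edgeMeasure] fun x =>
    -(g x + 2 * Complex.I * (a : ℂ) * v x - (a : ℂ) ^ 2 * u x)

theorem IsAction.edge {A : ℝ} {α : ℤ → ℝ} {f h : ChainL2} {u v : Edge → ℝ → ℂ} {g : Edge → EdgeL2}
    (H : IsAction A α f h u v g) (e : Edge) :
    IsEdgeAction (pot A e) (f e) (h e) (u e) (v e) (g e) :=
  ⟨H.sobolev e, H.repr e, H.action e⟩

namespace IsEdgeAction

variable {a E : ℝ} {f h g f' h' g' r : EdgeL2} {u v u' v' p p₁ p₂ : ℝ → ℂ}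

theorem isPrimitive_gauge (H : IsEdgeAction a f h u v g) :
    IsPrimitive (fun x => phase a x * u x)
      (fun x => phase a x * (v x + Complex.I * a * u x)) 0 Real.pi :=
  ((isPrimitive_phase a 0 Real.pi).mul H.sobolev.isPrimitive).congr (fun _ _ => rfl)
    (Eventually.of_forall fun x => by ring)

theorem isPrimitive_gauge₂ (H : IsEdgeAction a f h u v g) :
    IsPrimitive (fun x => phase a x * (v x + Complex.I * a * u x))
      (fun x => -(phase a x * h x)) 0 Real.pi := by
  refine ((isPrimitive_phase a 0 Real.pi).mul (H.sobolev.isPrimitive₂.add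
    (H.sobolev.isPrimitive.const_mul (Complex.I * a)))).congr (fun _ _ => rfl) ?_
  rw [restrict_uIoc_zero_pi]
  filter_upwards [H.action] with x hx
  rw [hx]
  linear_combination (-(phase a x) * a ^ 2 * u x) * Complex.I_sq

theorem integral_mul_add_integral_mul (H : IsEdgeAction a f h u v g)
    (hp : IsPrimitive p p₁ 0 Real.pi) (hp₁ : IsPrimitive p₁ p₂ 0 Real.pi)
    (hp₂ : ContinuousOn p₂ (Icc 0 Real.pi)) :
    (∫ x in (0 : ℝ)..Real.pi, (p x * phase a x) * h x) +
        ∫ x in (0 : ℝ)..Real.pi, (p₂ x * phase a x) * f x =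
      ((v 0 + Complex.I * a * u 0) * p 0 - u 0 * p₁ 0) - phase a Real.pi *
        ((v Real.pi + Complex.I * a * u Real.pi) * p Real.pi - u Real.pi * p₁ Real.pi) := by
  have hpc : ContinuousOn p (Icc 0 Real.pi) := uIcc_zero_pi ▸ hp.continuousOn
  have hgreen := H.isPrimitive_gauge.integral_green H.isPrimitive_gauge₂ hp hp₁
  have hae : ∫ x in (0 : ℝ)..Real.pi, ((p x * phase a x) * h x + (p₂ x * phase a x) * f x) =
      -∫ x in (0 : ℝ)..Real.pi, (-(phase a x * h x) * p x - phase a x * u x * p₂ x) := by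
    rw [← intervalIntegral.integral_neg]
    refine intervalIntegral_congr_edgeMeasure ?_
    filter_upwards [H.repr] with x hx
    rw [hx]
    ring
  rw [← intervalIntegral.integral_add (h.intervalIntegrable_mul_phase hpc a)
    (f.intervalIntegrable_mul_phase hp₂ a), hae, hgreen, phase_zero]
  ring

theorem integral_mul_of_eq_neg_mul (H : IsEdgeAction a f ((E : ℂ) • f + r) u v g)
    (hp : IsPrimitive p p₁ 0 Real.pi) (hp₁ : IsPrimitive p₁ (fun x => -E * p x) 0 Real.pi) :
    ∫ x in (0 : ℝ)..Real.pi, (p x * phase a x) * r x =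
      ((v 0 + Complex.I * a * u 0) * p 0 - u 0 * p₁ 0) - phase a Real.pi *
        ((v Real.pi + Complex.I * a * u Real.pi) * p Real.pi - u Real.pi * p₁ Real.pi) := by
  have hpc : ContinuousOn p (Icc 0 Real.pi) := uIcc_zero_pi ▸ hp.continuousOn
  have hc : ContinuousOn (fun x => -E * p x) (Icc 0 Real.pi) := continuousOn_const.mul hpc
  rw [← H.integral_mul_add_integral_mul hp hp₁ hc, ← intervalIntegral.integral_add
    (EdgeL2.intervalIntegrable_mul_phase hpc a _) (f.intervalIntegrable_mul_phase hc a)]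
  refine intervalIntegral_congr_edgeMeasure ?_
  filter_upwards [EdgeL2.coeFn_smul_add E f r] with x hx
  rw [hx]
  ring

theorem phase_mul_value_pi (H : IsEdgeAction a f ((E : ℂ) • f + r) u v g) :
    phase a Real.pi * u Real.pi = cosE E Real.pi * u 0 +
      sinE E Real.pi * (v 0 + Complex.I * a * u 0) -
      ∫ x in (0 : ℝ)..Real.pi, (sinE E (Real.pi - x) * phase a x) * r x := by
  rw [H.integral_mul_of_eq_neg_mul (isPrimitive_sinE_const_sub E 0 Real.pi Real.pi)
    ((isPrimitive_cosE_const_sub E 0 Real.pi Real.pi).const_mul (-1) |>.congr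
      (fun x _ => by ring) (Eventually.of_forall fun x => by ring))]
  simp only [sub_self, sub_zero, sinE_zero_right, cosE_zero_right]
  push_cast
  ring

theorem phase_mul_deriv_pi (H : IsEdgeAction a f ((E : ℂ) • f + r) u v g) :
    phase a Real.pi * (v Real.pi + Complex.I * a * u Real.pi) = -E * sinE E Real.pi * u 0 +
      cosE E Real.pi * (v 0 + Complex.I * a * u 0) -
      ∫ x in (0 : ℝ)..Real.pi, (cosE E (Real.pi - x) * phase a x) * r x := by
  rw [H.integral_mul_of_eq_neg_mul (isPrimitive_cosE_const_sub E 0 Real.pi Real.pi)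
    ((isPrimitive_sinE_const_sub E 0 Real.pi Real.pi).const_mul E |>.congr
      (fun _ _ => rfl) (Eventually.of_forall fun x => by ring))]
  simp only [sub_self, sub_zero, sinE_zero_right, cosE_zero_right]
  push_cast
  ring

theorem inner_sub_inner (H : IsEdgeAction a f h u v g) (H' : IsEdgeAction a f' h' u' v' g') :
    inner ℂ h f' - inner ℂ f h' =
      (starRingEnd ℂ (v 0 + Complex.I * a * u 0) * u' 0 -
        starRingEnd ℂ (u 0) * (v' 0 + Complex.I * a * u' 0)) -
      (starRingEnd ℂ (v Real.pi + Complex.I * a * u Real.pi) * u' Real.pi -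
        starRingEnd ℂ (u Real.pi) * (v' Real.pi + Complex.I * a * u' Real.pi)) := by
  have hgreen := H.isPrimitive_gauge.conj.integral_green H.isPrimitive_gauge₂.conj
    H'.isPrimitive_gauge H'.isPrimitive_gauge₂
  have hinner : (inner ℂ h f' - inner ℂ f h' : ℂ) = -∫ x in (0 : ℝ)..Real.pi,
      (starRingEnd ℂ (-(phase a x * h x)) * (phase a x * u' x) -
        starRingEnd ℂ (phase a x * u x) * -(phase a x * h' x)) := by
    rw [L2.inner_def, L2.inner_def, ← integral_sub (L2.integrable_inner h f')
      (L2.integrable_inner f h'), ← intervalIntegral.integral_neg, integral_zero_pi_eq]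
    refine integral_congr_ae ?_
    filter_upwards [H.repr, H'.repr] with x hx hx'
    rw [hx, hx']
    simp only [RCLike.inner_apply, map_neg, map_mul, conj_phase]
    linear_combination (starRingEnd ℂ (u x) * h' x - starRingEnd ℂ (h x) * u' x) *
      phase_neg_mul_phase a x
  rw [hinner, hgreen]
  simp only [map_mul, conj_phase, phase_zero, map_one]
  linear_combination (-starRingEnd ℂ (v Real.pi + Complex.I * a * u Real.pi) * u' Real.pi +
    starRingEnd ℂ (u Real.pi) * (v' Real.pi + Complex.I * a * u' Real.pi)) *
      phase_neg_mul_phase a Real.pi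

end IsEdgeAction

end EdgeAction

section VariationOfConstants

variable {E c : ℝ} {y b : ℂ} {ρ : ℝ → ℂ}

/-- The solution of `-w'' = E w + ρ` with `w 0 = y` and `w' 0 = b`, by variation of constants. -/
noncomputable def duhamel (E : ℝ) (y b : ℂ) (ρ : ℝ → ℂ) (x : ℝ) : ℂ :=
  y * cosE E x + b * sinE E x -
    (sinE E x * (∫ t in (0 : ℝ)..x, cosE E t * ρ t) -
      cosE E x * ∫ t in (0 : ℝ)..x, sinE E t * ρ t)

/-- The derivative of `duhamel E y b ρ`. -/
noncomputable def duhamelDeriv (E : ℝ) (y b : ℂ) (ρ : ℝ → ℂ) (x : ℝ) : ℂ :=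
  -E * y * sinE E x + b * cosE E x -
    (cosE E x * (∫ t in (0 : ℝ)..x, cosE E t * ρ t) +
      E * (sinE E x * ∫ t in (0 : ℝ)..x, sinE E t * ρ t))

theorem duhamel_zero_right (E : ℝ) (y b : ℂ) (ρ : ℝ → ℂ) : duhamel E y b ρ 0 = y := by
  simp [duhamel]

theorem duhamelDeriv_zero_right (E : ℝ) (y b : ℂ) (ρ : ℝ → ℂ) : duhamelDeriv E y b ρ 0 = b := by
  simp [duhamelDeriv]

theorem isPrimitive_integral_cosE_mul (hρ : IntervalIntegrable ρ volume 0 c) :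
    IsPrimitive (fun x => ∫ t in (0 : ℝ)..x, cosE E t * ρ t) (fun x => cosE E x * ρ x) 0 c :=
  .of_intervalIntegrable (hρ.continuousOn_mul (isPrimitive_cosE E 0 c).continuousOn)

theorem isPrimitive_integral_sinE_mul (hρ : IntervalIntegrable ρ volume 0 c) :
    IsPrimitive (fun x => ∫ t in (0 : ℝ)..x, sinE E t * ρ t) (fun x => sinE E x * ρ x) 0 c :=
  .of_intervalIntegrable (hρ.continuousOn_mul (isPrimitive_sinE E 0 c).continuousOn)

theorem isPrimitive_duhamel (hρ : IntervalIntegrable ρ volume 0 c) :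
    IsPrimitive (duhamel E y b ρ) (duhamelDeriv E y b ρ) 0 c := by
  have hC := isPrimitive_cosE E 0 c
  have hS := isPrimitive_sinE E 0 c
  refine (((hC.const_mul y).add (hS.const_mul b)).sub
    ((hS.mul (isPrimitive_integral_cosE_mul hρ)).sub
      (hC.mul (isPrimitive_integral_sinE_mul hρ)))).congr (fun _ _ => rfl)
    (Eventually.of_forall fun x => ?_)
  simp only [duhamelDeriv]
  ring

theorem isPrimitive_duhamelDeriv (hρ : IntervalIntegrable ρ volume 0 c) :
    IsPrimitive (duhamelDeriv E y b ρ) (fun x => -E * duhamel E y b ρ x - ρ x) 0 c := by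
  have hC := isPrimitive_cosE E 0 c
  have hS := isPrimitive_sinE E 0 c
  refine (((hS.const_mul (-E * y)).add (hC.const_mul b)).sub
    ((hC.mul (isPrimitive_integral_cosE_mul hρ)).add
      ((hS.mul (isPrimitive_integral_sinE_mul hρ)).const_mul E))).congr (fun _ _ => rfl)
    (Eventually.of_forall fun x => ?_)
  have hwronskian : (cosE E x : ℂ) ^ 2 + E * (sinE E x : ℂ) ^ 2 = 1 := by
    exact_mod_cast cosE_sq_add E x
  simp only [duhamel]
  linear_combination ρ x * hwronskian

theorem exists_norm_duhamel_le (E : ℝ) {c : ℝ} (hc : 0 ≤ c) : ∃ K : ℝ, 0 ≤ K ∧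
    ∀ (y b : ℂ) (ρ : ℝ → ℂ), IntervalIntegrable ρ volume 0 c → ∀ x ∈ Icc 0 c,
      ‖duhamel E y b ρ x‖ ≤ K * (‖y‖ + ‖b‖ + ∫ t in (0 : ℝ)..c, ‖ρ t‖) := by
  obtain ⟨M, hM⟩ := isCompact_Icc.exists_bound_of_continuousOn
    (f := fun x => ((cosE E x : ℂ), (sinE E x : ℂ))) (s := Icc 0 c)
    ((Complex.continuous_ofReal.comp (continuous_cosE E)).prodMk
      (Complex.continuous_ofReal.comp (continuous_sinE E))).continuousOn
  have hC (x) (hx : x ∈ Icc 0 c) : ‖(cosE E x : ℂ)‖ ≤ M := (norm_fst_le _).trans (hM x hx)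
  have hS (x) (hx : x ∈ Icc 0 c) : ‖(sinE E x : ℂ)‖ ≤ M := (norm_snd_le _).trans (hM x hx)
  have hM0 : 0 ≤ M := (norm_nonneg _).trans (hM 0 (left_mem_Icc.2 hc))
  refine ⟨M + 2 * M ^ 2, by positivity, fun y b ρ hρ x hx => ?_⟩
  have hIC := norm_integral_mul_le_mul_integral_norm hC hρ hx
  have hIS := norm_integral_mul_le_mul_integral_norm hS hρ hx
  have hCx := hC x hx
  have hSx := hS x hx
  set J := ∫ t in (0 : ℝ)..c, ‖ρ t‖
  have hJ : 0 ≤ J := intervalIntegral.integral_nonneg hc fun _ _ => norm_nonneg _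
  calc ‖duhamel E y b ρ x‖ ≤ ‖y * cosE E x‖ + ‖b * sinE E x‖ +
        (‖sinE E x * ∫ t in (0 : ℝ)..x, cosE E t * ρ t‖ +
          ‖cosE E x * ∫ t in (0 : ℝ)..x, sinE E t * ρ t‖) :=
        (norm_sub_le _ _).trans (add_le_add (norm_add_le _ _) (norm_sub_le _ _))
    _ ≤ ‖y‖ * M + ‖b‖ * M + (M * (M * J) + M * (M * J)) := by
        simp only [norm_mul] at hIC hIS ⊢
        gcongr
    _ ≤ (M + 2 * M ^ 2) * (‖y‖ + ‖b‖ + J) := by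
        have h1 : 0 ≤ 2 * M ^ 2 * (‖y‖ + ‖b‖) + M * J := by positivity
        linarith

end VariationOfConstants

namespace IsEdgeAction

variable {a E : ℝ} {r : EdgeL2}

theorem exists_trace_bound_of_test {p p₁ p₂ : ℝ → ℂ} (hp : IsPrimitive p p₁ 0 Real.pi)
    (hp₁ : IsPrimitive p₁ p₂ 0 Real.pi) (hp₂ : ContinuousOn p₂ (Icc 0 Real.pi))
    (hpπ : p Real.pi = 0) (hp₁π : p₁ Real.pi = 0) : ∃ K : ℝ, 0 ≤ K ∧
    ∀ {a : ℝ} {f h g : EdgeL2} {u v : ℝ → ℂ}, IsEdgeAction a f h u v g →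
      ‖(v 0 + Complex.I * a * u 0) * p 0 - u 0 * p₁ 0‖ ≤ K * (‖f‖ + ‖h‖) := by
  obtain ⟨M, hM⟩ := isCompact_Icc.exists_bound_of_continuousOn (uIcc_zero_pi ▸ hp.continuousOn)
  obtain ⟨M₂, hM₂⟩ := isCompact_Icc.exists_bound_of_continuousOn hp₂
  have hM0 : 0 ≤ M := (norm_nonneg _).trans (hM 0 zero_mem_Icc_pi)
  have hM₂0 : 0 ≤ M₂ := (norm_nonneg _).trans (hM₂ 0 zero_mem_Icc_pi)
  refine ⟨(M + M₂) * √Real.pi, by positivity, fun {a f h g u v} H => ?_⟩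
  have hgreen := H.integral_mul_add_integral_mul hp hp₁ hp₂
  rw [hpπ, hp₁π, mul_zero, mul_zero, sub_zero, mul_zero, sub_zero] at hgreen
  have hh := EdgeL2.norm_integral_mul_le (φ := fun x => p x * phase a x)
    (fun x hx => by rw [norm_mul, norm_phase, mul_one]; exact hM x hx) h
  have hf := EdgeL2.norm_integral_mul_le (φ := fun x => p₂ x * phase a x)
    (fun x hx => by rw [norm_mul, norm_phase, mul_one]; exact hM₂ x hx) f
  have hcross : 0 ≤ √Real.pi * (M * ‖f‖ + M₂ * ‖h‖) := by positivity
  calc ‖(v 0 + Complex.I * a * u 0) * p 0 - u 0 * p₁ 0‖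
      ≤ M * √Real.pi * ‖h‖ + M₂ * √Real.pi * ‖f‖ :=
        hgreen ▸ (norm_add_le _ _).trans (add_le_add hh hf)
    _ ≤ (M + M₂) * √Real.pi * (‖f‖ + ‖h‖) := by linarith

theorem exists_trace_bound : ∃ K : ℝ, 0 ≤ K ∧
    ∀ {a : ℝ} {f h g : EdgeL2} {u v : ℝ → ℂ}, IsEdgeAction a f h u v g →
      ‖u 0‖ ≤ K * (‖f‖ + ‖h‖) ∧ ‖v 0 + Complex.I * a * u 0‖ ≤ K * (‖f‖ + ‖h‖) := by
  have hπ := Real.pi_ne_zero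
  have hid (x : ℝ) := hasDerivAt_id' x
  have hsub (x : ℝ) : HasDerivAt (fun x => 1 - x / Real.pi) (-1 / Real.pi) x := by
    simpa [neg_div] using ((hid x).div_const Real.pi).const_sub 1
  have hsq (x : ℝ) :
      HasDerivAt (fun x => (1 - x / Real.pi) ^ 2) (-2 * (1 - x / Real.pi) / Real.pi) x :=
    ((hsub x).fun_pow 2).congr_deriv (by push_cast; ring)
  -- Cubic Hermite polynomials: the first one vanishes at `0` and isolates `u 0`, the derivative of
  -- the second one vanishes at `0`, which isolates `D u 0`.
  obtain ⟨K₁, hK₁, H₁⟩ := exists_trace_bound_of_test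
    (IsPrimitive.of_hasDerivAt (u := fun x => x * (1 - x / Real.pi) ^ 2)
      (v := fun x => (1 - x / Real.pi) * (1 - 3 * x / Real.pi))
      (fun x => ((hid x).mul (hsq x)).congr_deriv (by field)) (by fun_prop)).ofReal
    (IsPrimitive.of_hasDerivAt (v := fun x => (6 * x / Real.pi - 4) / Real.pi)
      (fun x => ((hsub x).mul ((((hid x).const_mul 3).div_const Real.pi).const_sub 1)).congr_deriv
        (by field)) (by fun_prop)).ofReal
    (by fun_prop) (by simp [hπ]) (by simp [hπ])
  obtain ⟨K₂, -, H₂⟩ := exists_trace_bound_of_test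
    (IsPrimitive.of_hasDerivAt (u := fun x => (1 - x / Real.pi) ^ 2 * (1 + 2 * x / Real.pi))
      (v := fun x => (1 - x / Real.pi) * (-6 * x / Real.pi ^ 2))
      (fun x => ((hsq x).mul
        ((((hid x).const_mul 2).div_const Real.pi).const_add 1)).congr_deriv (by field))
      (by fun_prop)).ofReal
    (IsPrimitive.of_hasDerivAt (v := fun x => 6 * (2 * x / Real.pi - 1) / Real.pi ^ 2)
      (fun x => ((hsub x).mul (((hid x).const_mul (-6)).div_const (Real.pi ^ 2))).congr_deriv
        (by field)) (by fun_prop)).ofReal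
    (by fun_prop) (by simp [hπ]) (by simp [hπ])
  refine ⟨max K₁ K₂, le_max_of_le_left hK₁, fun H => ⟨?_, ?_⟩⟩
  · refine le_trans ?_ (mul_le_mul_of_nonneg_right (le_max_left K₁ K₂) (by positivity))
    simpa using H₁ H
  · refine le_trans ?_ (mul_le_mul_of_nonneg_right (le_max_right K₁ K₂) (by positivity))
    simpa using H₂ H

theorem exists_of_gauge {w w₁ : ℝ → ℂ} (hw : IsPrimitive w w₁ 0 Real.pi)
    (hw₁ : IsPrimitive w₁ (fun x => -E * w x - phase a x * r x) 0 Real.pi) :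
    ∃ f g : EdgeL2, IsEdgeAction a f ((E : ℂ) • f + r) (fun x => phase (-a) x * w x)
      (fun x => phase (-a) x * (w₁ x - Complex.I * a * w x)) g := by
  have hphase := isPrimitive_phase (-a) 0 Real.pi
  have hu : IsPrimitive (fun x => phase (-a) x * w x)
      (fun x => phase (-a) x * (w₁ x - Complex.I * a * w x)) 0 Real.pi := by
    refine (hphase.mul hw).congr (fun _ _ => rfl) (Eventually.of_forall fun x => ?_)
    push_cast
    ring
  set G : ℝ → ℂ := fun x => phase (-a) x * (-E * w x - 2 * Complex.I * a * w₁ x - a ^ 2 * w x)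
  have hv : IsPrimitive (fun x => phase (-a) x * (w₁ x - Complex.I * a * w x))
      (fun x => G x - r x) 0 Real.pi := by
    refine (hphase.mul (hw₁.sub (hw.const_mul (Complex.I * a)))).congr (fun _ _ => rfl)
      (Eventually.of_forall fun x => ?_)
    simp only [G]
    push_cast
    linear_combination r x * phase_neg_mul_phase a x +
      (-a ^ 2 * phase (-a) x * w x) * Complex.I_sq
  have hGcont : ContinuousOn G (Icc 0 Real.pi) := by
    have hwc := hw.continuousOn
    have hw₁c := hw₁.continuousOn
    have hphasec := continuous_phase (-a)
    rw [← uIcc_zero_pi]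
    fun_prop
  obtain ⟨g, hg⟩ := EdgeL2.exists_ae_eq hGcont
  obtain ⟨f, hf⟩ := EdgeL2.exists_ae_eq (uIcc_zero_pi ▸ hu.continuousOn)
  have hgr : ((g - r : EdgeL2) : ℝ → ℂ) =ᵐ[edgeMeasure] fun x => G x - r x := by
    filter_upwards [Lp.coeFn_sub g r, hg] with x h1 h2
    rw [h1, Pi.sub_apply, h2]
  refine ⟨f, g - r, isH2_of_isPrimitive hu (hv.congr (fun _ _ => rfl) ?_), hf, ?_⟩
  · rwa [restrict_uIoc_zero_pi]
  · filter_upwards [EdgeL2.coeFn_smul_add E f r, hf, hgr] with x h1 h2 h3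
    rw [h1, h2, h3]
    simp only [G]
    linear_combination (-2 * a ^ 2 * phase (-a) x * w x) * Complex.I_sq

theorem exists_initial (E : ℝ) : ∃ K : ℝ, 0 ≤ K ∧ ∀ (a : ℝ) (y b : ℂ) (r : EdgeL2),
    ∃ (f : EdgeL2) (u v : ℝ → ℂ) (g : EdgeL2), IsEdgeAction a f ((E : ℂ) • f + r) u v g ∧
      u 0 = y ∧ v 0 + Complex.I * a * u 0 = b ∧ ‖f‖ ≤ K * (‖y‖ + ‖b‖ + ‖r‖) := by
  obtain ⟨K, hK, hbound⟩ := exists_norm_duhamel_le E Real.pi_pos.le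
  refine ⟨√Real.pi * (K * (1 + √Real.pi)), by positivity, fun a y b r => ?_⟩
  have hρ : IntervalIntegrable (fun x => phase a x * r x) volume 0 Real.pi :=
    r.intervalIntegrable_mul (continuous_phase a).continuousOn
  obtain ⟨f, g, H⟩ := exists_of_gauge (a := a) (E := E) (r := r)
    (isPrimitive_duhamel (y := y) (b := b) hρ) (isPrimitive_duhamelDeriv hρ)
  refine ⟨f, _, _, g, H, ?_, ?_, ?_⟩
  · simp [phase_zero, duhamel_zero_right]
  · simp [phase_zero, duhamel_zero_right, duhamelDeriv_zero_right]
  · have hf := EdgeL2.norm_le_of_forall_le (by positivity) H.repr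
      (B := K * (‖y‖ + ‖b‖ + √Real.pi * ‖r‖)) fun x hx => ?_
    · have h1 : 0 ≤ √Real.pi * (‖y‖ + ‖b‖) + ‖r‖ := by positivity
      refine hf.trans ?_
      rw [mul_assoc, mul_assoc]
      gcongr
      linarith
    · rw [norm_mul, norm_phase, one_mul]
      refine (hbound y b _ hρ x hx).trans ?_
      simp only [norm_mul, norm_phase, one_mul]
      gcongr
      exact r.integral_norm_le

end IsEdgeAction

section Source

/-- The value at `π` of the solution of `-w'' = E w + e^{iax} r` on an edge with vanishing initial
data, up to sign: the contribution of the source `r` to `phase_mul_value_pi`. -/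
noncomputable def sourceValue (E a : ℝ) (r : EdgeL2) : ℂ :=
  ∫ x in (0 : ℝ)..Real.pi, (sinE E (Real.pi - x) * phase a x) * r x

/-- The derivative belonging to `sourceValue`: the contribution of the source `r` to
`phase_mul_deriv_pi`. -/
noncomputable def sourceDeriv (E a : ℝ) (r : EdgeL2) : ℂ :=
  ∫ x in (0 : ℝ)..Real.pi, (cosE E (Real.pi - x) * phase a x) * r x

theorem exists_norm_integral_mul_phase_le {φ : ℝ → ℂ} (hφ : ContinuousOn φ (Icc 0 Real.pi)) :
    ∃ K : ℝ, 0 ≤ K ∧ ∀ (a : ℝ) (r : EdgeL2),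
      ‖∫ x in (0 : ℝ)..Real.pi, (φ x * phase a x) * r x‖ ≤ K * ‖r‖ := by
  obtain ⟨M, hM⟩ := isCompact_Icc.exists_bound_of_continuousOn hφ
  refine ⟨M * √Real.pi,
    mul_nonneg ((norm_nonneg _).trans (hM 0 zero_mem_Icc_pi)) (Real.sqrt_nonneg _), fun a r => ?_⟩
  refine EdgeL2.norm_integral_mul_le (fun x hx => ?_) r
  rw [norm_mul, norm_phase, mul_one]
  exact hM x hx

theorem exists_norm_source_le (E : ℝ) : ∃ K : ℝ, 0 ≤ K ∧ ∀ (a : ℝ) (r : EdgeL2),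
    ‖sourceValue E a r‖ ≤ K * ‖r‖ ∧ ‖sourceDeriv E a r‖ ≤ K * ‖r‖ := by
  obtain ⟨K₁, hK₁, H₁⟩ := exists_norm_integral_mul_phase_le
    (uIcc_zero_pi ▸ (isPrimitive_sinE_const_sub E 0 Real.pi Real.pi).continuousOn)
  obtain ⟨K₂, -, H₂⟩ := exists_norm_integral_mul_phase_le
    (uIcc_zero_pi ▸ (isPrimitive_cosE_const_sub E 0 Real.pi Real.pi).continuousOn)
  refine ⟨max K₁ K₂, le_max_of_le_left hK₁, fun a r => ⟨(H₁ a r).trans ?_, (H₂ a r).trans ?_⟩⟩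
  · gcongr
    exact le_max_left _ _
  · gcongr
    exact le_max_right _ _

end Source

section Jacobi

/-- The Jacobi operator that the vertex values of a solution of `-Δ_β f = E f` annihilate. -/
noncomputable def jacobi (A : ℝ) (β : ℤ → ℝ) (E : ℝ) (y : ℤ → ℂ) (j : ℤ) : ℂ :=
  2 * (Real.cos (A * Real.pi) : ℂ) * (y (j + 1) + y (j - 1)) -
    (4 * cosE E Real.pi + β j * sinE E Real.pi : ℝ) * y j

/-- The right-hand side of the Jacobi equation for the vertex values of a solution of
`-Δ_β f = E f + r`, up to sign. -/
noncomputable def source (A E : ℝ) (r : ChainL2) (j : ℤ) : ℂ :=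
  sourceValue E A (r (j, true)) + sourceValue E (-A) (r (j, false)) -
    phase (-A) Real.pi * (cosE E Real.pi * sourceValue E A (r (j - 1, true)) -
      sinE E Real.pi * sourceDeriv E A (r (j - 1, true))) -
    phase A Real.pi * (cosE E Real.pi * sourceValue E (-A) (r (j - 1, false)) -
      sinE E Real.pi * sourceDeriv E (-A) (r (j - 1, false)))

theorem phase_add_phase_neg (A : ℝ) :
    phase A Real.pi + phase (-A) Real.pi = 2 * (Real.cos (A * Real.pi) : ℂ) := by
  rw [phase, phase, Complex.ofReal_cos, Complex.cos]
  push_cast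
  ring_nf

@[simp] theorem pot_true (A : ℝ) (j : ℤ) : pot A (j, true) = A := rfl

@[simp] theorem pot_false (A : ℝ) (j : ℤ) : pot A (j, false) = -A := rfl

namespace IsAction

variable {A E : ℝ} {β : ℤ → ℝ} {f h r : ChainL2} {u v : Edge → ℝ → ℂ} {g : Edge → EdgeL2}

theorem left_value (H : IsAction A β f h u v g) (e : Edge) : u e 0 = u (e.1, true) 0 := by
  obtain ⟨j, _ | _⟩ := e
  · exact (H.continuity j).1.symm
  · rfl

theorem right_value (H : IsAction A β f h u v g) (e : Edge) :
    u e Real.pi = u (e.1 + 1, true) 0 := by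
  obtain ⟨j, b⟩ := e
  obtain ⟨-, hupper, hlower⟩ := H.continuity (j + 1)
  rw [add_sub_cancel_right] at hupper hlower
  cases b
  · exact hlower.symm
  · exact hupper.symm

theorem phase_mul_vertex_succ (H : IsAction A β f ((E : ℂ) • f + r) u v g) (e : Edge) :
    phase (pot A e) Real.pi * u (e.1 + 1, true) 0 = cosE E Real.pi * u (e.1, true) 0 +
      sinE E Real.pi * quasiDeriv A e (u e) (v e) 0 - sourceValue E (pot A e) (r e) := by
  rw [← H.right_value, ← H.left_value]
  exact (H.edge e).phase_mul_value_pi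

theorem phase_mul_quasiDeriv_pi (H : IsAction A β f ((E : ℂ) • f + r) u v g) (e : Edge) :
    phase (pot A e) Real.pi * quasiDeriv A e (u e) (v e) Real.pi =
      -E * sinE E Real.pi * u (e.1, true) 0 + cosE E Real.pi * quasiDeriv A e (u e) (v e) 0 -
        sourceDeriv E (pot A e) (r e) := by
  rw [← H.left_value]
  exact (H.edge e).phase_mul_deriv_pi

theorem jacobi_eq (H : IsAction A β f ((E : ℂ) • f + r) u v g) (j : ℤ) :
    jacobi A β E (fun j => u (j, true) 0) j = -source A E r j := by
  have right_upper := H.phase_mul_vertex_succ (j, true)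
  have right_lower := H.phase_mul_vertex_succ (j, false)
  have left_upper := H.phase_mul_vertex_succ (j - 1, true)
  have left_lower := H.phase_mul_vertex_succ (j - 1, false)
  have deriv_upper := H.phase_mul_quasiDeriv_pi (j - 1, true)
  have deriv_lower := H.phase_mul_quasiDeriv_pi (j - 1, false)
  have coupling := H.coupling j
  have hphase := phase_neg_mul_phase A Real.pi
  have hcs : (cosE E Real.pi : ℂ) ^ 2 + E * (sinE E Real.pi : ℂ) ^ 2 = 1 := by
    exact_mod_cast cosE_sq_add E Real.pi
  simp only [sub_add_cancel, pot_true, pot_false]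
    at right_upper right_lower left_upper left_lower deriv_upper deriv_lower
  rw [jacobi, ← phase_add_phase_neg, source]
  push_cast
  set S : ℂ := (sinE E Real.pi : ℂ)
  set C : ℂ := (cosE E Real.pi : ℂ)
  set D := quasiDeriv A (j - 1, true) (u (j - 1, true)) (v (j - 1, true)) Real.pi
  set D' := quasiDeriv A (j - 1, false) (u (j - 1, false)) (v (j - 1, false)) Real.pi
  set p := phase A Real.pi
  set q := phase (-A) Real.pi
  linear_combination right_upper + right_lower + S * coupling - q * C * left_upper -
    p * C * left_lower + q * S * deriv_upper + p * S * deriv_lower -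
    (p + q) * u (j - 1, true) 0 * hcs + (2 * C * u (j, true) 0 - S * (D + D')) * hphase

end IsAction

end Jacobi

section Symmetry

theorem memℓp_norm_add_norm (f h : ChainL2) : Memℓp (fun e => ‖f e‖ + ‖h e‖) 2 :=
  (lp.memℓp f).norm.add (lp.memℓp h).norm

/-- The boundary form of Green's formula for `D²` on the edge `e`, where `v = u'`, `v' = (u')'`. -/
noncomputable def quasiWronskian (A : ℝ) (e : Edge) (u v u' v' : ℝ → ℂ) (x : ℝ) : ℂ :=
  starRingEnd ℂ (quasiDeriv A e u v x) * u' x - starRingEnd ℂ (u x) * quasiDeriv A e u' v' x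

namespace IsAction

variable {A : ℝ} {β : ℤ → ℝ} {f h f' h' : ChainL2} {u v u' v' : Edge → ℝ → ℂ}
  {g g' : Edge → EdgeL2}

theorem memℓp_vertex (H : IsAction A β f h u v g) : Memℓp (fun j => u (j, true) 0) 2 := by
  obtain ⟨K, -, HK⟩ := IsEdgeAction.exists_trace_bound
  exact ((memℓp_two_comp_injective (memℓp_norm_add_norm f h)
    (Prod.mk_left_injective true)).const_mul K).mono fun j => (HK (H.edge (j, true))).1

theorem inner_sub_inner (H : IsAction A β f h u v g) (H' : IsAction A β f' h' u' v' g')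
    (e : Edge) : inner ℂ (h e) (f' e) - inner ℂ (f e) (h' e) =
      quasiWronskian A e (u e) (v e) (u' e) (v' e) 0 -
        quasiWronskian A e (u e) (v e) (u' e) (v' e) Real.pi :=
  (H.edge e).inner_sub_inner (H'.edge e)

theorem summable_quasiWronskian_zero (H : IsAction A β f h u v g)
    (H' : IsAction A β f' h' u' v' g') :
    Summable fun e => quasiWronskian A e (u e) (v e) (u' e) (v' e) 0 := by
  obtain ⟨K, hK, HK⟩ := IsEdgeAction.exists_trace_bound
  refine Summable.of_norm_bounded ((summable_mul_of_memℓp_two (memℓp_norm_add_norm f h)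
    (memℓp_norm_add_norm f' h')).mul_left (2 * K ^ 2)) fun e => ?_
  obtain ⟨hu, hDu⟩ := HK (H.edge e)
  obtain ⟨hu', hDu'⟩ := HK (H'.edge e)
  calc ‖quasiWronskian A e (u e) (v e) (u' e) (v' e) 0‖
      ≤ ‖quasiDeriv A e (u e) (v e) 0‖ * ‖u' e 0‖ +
          ‖u e 0‖ * ‖quasiDeriv A e (u' e) (v' e) 0‖ := by
        refine (norm_sub_le _ _).trans_eq ?_
        rw [norm_mul, norm_mul, RCLike.norm_conj, RCLike.norm_conj]
    _ ≤ K * (‖f e‖ + ‖h e‖) * (K * (‖f' e‖ + ‖h' e‖)) +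
          K * (‖f e‖ + ‖h e‖) * (K * (‖f' e‖ + ‖h' e‖)) :=
        add_le_add (mul_le_mul hDu hu' (norm_nonneg _) (by positivity))
          (mul_le_mul hu hDu' (norm_nonneg _) (by positivity))
    _ = 2 * K ^ 2 * ((‖f e‖ + ‖h e‖) * (‖f' e‖ + ‖h' e‖)) := by ring

theorem quasiWronskian_pi_add (H : IsAction A β f h u v g) (H' : IsAction A β f' h' u' v' g')
    {w : Edge → ℝ → ℂ} (hw : w = fun e => quasiWronskian A e (u e) (v e) (u' e) (v' e)) (j : ℤ) :
    w (j, true) Real.pi + w (j, false) Real.pi = w (j + 1, true) 0 + w (j + 1, false) 0 := by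
  have coupling' := H'.coupling (j + 1)
  have coupling := congrArg (starRingEnd ℂ) (H.coupling (j + 1))
  simp only [add_sub_cancel_right, map_add, map_sub, map_mul, Complex.conj_ofReal]
    at coupling coupling'
  simp only [hw, quasiWronskian, H.right_value, H'.right_value, H.left_value (j + 1, false),
    H'.left_value (j + 1, false)]
  linear_combination starRingEnd ℂ (u (j + 1, true) 0) * coupling' -
    u' (j + 1, true) 0 * coupling

theorem inner_comm (H : IsAction A β f h u v g) (H' : IsAction A β f' h' u' v' g') :
    inner ℂ h f' = inner ℂ f h' := by
  set w : Edge → ℝ → ℂ := fun e => quasiWronskian A e (u e) (v e) (u' e) (v' e) with hw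
  have hsum : HasSum (fun e => w e 0 - w e Real.pi) (inner ℂ h f' - inner ℂ f h') := by
    simpa only [H.inner_sub_inner H'] using
      (lp.hasSum_inner (𝕜 := ℂ) h f').sub (lp.hasSum_inner (𝕜 := ℂ) f h')
  have hzero : Summable fun e => w e 0 := H.summable_quasiWronskian_zero H'
  have hpi : Summable fun e => w e Real.pi := by simpa using hzero.sub hsum.summable
  have hshift : ∑' e, w e Real.pi = ∑' e, w e 0 := by
    rw [hpi.tsum_prod, hzero.tsum_prod]
    simp only [tsum_fintype, Fintype.sum_bool, H.quasiWronskian_pi_add H' hw]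
    exact (Equiv.addRight (1 : ℤ)).tsum_eq fun j => w (j, true) 0 + w (j, false) 0
  rw [← sub_eq_zero, ← hsum.tsum_eq, hzero.tsum_sub hpi, hshift, sub_self]

end IsAction

end Symmetry

section Uniqueness

theorem eqOn_Icc_pi_of_ae_eq {u u' : ℝ → ℂ} (h : u =ᵐ[edgeMeasure] u')
    (hu : ContinuousOn u (Icc 0 Real.pi)) (hu' : ContinuousOn u' (Icc 0 Real.pi)) :
    EqOn u u' (Icc 0 Real.pi) := by
  rw [edgeMeasure, restrict_Ioo_eq_restrict_Icc] at h
  exact Measure.eqOn_Icc_of_ae_eq volume Real.pi_pos.ne h hu hu'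

theorem IsAction.continuousOn {A : ℝ} {β : ℤ → ℝ} {f h : ChainL2} {u v : Edge → ℝ → ℂ}
    {g : Edge → EdgeL2} (H : IsAction A β f h u v g) (e : Edge) :
    ContinuousOn (u e) (Icc 0 Real.pi) :=
  uIcc_zero_pi ▸ (H.sobolev e).isPrimitive.continuousOn

theorem IsAction.eqOn {A : ℝ} {β : ℤ → ℝ} {f h : ChainL2} {u v : Edge → ℝ → ℂ}
    {g : Edge → EdgeL2} {w : ℝ → ℂ} (H : IsAction A β f h u v g) {e : Edge}
    (hf : (f e : ℝ → ℂ) =ᵐ[edgeMeasure] w) (hw : ContinuousOn w (Icc 0 Real.pi)) :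
    EqOn (u e) w (Icc 0 Real.pi) :=
  eqOn_Icc_pi_of_ae_eq ((H.repr e).symm.trans hf) (H.continuousOn e) hw

theorem IsAction.vertex_eq_zero {A : ℝ} {β : ℤ → ℝ} {h : ChainL2} {u v : Edge → ℝ → ℂ}
    {g : Edge → EdgeL2} (H : IsAction A β 0 h u v g) (e : Edge) : u e 0 = 0 :=
  H.eqOn (Lp.coeFn_zero ℂ 2 edgeMeasure) continuousOn_const zero_mem_Icc_pi

namespace IsEdgeAction

variable {a E : ℝ} {f g : EdgeL2} {u v p p₁ : ℝ → ℂ}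

theorem wronskian_eq (H : IsEdgeAction a f ((E : ℂ) • f) u v g) (hp : IsPrimitive p p₁ 0 Real.pi)
    (hp₁ : IsPrimitive p₁ (fun x => -E * p x) 0 Real.pi) {x : ℝ} (hx : x ∈ Icc 0 Real.pi) :
    phase a x * (v x + Complex.I * a * u x) * p x - phase a x * u x * p₁ x =
      (v 0 + Complex.I * a * u 0) * p 0 - u 0 * p₁ 0 := by
  have hconst := (H.isPrimitive_gauge.wronskian H.isPrimitive_gauge₂ hp hp₁).congr
    (v' := fun _ => (0 : ℂ)) (fun _ _ => rfl) (by
      rw [restrict_uIoc_zero_pi]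
      filter_upwards [Lp.coeFn_smul (E : ℂ) f, H.repr] with x hsmul hfu
      rw [hsmul, Pi.smul_apply, hfu, smul_eq_mul]
      ring)
  have hvalue := hconst.eq_add_integral x (uIcc_zero_pi.symm ▸ hx)
  simp only [intervalIntegral.integral_zero, add_zero, phase_zero, one_mul] at hvalue
  exact hvalue

theorem eq_zero (H : IsEdgeAction a f ((E : ℂ) • f) u v g) (hu : u 0 = 0)
    (hv : v 0 + Complex.I * a * u 0 = 0) : f = 0 := by
  have hzero : ∀ x ∈ Icc 0 Real.pi, u x = 0 := fun x hx => by
    have hsin := H.wronskian_eq (isPrimitive_sinE E 0 Real.pi) (isPrimitive_cosE E 0 Real.pi) hx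
    have hcos := H.wronskian_eq (isPrimitive_cosE E 0 Real.pi)
      ((isPrimitive_sinE E 0 Real.pi).const_mul (-E)) hx
    rw [hv, hu] at hsin hcos
    have hcs : (cosE E x : ℂ) ^ 2 + E * (sinE E x : ℂ) ^ 2 = 1 := by
      exact_mod_cast cosE_sq_add E x
    linear_combination phase (-a) x * (sinE E x * hcos - cosE E x * hsin) -
      u x * phase_neg_mul_phase a x - phase (-a) x * phase a x * u x * hcs
  refine (Lp.eq_zero_iff_ae_eq_zero).2 ?_
  filter_upwards [H.repr, ae_restrict_mem measurableSet_Ioo] with x hfu hx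
  rw [hfu, hzero x (Ioo_subset_Icc_self hx), Pi.zero_apply]

end IsEdgeAction

end Uniqueness

section JacobiSolutions

variable {A E : ℝ} {β : ℤ → ℝ} {f r : ChainL2} {u v : Edge → ℝ → ℂ} {g : Edge → EdgeL2}
  {y : ℤ → ℂ} {b : Edge → ℂ}

theorem sourceValue_zero (E a : ℝ) : sourceValue E a 0 = 0 := by
  obtain ⟨K, -, HK⟩ := exists_norm_source_le E
  simpa using (HK a 0).1

theorem sourceDeriv_zero (E a : ℝ) : sourceDeriv E a 0 = 0 := by
  obtain ⟨K, -, HK⟩ := exists_norm_source_le E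
  simpa using (HK a 0).2

theorem source_zero (A E : ℝ) (j : ℤ) : source A E 0 j = 0 := by
  simp only [source, lp.coeFn_zero, Pi.zero_apply, sourceValue_zero, sourceDeriv_zero, mul_zero,
    sub_zero, add_zero]

theorem IsAction.jacobi_eq_zero (H : IsAction A β f ((E : ℂ) • f) u v g) (j : ℤ) :
    jacobi A β E (fun j => u (j, true) 0) j = 0 := by
  rw [IsAction.jacobi_eq (r := 0) (by rwa [add_zero]) j, source_zero, neg_zero]

theorem IsAction.eq_zero (H : IsAction A β f ((E : ℂ) • f) u v g) (hS : sinE E Real.pi ≠ 0)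
    (hu : ∀ j, u (j, true) 0 = 0) : f = 0 := by
  refine lp.ext (funext fun e => (H.edge e).eq_zero (by rw [H.left_value, hu]) ?_)
  have hend := IsAction.phase_mul_vertex_succ (r := 0) (by rwa [add_zero]) e
  rw [hu, hu, lp.coeFn_zero, Pi.zero_apply, sourceValue_zero, mul_zero, mul_zero, zero_add,
    sub_zero] at hend
  exact (mul_eq_zero.1 hend.symm).resolve_left (Complex.ofReal_ne_zero.2 hS)

/-- Solutions on the edges with matching boundary data assemble to one on the chain: `y` collects
the vertex values, and `b` the initial values of the quasiderivatives. -/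
theorem exists_isAction (hy : Memℓp y 2) (hb : Memℓp b 2)
    (hcont : ∀ e : Edge, phase (pot A e) Real.pi * y (e.1 + 1) =
      cosE E Real.pi * y e.1 + sinE E Real.pi * b e - sourceValue E (pot A e) (r e))
    (hcoup : ∀ j : ℤ, b (j, true) + b (j, false) -
      phase (-A) Real.pi * (-E * sinE E Real.pi * y (j - 1) + cosE E Real.pi * b (j - 1, true) -
        sourceDeriv E A (r (j - 1, true))) -
      phase A Real.pi * (-E * sinE E Real.pi * y (j - 1) + cosE E Real.pi * b (j - 1, false) -
        sourceDeriv E (-A) (r (j - 1, false))) = β j * y j) :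
    ∃ f u v g, IsAction A β f ((E : ℂ) • f + r) u v g ∧ (∀ e, u e 0 = y e.1) ∧
      ∀ e, quasiDeriv A e (u e) (v e) 0 = b e := by
  obtain ⟨K, -, HK⟩ := IsEdgeAction.exists_initial E
  choose F u v g H hu hDu hF using fun e : Edge => HK (pot A e) (y e.1) (b e) (r e)
  have hmem : Memℓp F 2 := (((memℓp_two_comp_fst hy.norm).add hb.norm).add
    (lp.memℓp r).norm |>.const_mul K).mono hF
  have hright (e : Edge) : u e Real.pi = y (e.1 + 1) := by
    have hval := (H e).phase_mul_value_pi
    rw [hDu, hu, ← sourceValue, ← hcont e] at hval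
    linear_combination phase (-pot A e) Real.pi * hval -
      (u e Real.pi - y (e.1 + 1)) * phase_neg_mul_phase (pot A e) Real.pi
  have hDright (e : Edge) : quasiDeriv A e (u e) (v e) Real.pi = phase (-pot A e) Real.pi *
      (-E * sinE E Real.pi * y e.1 + cosE E Real.pi * b e - sourceDeriv E (pot A e) (r e)) := by
    have hder := (H e).phase_mul_deriv_pi
    rw [hDu, hu, ← sourceDeriv] at hder
    rw [← hder, ← mul_assoc, phase_neg_mul_phase, one_mul, quasiDeriv]
  refine ⟨⟨F, hmem⟩, u, v, g, ⟨fun e => (H e).sobolev, fun e => (H e).repr, fun e => (H e).action,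
    fun j => ⟨?_, ?_, ?_⟩, fun j => ?_⟩, hu, hDu⟩
  · rw [hu, hu]
  · rw [hu, hright, sub_add_cancel]
  · rw [hu, hright, sub_add_cancel]
  · rw [hDright, hDright, quasiDeriv, hDu, quasiDeriv, hDu, hu, pot_true, pot_false, neg_neg]
    exact hcoup j

theorem memℓp_sourceValue (A E : ℝ) (r : ChainL2) :
    Memℓp (fun e => sourceValue E (pot A e) (r e)) 2 := by
  obtain ⟨K, -, HK⟩ := exists_norm_source_le E
  exact ((lp.memℓp r).norm.const_mul K).mono fun e => (HK _ _).1

theorem memℓp_sourceDeriv (A E : ℝ) (r : ChainL2) :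
    Memℓp (fun e => sourceDeriv E (pot A e) (r e)) 2 := by
  obtain ⟨K, -, HK⟩ := exists_norm_source_le E
  exact ((lp.memℓp r).norm.const_mul K).mono fun e => (HK _ _).2

theorem memℓp_source (A E : ℝ) (r : ChainL2) : Memℓp (source A E r) 2 := by
  have left_inj (c : Bool) : Function.Injective fun j : ℤ => ((j, c) : Edge) :=
    Prod.mk_left_injective c
  have right_inj (c : Bool) : Function.Injective fun j : ℤ => ((j - 1, c) : Edge) :=
    (left_inj c).comp (sub_left_injective (b := (1 : ℤ)))
  have hleft (c : Bool) := memℓp_two_comp_injective (memℓp_sourceValue A E r) (left_inj c)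
  have hvalue (c : Bool) := memℓp_two_comp_injective (memℓp_sourceValue A E r) (right_inj c)
  have hderiv (c : Bool) := memℓp_two_comp_injective (memℓp_sourceDeriv A E r) (right_inj c)
  have hright (c : Bool) := ((hvalue c).const_mul (cosE E Real.pi : ℂ)).sub
    ((hderiv c).const_mul (sinE E Real.pi : ℂ))
  exact (((hleft true).add (hleft false)).sub ((hright true).const_mul (phase (-A) Real.pi))).sub
    ((hright false).const_mul (phase A Real.pi))

/-- The initial value of the quasiderivative on the edge `e` for the solution of `-D² f = E f + r`
with vertex values `y`, where `sinE E π ≠ 0`. -/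
noncomputable def initialQuasiDeriv (A E : ℝ) (y : ℤ → ℂ) (r : ChainL2) (e : Edge) : ℂ :=
  (sinE E Real.pi : ℂ)⁻¹ * (phase (pot A e) Real.pi * y (e.1 + 1) - cosE E Real.pi * y e.1 +
    sourceValue E (pot A e) (r e))

theorem sinE_mul_initialQuasiDeriv (hS : sinE E Real.pi ≠ 0) (e : Edge) :
    sinE E Real.pi * initialQuasiDeriv A E y r e = phase (pot A e) Real.pi * y (e.1 + 1) -
      cosE E Real.pi * y e.1 + sourceValue E (pot A e) (r e) :=
  mul_inv_cancel_left₀ (Complex.ofReal_ne_zero.2 hS) _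

theorem memℓp_initialQuasiDeriv (hy : Memℓp y 2) : Memℓp (initialQuasiDeriv A E y r) 2 := by
  have hsucc : Memℓp (fun e : Edge => phase (pot A e) Real.pi * y (e.1 + 1)) 2 :=
    (memℓp_two_comp_fst (memℓp_two_comp_injective hy (add_left_injective (1 : ℤ)))).norm.mono
      fun e => by rw [norm_mul, norm_phase, one_mul]
  exact ((hsucc.sub ((memℓp_two_comp_fst hy).const_mul _)).add
    (memℓp_sourceValue A E r)).const_mul _

theorem initialQuasiDeriv_coupling (hS : sinE E Real.pi ≠ 0) {j : ℤ}
    (hJ : jacobi A β E y j = -source A E r j) {b : Edge → ℂ}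
    (hb : b = initialQuasiDeriv A E y r) :
    b (j, true) + b (j, false) -
      phase (-A) Real.pi * (-E * sinE E Real.pi * y (j - 1) + cosE E Real.pi * b (j - 1, true) -
        sourceDeriv E A (r (j - 1, true))) -
      phase A Real.pi * (-E * sinE E Real.pi * y (j - 1) + cosE E Real.pi * b (j - 1, false) -
        sourceDeriv E (-A) (r (j - 1, false))) = β j * y j := by
  have right_upper := sinE_mul_initialQuasiDeriv (A := A) (y := y) (r := r) hS (j, true)
  have right_lower := sinE_mul_initialQuasiDeriv (A := A) (y := y) (r := r) hS (j, false)
  have left_upper := sinE_mul_initialQuasiDeriv (A := A) (y := y) (r := r) hS (j - 1, true)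
  have left_lower := sinE_mul_initialQuasiDeriv (A := A) (y := y) (r := r) hS (j - 1, false)
  rw [jacobi, ← phase_add_phase_neg, source] at hJ
  push_cast at hJ
  simp only [← hb, sub_add_cancel, pot_true, pot_false]
    at right_upper right_lower left_upper left_lower
  have hcs : (cosE E Real.pi : ℂ) ^ 2 + E * (sinE E Real.pi : ℂ) ^ 2 = 1 := by
    exact_mod_cast cosE_sq_add E Real.pi
  apply mul_left_cancel₀ (Complex.ofReal_ne_zero.2 hS)
  linear_combination hJ + right_upper + right_lower -
    phase (-A) Real.pi * cosE E Real.pi * left_upper -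
    phase A Real.pi * cosE E Real.pi * left_lower +
    (phase A Real.pi + phase (-A) Real.pi) * y (j - 1) * hcs -
    2 * cosE E Real.pi * y j * phase_neg_mul_phase A Real.pi

theorem exists_isAction_of_jacobi (hS : sinE E Real.pi ≠ 0) (hy : Memℓp y 2)
    (hJ : ∀ j, jacobi A β E y j = -source A E r j) :
    ∃ f u v g, IsAction A β f ((E : ℂ) • f + r) u v g ∧ ∀ e, u e 0 = y e.1 := by
  obtain ⟨f, u, v, g, H, hu, -⟩ :=
    exists_isAction hy (memℓp_initialQuasiDeriv (A := A) (r := r) hy)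
      (fun e => by rw [sinE_mul_initialQuasiDeriv hS]; ring)
      fun j => initialQuasiDeriv_coupling hS (hJ j) rfl
  exact ⟨f, u, v, g, H, hu⟩

end JacobiSolutions

section Hamiltonian

variable {A E : ℝ} {β : ℤ → ℝ} {f h : ChainL2}

theorem mem_graph_hamiltonian_iff :
    (f, h) ∈ (hamiltonian A β).graph ↔ ∃ u v g, IsAction A β f h u v g := by
  rw [hamiltonian_graph]
  rfl

theorem exists_isAction_domain (f : (hamiltonian A β).domain) :
    ∃ u v g, IsAction A β (f : ChainL2) (hamiltonian A β f) u v g :=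
  mem_graph_hamiltonian_iff.1 ((hamiltonian A β).mem_graph f)

theorem IsAction.exists_domain {u v : Edge → ℝ → ℂ} {g : Edge → EdgeL2}
    (H : IsAction A β f h u v g) :
    ∃ f' : (hamiltonian A β).domain, (f' : ChainL2) = f ∧ hamiltonian A β f' = h :=
  (LinearPMap.mem_graph_iff _).1 (mem_graph_hamiltonian_iff.2 ⟨u, v, g, H⟩)

theorem mem_eigenspace_hamiltonian_iff {z : ℂ} :
    f ∈ eigenspace (hamiltonian A β) z ↔ ∃ u v g, IsAction A β f (z • f) u v g := by
  rw [mem_eigenspace_iff_graph, mem_graph_hamiltonian_iff]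

theorem isSymmetric_hamiltonian (A : ℝ) (β : ℤ → ℝ) : IsSymmetric (hamiltonian A β) := by
  intro f f'
  obtain ⟨u, v, g, H⟩ := exists_isAction_domain f
  obtain ⟨u', v', g', H'⟩ := exists_isAction_domain f'
  exact H.inner_comm H'

theorem mem_resolventSet_of_jacobi (hS : sinE E Real.pi ≠ 0)
    (inj : ∀ y : ℤ → ℂ, Memℓp y 2 → (∀ j, jacobi A β E y j = 0) → y = 0)
    (surj : ∀ d : ℤ → ℂ, Memℓp d 2 → ∃ y : ℤ → ℂ, Memℓp y 2 ∧ ∀ j, jacobi A β E y j = d j) :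
    (E : ℂ) ∈ resolventSet (hamiltonian A β) := by
  refine (isSymmetric_hamiltonian A β).mem_resolventSet (fun f hf => ?_) fun r => ?_
  · obtain ⟨u, v, g, H⟩ := exists_isAction_domain f
    rw [hf] at H
    have hvertex := inj _ H.memℓp_vertex H.jacobi_eq_zero
    exact Subtype.ext (H.eq_zero hS (congrFun hvertex))
  · obtain ⟨y, hy, hJ⟩ := surj _ (memℓp_source A E r).neg
    obtain ⟨f, u, v, g, H, -⟩ := exists_isAction_of_jacobi hS hy hJ
    obtain ⟨f', hf', hHf'⟩ := H.exists_domain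
    exact ⟨f', by rw [hf', hHf', add_sub_cancel_left]⟩

end Hamiltonian

section JacobiOperator

/-- The space of sequences of vertex values. -/
abbrev VertexL2 : Type := lp (fun _ : ℤ => ℂ) 2

/-- Translation of sequences. -/
noncomputable def shift (k : ℤ) : VertexL2 →L[ℂ] VertexL2 :=
  LinearMap.mkContinuous
    { toFun := fun y =>
        ⟨fun j => y (j + k), memℓp_two_comp_injective (lp.memℓp y) (add_left_injective k)⟩
      map_add' := fun _ _ => rfl
      map_smul' := fun _ _ => rfl } 1 fun y => by
    rw [one_mul, lp.norm_eq_tsum_rpow (by norm_num), lp.norm_eq_tsum_rpow (by norm_num)]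
    exact le_of_eq (congrArg (· ^ (1 / (2 : ENNReal).toReal))
      ((Equiv.addRight k).tsum_eq (fun j => ‖y j‖ ^ (2 : ENNReal).toReal)))

theorem norm_shift_le (k : ℤ) : ‖shift k‖ ≤ 1 := LinearMap.mkContinuous_norm_le _ zero_le_one _

/-- Half the trace of the transfer matrix of a ring with vertex coupling `α`, up to the
factor `cos (A π)`. -/
noncomputable def xi (α E : ℝ) : ℝ := cosE E Real.pi + α / 4 * sinE E Real.pi

/-- The operator on `ℓ²(ℤ)` given by `jacobi` for the constant coupling `α`. -/
noncomputable def jacobiConst (A α E : ℝ) : VertexL2 →L[ℂ] VertexL2 :=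
  (2 * Real.cos (A * Real.pi) : ℂ) • (shift 1 + shift (-1)) - algebraMap ℂ _ (4 * xi α E : ℂ)

variable {A α E : ℝ} {β : ℤ → ℝ} {s : Finset ℤ}

theorem jacobiConst_apply (A α E : ℝ) (y : VertexL2) (j : ℤ) :
    jacobiConst A α E y j = jacobi A (fun _ => α) E y j := by
  change (2 * Real.cos (A * Real.pi) : ℂ) * (y (j + 1) + y (j - 1)) - 4 * xi α E * y j = _
  rw [jacobi, xi]
  push_cast
  ring

theorem isUnit_jacobiConst (h : |Real.cos (A * Real.pi)| < |xi α E|) :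
    IsUnit (jacobiConst A α E) := by
  have hshift : ‖shift 1 + shift (-1)‖ ≤ 2 :=
    (norm_add_le _ _).trans (by linarith [norm_shift_le 1, norm_shift_le (-1)])
  have hcos : ‖(2 * Real.cos (A * Real.pi) : ℂ)‖ = 2 * |Real.cos (A * Real.pi)| := by
    rw [norm_mul, Complex.norm_real, Complex.norm_two, Real.norm_eq_abs]
  have hxi : ‖(4 * xi α E : ℂ)‖ = 4 * |xi α E| := by
    rw [norm_mul, Complex.norm_real, Complex.norm_ofNat, Real.norm_eq_abs]
  have hmem : (4 * xi α E : ℂ) ∈ _root_.resolventSet ℂ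
      ((2 * Real.cos (A * Real.pi) : ℂ) • (shift 1 + shift (-1))) := by
    apply spectrum.mem_resolventSet_of_norm_lt_mul
    calc _ ≤ ‖(2 * Real.cos (A * Real.pi) : ℂ)‖ * ‖shift 1 + shift (-1)‖ * 1 := by
          gcongr
          · exact ContinuousLinearMap.opNorm_smul_le _ _
          · exact ContinuousLinearMap.norm_id_le
      _ ≤ 2 * |Real.cos (A * Real.pi)| * 2 * 1 := by rw [hcos]; gcongr
      _ < ‖(4 * xi α E : ℂ)‖ := by rw [hxi]; linarith
  rw [jacobiConst, ← neg_sub]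
  exact hmem.neg

theorem jacobi_eq_jacobi_const_sub (A α E : ℝ) (β : ℤ → ℝ) (y : ℤ → ℂ) (j : ℤ) :
    jacobi A β E y j =
      jacobi A (fun _ => α) E y j - ((β j - α) * sinE E Real.pi : ℝ) * y j := by
  rw [jacobi, jacobi]
  push_cast
  ring

theorem surjective_sub_comp_of_injective {K V V' W : Type*} [Field K] [AddCommGroup V]
    [AddCommGroup V'] [AddCommGroup W] [Module K V] [Module K V'] [Module K W]
    [FiniteDimensional K W] {L : V →ₗ[K] V'} {G : V' →ₗ[K] V} (hLG : ∀ d, L (G d) = d)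
    (P : V →ₗ[K] W) (Q : W →ₗ[K] V')
    (hinj : Function.Injective (L - Q ∘ₗ P)) : Function.Surjective (L - Q ∘ₗ P) := by
  have hM : Function.Injective (LinearMap.id - P ∘ₗ G ∘ₗ Q : W →ₗ[K] W) := by
    rw [injective_iff_map_eq_zero]
    intro w hw
    have hw' : w = P (G (Q w)) := sub_eq_zero.1 hw
    have hzero : G (Q w) = 0 := (injective_iff_map_eq_zero _).1 hinj _ (by
      rw [LinearMap.sub_apply, hLG, LinearMap.comp_apply, ← hw', sub_self])
    rw [hw', hzero, map_zero]
  intro d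
  obtain ⟨w, hw⟩ := LinearMap.injective_iff_surjective.1 hM (P (G d))
  have hw' : P (G (d + Q w)) = w := by
    rw [map_add, map_add, ← hw]
    exact sub_add_cancel w (P (G (Q w)))
  refine ⟨G (d + Q w), ?_⟩
  rw [LinearMap.sub_apply, hLG, LinearMap.comp_apply, hw', add_sub_cancel_right]

theorem mem_resolventSet_of_jacobi_injective (hβ : ∀ j ∉ s, β j = α) (hS : sinE E Real.pi ≠ 0)
    (h : |Real.cos (A * Real.pi)| < |xi α E|)
    (hinj : ∀ y : ℤ → ℂ, Memℓp y 2 → (∀ j, jacobi A β E y j = 0) → y = 0) :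
    (E : ℂ) ∈ resolventSet (hamiltonian A β) := by
  let P : VertexL2 →ₗ[ℂ] (s → ℂ) := LinearMap.pi fun i => lp.evalₗ (𝕜 := ℂ) (fun _ : ℤ => ℂ) 2 i
  let Q : (s → ℂ) →ₗ[ℂ] VertexL2 := ∑ i : s,
    (((β i - α) * sinE E Real.pi : ℝ) : ℂ) • (lp.lsingle 2 (i : ℤ) ∘ₗ LinearMap.proj i)
  let L : VertexL2 →ₗ[ℂ] VertexL2 := (jacobiConst A α E).toLinearMap
  have hQP (y : VertexL2) (j : ℤ) :
      Q (P y) j = ((β j - α) * sinE E Real.pi : ℝ) * y j := by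
    have hsum : Q (P y) =
        ∑ i ∈ s, (((β i - α) * sinE E Real.pi : ℝ) : ℂ) • lp.single 2 i (y i) := by
      rw [← Finset.sum_coe_sort s]
      exact LinearMap.sum_apply _ _ _
    rw [hsum, lp.coeFn_sum, Finset.sum_apply, Finset.sum_eq_single j]
    · rw [lp.coeFn_smul, Pi.smul_apply, lp.single_apply, Pi.single_eq_same, smul_eq_mul]
    · intro i _ hij
      rw [lp.coeFn_smul, Pi.smul_apply, lp.single_apply, Pi.single_eq_of_ne hij.symm, smul_zero]
    · intro hj
      rw [hβ j hj, sub_self, zero_mul, Complex.ofReal_zero, zero_smul]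
      rfl
  have hL (y : VertexL2) (j : ℤ) : (L - Q ∘ₗ P) y j = jacobi A β E y j := by
    rw [jacobi_eq_jacobi_const_sub A α, ← hQP, ← jacobiConst_apply]
    rfl
  obtain ⟨G, hG⟩ := (isUnit_jacobiConst h).exists_right_inv
  refine mem_resolventSet_of_jacobi hS hinj fun d hd => ?_
  obtain ⟨y, hy⟩ := surjective_sub_comp_of_injective (L := L) (G := G.toLinearMap)
    (fun d => DFunLike.congr_fun hG d) P Q
    ((injective_iff_map_eq_zero _).2 fun y hy => lp.ext (hinj y (lp.memℓp y) fun j => by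
      rw [← hL, hy]; rfl)) ⟨d, hd⟩
  exact ⟨y, lp.memℓp y, fun j => by rw [← hL, hy]⟩

theorem jacobi_injective_of_eigenspace_eq_bot (hS : sinE E Real.pi ≠ 0)
    (h : eigenspace (hamiltonian A β) (E : ℂ) = ⊥) {y : ℤ → ℂ} (hy : Memℓp y 2)
    (hJ : ∀ j, jacobi A β E y j = 0) : y = 0 := by
  obtain ⟨f, u, v, g, H, hu⟩ := exists_isAction_of_jacobi hS hy (r := 0) fun j => by
    rw [hJ, source_zero, neg_zero]
  rw [add_zero] at H
  have hf : f ∈ eigenspace (hamiltonian A β) (E : ℂ) :=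
    mem_eigenspace_hamiltonian_iff.2 ⟨u, v, g, H⟩
  rw [h, Submodule.mem_bot] at hf
  subst hf
  funext j
  rw [← hu (j, true)]
  exact H.vertex_eq_zero _

theorem mem_resolventSet_of_eigenspace_eq_bot (hβ : ∀ j ∉ s, β j = α)
    (hS : sinE E Real.pi ≠ 0) (h : |Real.cos (A * Real.pi)| < |xi α E|)
    (he : eigenspace (hamiltonian A β) (E : ℂ) = ⊥) :
    (E : ℂ) ∈ resolventSet (hamiltonian A β) :=
  mem_resolventSet_of_jacobi_injective hβ hS h fun _ =>
    jacobi_injective_of_eigenspace_eq_bot hS he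

theorem mem_resolventSet_const (hS : sinE E Real.pi ≠ 0)
    (h : |Real.cos (A * Real.pi)| < |xi α E|) :
    (E : ℂ) ∈ resolventSet (hamiltonian A fun _ => α) := by
  obtain ⟨G, hG⟩ := (isUnit_jacobiConst h).exists_left_inv
  refine mem_resolventSet_of_jacobi_injective (s := ∅) (fun _ _ => rfl) hS h fun y hy hJ => ?_
  have hzero : jacobiConst A α E ⟨y, hy⟩ = 0 :=
    lp.ext (funext fun j => (jacobiConst_apply A α E ⟨y, hy⟩ j).trans (hJ j))
  have hy0 : (⟨y, hy⟩ : VertexL2) = 0 := by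
    have happly := DFunLike.congr_fun hG (⟨y, hy⟩ : VertexL2)
    rwa [mul_apply_eq_comp, hzero, map_zero, one_apply_eq_self, eq_comm] at happly
  exact congrArg (fun x : VertexL2 => (x : ℤ → ℂ)) hy0

end JacobiOperator

section Decay

/-- The quadratic form `‖z (n + 1)‖² + ‖z n‖² - 2 t ⟪z (n + 1), z n⟫` is conserved; when `z`
tends to zero it vanishes, and then `|t| ≤ 1` makes `‖z n‖` constant. -/
theorem eq_zero_of_recurrence {V : Type*} [NormedAddCommGroup V] [InnerProductSpace ℝ V] {t : ℝ}
    (ht : |t| ≤ 1) {z : ℕ → V} (hz : ∀ n, z (n + 2) + z n = (2 * t) • z (n + 1))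
    (hlim : Tendsto z atTop (𝓝 0)) (n : ℕ) : z n = 0 := by
  have hlim₁ : Tendsto (fun n => z (n + 1)) atTop (𝓝 0) := hlim.comp (tendsto_add_atTop_nat 1)
  let Q (n : ℕ) : ℝ := ‖z (n + 1)‖ ^ 2 + ‖z n‖ ^ 2 - 2 * t * inner ℝ (z (n + 1)) (z n)
  have hQ_succ (n : ℕ) : Q (n + 1) = Q n := by
    have hz' : z (n + 1 + 1) = (2 * t) • z (n + 1) - z n := eq_sub_of_add_eq (hz n)
    simp only [Q, hz', norm_sub_sq_real, inner_sub_left, real_inner_smul_left,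
      real_inner_self_eq_norm_sq, norm_smul, mul_pow, Real.norm_eq_abs, sq_abs,
      real_inner_comm (z (n + 1)) (z n)]
    ring
  have hQ_lim : Tendsto Q atTop (𝓝 0) := by
    simpa [Q] using ((hlim₁.norm.pow 2).add (hlim.norm.pow 2)).sub
      ((hlim₁.inner hlim).const_mul (2 * t))
  have hQ_zero (n : ℕ) : Q n = 0 := by
    have hconst : Q = fun _ => Q 0 :=
      funext fun n => Nat.rec rfl (fun n ih => (hQ_succ n).trans ih) n
    rw [hconst] at hQ_lim ⊢
    exact tendsto_nhds_unique tendsto_const_nhds hQ_lim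
  have hnorm_succ (n : ℕ) : ‖z (n + 1)‖ = ‖z n‖ := by
    have hinner : t * inner ℝ (z (n + 1)) (z n) ≤ ‖z (n + 1)‖ * ‖z n‖ := by
      refine (le_abs_self _).trans ?_
      rw [abs_mul]
      exact (mul_le_of_le_one_left (abs_nonneg _) ht).trans (abs_real_inner_le_norm _ _)
    have hsq : (‖z (n + 1)‖ - ‖z n‖) ^ 2 ≤ 0 := by linarith [hQ_zero n]
    exact sub_eq_zero.1 (pow_eq_zero_iff two_ne_zero |>.1 (hsq.antisymm (sq_nonneg _)))
  have hnorm : (fun n => ‖z n‖) = fun _ => ‖z n‖ := funext fun m => by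
    have hzero (m : ℕ) : ‖z m‖ = ‖z 0‖ := Nat.rec rfl (fun n ih => (hnorm_succ n).trans ih) m
    rw [hzero m, hzero n]
  have hnorm_lim := hlim.norm
  rw [hnorm, norm_zero] at hnorm_lim
  exact norm_eq_zero.1 (tendsto_nhds_unique tendsto_const_nhds hnorm_lim)

theorem tendsto_cofinite_zero_of_memℓp_two {ι V : Type*} [NormedAddCommGroup V] {y : ι → V}
    (hy : Memℓp y 2) : Tendsto y cofinite (𝓝 0) := by
  rw [tendsto_zero_iff_norm_tendsto_zero]
  simpa using (memℓp_two_iff_summable.1 hy).tendsto_cofinite_zero.sqrt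

variable {A α E : ℝ} {β : ℤ → ℝ} {y : ℤ → ℂ} {k : ℤ}

theorem add_eq_of_jacobi_eq_zero (hc : Real.cos (A * Real.pi) ≠ 0) {j : ℤ} (hβ : β j = α)
    (hJ : jacobi A β E y j = 0) :
    y (j + 1) + y (j - 1) = (2 * (xi α E / Real.cos (A * Real.pi))) • y j := by
  have hc' : Complex.cos (A * Real.pi) ≠ 0 := by exact_mod_cast hc
  rw [jacobi, hβ] at hJ
  rw [Complex.real_smul, xi]
  push_cast at hJ ⊢
  field_simp
  linear_combination 2 * hJ

theorem eq_zero_of_jacobi_eq_zero_of_lt (hc : Real.cos (A * Real.pi) ≠ 0)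
    (h : |xi α E| ≤ |Real.cos (A * Real.pi)|) (hβ : ∀ᶠ j in atTop, β j = α) (hy : Memℓp y 2)
    (hJ : ∀ j > k, jacobi A β E y j = 0) : ∀ j ≥ k, y j = 0 := by
  obtain ⟨n, hn⟩ := eventually_atTop.1 hβ
  have hratio : |xi α E / Real.cos (A * Real.pi)| ≤ 1 := by
    rw [abs_div]
    exact div_le_one_of_le₀ h (abs_nonneg _)
  have hright (j : ℤ) (hj : max n k ≤ j) : y j = 0 := by
    have hlim : Tendsto (fun i : ℕ => y (j + i)) atTop (𝓝 0) := by
      rw [← Nat.cofinite_eq_atTop]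
      exact (tendsto_cofinite_zero_of_memℓp_two hy).comp
        (Function.Injective.tendsto_cofinite fun a b hab => by simpa using hab)
    have hzero := eq_zero_of_recurrence hratio (fun i => ?_) hlim 0
    · simpa using hzero
    have hstep := add_eq_of_jacobi_eq_zero hc (hn (j + (i + 1 : ℕ)) (by omega))
      (hJ (j + (i + 1 : ℕ)) (by omega))
    convert hstep using 3
    · push_cast; ring
    · push_cast; ring
  have hdown (j : ℤ) (hj : k ≤ j) (hpair : y (j + 1) = 0 ∧ y (j + 2) = 0) : y j = 0 := by
    have hjac := hJ (j + 1) (by omega)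
    rw [jacobi, add_assoc, one_add_one_eq_two, hpair.1, hpair.2, add_sub_cancel_right, mul_zero,
      sub_zero, zero_add] at hjac
    exact (mul_eq_zero.1 hjac).resolve_left
      (mul_ne_zero two_ne_zero (Complex.ofReal_ne_zero.2 hc))
  have hpair (j : ℤ) (hj : j ≤ max n k) : k ≤ j → y j = 0 ∧ y (j + 1) = 0 := by
    induction j, hj using Int.leInductionDown with
    | base => exact fun _ => ⟨hright _ le_rfl, hright _ (by omega)⟩
    | pred j _ ih =>
      intro hkj
      have hnext := ih (by omega)
      rw [sub_add_cancel]
      exact ⟨hdown _ hkj (by convert hnext using 3 <;> ring), hnext.1⟩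
  exact fun j hj => (le_total j (max n k)).elim (fun hle => (hpair j hle hj).1) (hright j)

theorem jacobi_comp_neg (A E : ℝ) (β : ℤ → ℝ) (y : ℤ → ℂ) (j : ℤ) :
    jacobi A (fun i => β (-i)) E (fun i => y (-i)) j = jacobi A β E y (-j) := by
  rw [jacobi, jacobi, neg_add, neg_sub', sub_neg_eq_add, add_comm (y _), ← sub_eq_add_neg]

theorem eq_zero_of_jacobi_eq_zero_of_gt (hc : Real.cos (A * Real.pi) ≠ 0)
    (h : |xi α E| ≤ |Real.cos (A * Real.pi)|) (hβ : ∀ᶠ j in atBot, β j = α) (hy : Memℓp y 2)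
    (hJ : ∀ j < k, jacobi A β E y j = 0) : ∀ j ≤ k, y j = 0 := by
  intro j hj
  have hzero := eq_zero_of_jacobi_eq_zero_of_lt (k := -k) hc h
    (tendsto_neg_atTop_atBot.eventually hβ) (memℓp_two_comp_injective hy neg_injective)
    (fun i hi => (jacobi_comp_neg A E β y i).trans (hJ (-i) (by omega))) (-j) (by omega)
  rwa [neg_neg] at hzero

theorem eq_zero_of_jacobi_eq_zero_of_ne (hc : Real.cos (A * Real.pi) ≠ 0)
    (h : |xi α E| ≤ |Real.cos (A * Real.pi)|) (hβ : ∀ᶠ j in cofinite, β j = α) (hy : Memℓp y 2)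
    (hJ : ∀ j, j ≠ k → j ≠ k + 1 → jacobi A β E y j = 0) : y = 0 := by
  rw [Int.cofinite_eq, eventually_sup] at hβ
  have hleft := eq_zero_of_jacobi_eq_zero_of_gt hc h hβ.1 hy fun j (hj : j < k) =>
    hJ j (by omega) (by omega)
  have hright := eq_zero_of_jacobi_eq_zero_of_lt hc h hβ.2 hy fun j (hj : j > k + 1) =>
    hJ j (by omega) (by omega)
  exact funext fun j => (le_or_gt j k).elim (hleft j) fun hj => hright j (by omega)

end Decay

section VertexValue

variable {A : ℝ} {β β' : ℤ → ℝ}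

/-- The value at the vertex `j`, as a linear functional on the domain of the Hamiltonian. It is
read off the continuous representative on the upper semicircle starting at `j`. -/
noncomputable def vertexValue (A : ℝ) (β : ℤ → ℝ) (j : ℤ) : (hamiltonian A β).domain →ₗ[ℂ] ℂ where
  toFun f := (exists_isAction_domain f).choose (j, true) 0
  map_add' f f' := by
    obtain ⟨v, g, H⟩ := (exists_isAction_domain f).choose_spec
    obtain ⟨v', g', H'⟩ := (exists_isAction_domain f').choose_spec
    obtain ⟨v'', g'', H''⟩ := (exists_isAction_domain (f + f')).choose_spec
    exact H''.eqOn ((Lp.coeFn_add _ _).trans ((H.repr _).add (H'.repr _)))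
      ((H.continuousOn _).add (H'.continuousOn _)) zero_mem_Icc_pi
  map_smul' c f := by
    obtain ⟨v, g, H⟩ := (exists_isAction_domain f).choose_spec
    obtain ⟨v', g', H'⟩ := (exists_isAction_domain (c • f)).choose_spec
    exact H'.eqOn ((Lp.coeFn_smul _ _).trans ((H.repr _).const_smul c))
      ((H.continuousOn _).const_smul c) zero_mem_Icc_pi

theorem IsAction.vertexValue_eq {f : (hamiltonian A β).domain} {u v : Edge → ℝ → ℂ}
    {g : Edge → EdgeL2} (H : IsAction A β f (hamiltonian A β f) u v g) (j : ℤ) :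
    vertexValue A β j f = u (j, true) 0 := by
  obtain ⟨v', g', H'⟩ := (exists_isAction_domain f).choose_spec
  exact H'.eqOn (H.repr _) (H.continuousOn _) zero_mem_Icc_pi

theorem IsAction.congr_coupling {f h : ChainL2} {u v : Edge → ℝ → ℂ} {g : Edge → EdgeL2}
    (H : IsAction A β f h u v g) (hβ : ∀ j, β j = β' j ∨ u (j, true) 0 = 0) :
    IsAction A β' f h u v g where
  sobolev := H.sobolev
  repr := H.repr
  action := H.action
  continuity := H.continuity
  coupling j := by
    rw [H.coupling]
    rcases hβ j with h | h
    · rw [h]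
    · rw [h, mul_zero, mul_zero]

end VertexValue

section SpectralBands

variable {A α E : ℝ}

/-- The essential spectrum of the chain: the bands `|xi α E| ≤ |cos (A π)|`, together with the
flat bands, which sit at the Dirichlet eigenvalues of the edges. -/
def bandSet (A α : ℝ) : Set ℝ :=
  {E | |xi α E| ≤ |Real.cos (A * Real.pi)|} ∪ {E | sinE E Real.pi = 0}

theorem notMem_bandSet_iff :
    E ∉ bandSet A α ↔ |Real.cos (A * Real.pi)| < |xi α E| ∧ sinE E Real.pi ≠ 0 := by
  simp only [bandSet, mem_union, mem_ofPred_eq, not_or, not_le, ne_eq]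

theorem continuous_xi (α : ℝ) : Continuous (xi α) :=
  (continuous_cosE_left _).add ((continuous_sinE_left _).const_mul _)

theorem isClosed_bandSet (A α : ℝ) : IsClosed (bandSet A α) :=
  (isClosed_le (continuous_xi α).abs continuous_const).union
    (isClosed_eq (continuous_sinE_left _) continuous_const)

theorem one_lt_cosE_sub_mul_sinE {K : ℝ} (hE : E ≤ -(K + 1) ^ 2) :
    1 < cosE E Real.pi - K * sinE E Real.pi := by
  have hE₀ : E ≤ 0 := hE.trans (neg_nonpos.2 (sq_nonneg _))
  have hroot : K + 1 ≤ √(-E) := Real.le_sqrt_of_sq_le (by linarith)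
  have hsin : Real.pi ≤ sinE E Real.pi := by
    simpa [sinE] using intervalIntegral.integral_mono_on (a := 0) (b := Real.pi) (μ := volume)
      Real.pi_pos.le intervalIntegrable_const ((continuous_cosE E).intervalIntegrable _ _)
      (fun x _ => one_le_cosE hE₀ x)
  calc 1 < sinE E Real.pi := by linarith [Real.pi_gt_three]
    _ = (K + 1) * sinE E Real.pi - K * sinE E Real.pi := by ring
    _ ≤ √(-E) * sinE E Real.pi - K * sinE E Real.pi := by
      gcongr
      exact Real.pi_pos.le.trans hsin
    _ ≤ cosE E Real.pi - K * sinE E Real.pi := by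
      gcongr
      exact sqrt_neg_mul_sinE_le hE₀ _

theorem one_lt_xi (hE : E ≤ -(|α| / 4 + 1) ^ 2) : 1 < xi α E := by
  have hsin := sinE_pi_pos_of_lt_one (E := E) (by nlinarith)
  have hα := mul_le_mul_of_nonneg_right (neg_abs_le α) hsin.le
  rw [xi]
  linarith [one_lt_cosE_sub_mul_sinE hE]

theorem notMem_bandSet_of_le (hE : E ≤ -(|α| / 4 + 1) ^ 2) : E ∉ bandSet A α :=
  notMem_bandSet_iff.2 ⟨(Real.abs_cos_le_one _).trans_lt ((one_lt_xi hE).trans_le (le_abs_self _)),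
    (sinE_pi_pos_of_lt_one (by nlinarith)).ne'⟩

end SpectralBands

section Perturbation

variable {A α : ℝ} {β : ℤ → ℝ} {s : Finset ℤ} {I : Set ℝ}

theorem rank_eigenfunctionsIn_le_card (hβ : ∀ j ∉ s, β j = α) (hI : IsOpen I)
    (hIc : I.OrdConnected) (hd : Disjoint I (bandSet A α)) :
    Module.rank ℂ (eigenfunctionsIn (hamiltonian A β) I) ≤ s.card := by
  rw [← Fintype.card_coe]
  refine (isSymmetric_hamiltonian A β).rank_eigenfunctionsIn_le
    (isSymmetric_hamiltonian A fun _ => α) hI hIc (fun x hx => ?_)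
    (LinearMap.pi fun i : s => vertexValue A β i) fun f hf => ?_
  · obtain ⟨hxi, hS⟩ := notMem_bandSet_iff.1 (disjoint_left.1 hd hx)
    exact mem_resolventSet_const hS hxi
  · obtain ⟨u, v, g, H⟩ := exists_isAction_domain f
    refine (H.congr_coupling (β' := fun _ => α) fun j => ?_).exists_domain
    refine (em' (j ∈ s)).imp (hβ j) fun hj => ?_
    rw [← H.vertexValue_eq]
    exact congrFun hf ⟨j, hj⟩

theorem mem_resolventSet_of_notMem_bandSet (hβ : ∀ j ∉ s, β j = α) {E : ℝ} (hE : E ∉ bandSet A α)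
    (he : eigenspace (hamiltonian A β) (E : ℂ) = ⊥) : (E : ℂ) ∈ resolventSet (hamiltonian A β) :=
  have hE := notMem_bandSet_iff.1 hE
  mem_resolventSet_of_eigenspace_eq_bot hβ hE.2 hE.1 he

theorem exists_real_mem_resolventSet (A : ℝ) (hβ : ∀ j ∉ s, β j = α) :
    ∃ E : ℝ, (E : ℂ) ∈ resolventSet (hamiltonian A β) := by
  have hnotMem (x : ℝ) (hx : x ∈ Iio (-(|α| / 4 + 1) ^ 2)) : x ∉ bandSet A α :=
    notMem_bandSet_of_le (le_of_lt hx)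
  obtain ⟨E, -, hE⟩ := (isSymmetric_hamiltonian A β).exists_mem_resolventSet isOpen_Iio
    nonempty_Iio (rank_eigenfunctionsIn_le_card hβ isOpen_Iio ordConnected_Iio
      (disjoint_left.2 hnotMem)) fun x hx => mem_resolventSet_of_notMem_bandSet hβ (hnotMem x hx)
  exact ⟨E, hE⟩

theorem essentialSpectrum_subset (A : ℝ) (hβ : ∀ j ∉ s, β j = α) :
    essentialSpectrum (hamiltonian A β) ⊆ Complex.ofReal '' bandSet A α := by
  rintro z ⟨hz, hnd⟩
  have hT := isSymmetric_hamiltonian A β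
  obtain ⟨E₀, hE₀⟩ := exists_real_mem_resolventSet A hβ
  have him : z.im = 0 := by_contra fun h => hz (hT.mem_resolventSet_of_im_ne_zero hE₀ h)
  obtain ⟨E, rfl⟩ : ∃ E : ℝ, (E : ℂ) = z := ⟨z.re, Complex.ext rfl him.symm⟩
  refine mem_image_of_mem _ (by_contra fun hE => hnd ?_)
  obtain ⟨ε, hε, hball⟩ := Metric.isOpen_iff.1 (isClosed_bandSet A α).isOpen_compl E hE
  rw [Real.ball_eq_Ioo] at hball
  exact hT.mem_discreteSpectrum isOpen_Ioo
    (rank_eigenfunctionsIn_le_card hβ isOpen_Ioo ordConnected_Ioo (disjoint_left.2 hball))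
    (fun x hx => mem_resolventSet_of_notMem_bandSet hβ (hball hx))
    ⟨sub_lt_self E hε, lt_add_of_pos_right E hε⟩ hz

end Perturbation

section EssentialSpectrum

theorem not_finiteDimensional_of_disjoint {ι γ κ : Type*} {G : ι → Type*}
    [∀ i, NormedAddCommGroup (G i)] [∀ i, InnerProductSpace ℂ (G i)] [Infinite κ]
    {V : Submodule ℂ (lp G 2)} {F : κ → lp G 2} (hV : ∀ k, F k ∈ V) (hF : ∀ k, F k ≠ 0)
    {ρ : ι → γ} {c : κ → γ} (hc : Function.Injective c) (hs : ∀ k i, ρ i ≠ c k → F k i = 0) :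
    ¬ FiniteDimensional ℂ V := by
  intro hfin
  have hinner (k l : κ) (hkl : k ≠ l) : inner ℂ (F k) (F l) = 0 := by
    rw [lp.inner_eq_tsum]
    refine (tsum_congr fun i => ?_).trans tsum_zero
    by_cases hi : ρ i = c k
    · rw [hs l i (hi ▸ hc.ne hkl), inner_zero_right]
    · rw [hs k i hi, inner_zero_left]
  have hli : LinearIndependent ℂ (fun k => (⟨F k, hV k⟩ : V)) :=
    LinearIndependent.of_comp V.subtype (linearIndependent_of_ne_zero_of_inner_eq_zero hF hinner)
  exact not_finite_iff_infinite.2 ‹_› hli.finite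

theorem mem_essentialSpectrum_of_not_finiteDimensional {H : Type*} [NormedAddCommGroup H]
    [NormedSpace ℂ H] {T : H →ₗ.[ℂ] H} {z : ℂ} (h : ¬ FiniteDimensional ℂ (eigenspace T z)) :
    z ∈ essentialSpectrum T := by
  refine ⟨fun hz => h ?_, fun hd => h hd.2.2.2⟩
  rw [eigenspace_eq_bot_of_mem_resolventSet hz]
  infer_instance

variable {A α E : ℝ} {β : ℤ → ℝ} {s : Finset ℤ} {f : ChainL2} {u v : Edge → ℝ → ℂ}
  {g : Edge → EdgeL2}

theorem IsAction.edge_eq_zero (H : IsAction A β f ((E : ℂ) • f) u v g) (hS : sinE E Real.pi ≠ 0)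
    {e : Edge} (hl : u (e.1, true) 0 = 0) (hr : u (e.1 + 1, true) 0 = 0) : f e = 0 := by
  refine (H.edge e).eq_zero (by rw [H.left_value, hl]) ?_
  have hend := IsAction.phase_mul_vertex_succ (r := 0) (by rwa [add_zero]) e
  rw [hl, hr, lp.coeFn_zero, Pi.zero_apply, sourceValue_zero, mul_zero, mul_zero, zero_add,
    sub_zero] at hend
  exact (mul_eq_zero.1 hend.symm).resolve_left (Complex.ofReal_ne_zero.2 hS)

theorem mem_essentialSpectrum_of_cos_eq_zero (hβ : ∀ j ∉ s, β j = α) (hS : sinE E Real.pi ≠ 0)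
    (hc : Real.cos (A * Real.pi) = 0) (hξ : xi α E = 0) :
    (E : ℂ) ∈ essentialSpectrum (hamiltonian A β) := by
  let κ := {n : ℤ | 2 * n + 1 ∉ s}
  have : Infinite κ := ((s.finite_toSet.preimage fun a _ b _ hab => by
    simpa using hab).infinite_compl : ((fun n : ℤ => 2 * n + 1) ⁻¹' s)ᶜ.Infinite).to_subtype
  have hmem (n : κ) : Memℓp (E := fun _ : ℤ => ℂ) (Pi.single (2 * n + 1 : ℤ) (1 : ℂ)) 2 := by
    simpa only [lp.coeFn_single] using lp.memℓp (lp.single 2 (2 * n + 1 : ℤ) (1 : ℂ) : VertexL2)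
  have hsol (n : κ) := exists_isAction_of_jacobi (A := A) (β := β) (r := 0) hS (hmem n) fun j => by
    rw [source_zero, neg_zero, jacobi, hc, Complex.ofReal_zero, mul_zero, zero_mul, zero_sub,
      neg_eq_zero]
    rcases eq_or_ne j (2 * n + 1) with rfl | hj
    · rw [hβ _ n.2, show 4 * cosE E Real.pi + α * sinE E Real.pi = 4 * xi α E by rw [xi]; ring,
        hξ, mul_zero, Complex.ofReal_zero, zero_mul]
    · rw [Pi.single_eq_of_ne hj, mul_zero]
  choose F u v g H hu using hsol
  simp only [add_zero] at H
  refine mem_essentialSpectrum_of_not_finiteDimensional (not_finiteDimensional_of_disjoint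
    (fun n => mem_eigenspace_hamiltonian_iff.2 ⟨u n, v n, g n, H n⟩) (fun n hF => ?_)
    (ρ := fun e : Edge => e.1 / 2) Subtype.val_injective fun n e he => ?_)
  · have hzero := IsAction.vertex_eq_zero (hF ▸ H n) (2 * n + 1, true)
    rw [hu, Pi.single_eq_same] at hzero
    exact one_ne_zero hzero
  · refine (H n).edge_eq_zero hS ?_ ?_ <;> rw [hu, Pi.single_eq_of_ne (by dsimp only; omega)]

theorem single_apply_of_ne {e e' : Edge} (he : e ≠ e') (r : EdgeL2) :
    (lp.single 2 e' r : ChainL2) e = 0 := by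
  rw [lp.single_apply, Pi.single_eq_of_ne he]

theorem source_single_of_ne {k j : ℤ} (hk : j ≠ k) (hk' : j ≠ k + 1) (r : EdgeL2) :
    source A E (lp.single 2 ((k, true) : Edge) r) j = 0 := by
  rw [source, single_apply_of_ne (e := (j, true)) (by simpa using hk),
    single_apply_of_ne (e := (j, false)) (by simp),
    single_apply_of_ne (e := (j - 1, true)) (by simpa [sub_eq_iff_eq_add] using hk'),
    single_apply_of_ne (e := (j - 1, false)) (by simp)]
  simp only [sourceValue_zero, sourceDeriv_zero, mul_zero, sub_zero, add_zero]

theorem source_single_self (A E : ℝ) (k : ℤ) (r : EdgeL2) :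
    source A E (lp.single 2 ((k, true) : Edge) r) k = sourceValue E A r := by
  rw [source, lp.single_apply, Pi.single_eq_same,
    single_apply_of_ne (e := (k, false)) (by simp),
    single_apply_of_ne (e := (k - 1, true)) (by simp),
    single_apply_of_ne (e := (k - 1, false)) (by simp)]
  simp only [sourceValue_zero, sourceDeriv_zero, mul_zero, sub_zero, add_zero]

theorem exists_sourceValue_ne_zero (a : ℝ) (hS : sinE E Real.pi ≠ 0) :
    ∃ r, sourceValue E a r ≠ 0 := by
  have hcont : Continuous fun x => sinE E (Real.pi - x) :=
    (continuous_sinE E).comp (continuous_const.sub continuous_id)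
  obtain ⟨r, hr⟩ := EdgeL2.exists_ae_eq
    ((Complex.continuous_ofReal.comp hcont).mul (continuous_phase (-a))).continuousOn
  have hvalue : sourceValue E a r =
      ((∫ x in (0 : ℝ)..Real.pi, sinE E (Real.pi - x) ^ 2 : ℝ) : ℂ) := by
    rw [sourceValue, ← intervalIntegral.integral_ofReal]
    refine intervalIntegral_congr_edgeMeasure ?_
    filter_upwards [hr] with x hx
    rw [hx]
    simp only [Pi.mul_apply, Function.comp_apply]
    push_cast
    linear_combination (sinE E (Real.pi - x) : ℂ) ^ 2 * phase_neg_mul_phase a x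
  refine ⟨r, ?_⟩
  rw [hvalue, Complex.ofReal_ne_zero]
  refine (intervalIntegral.integral_pos Real.pi_pos (hcont.pow 2).continuousOn
    (fun x _ => sq_nonneg _) ⟨0, zero_mem_Icc_pi, ?_⟩).ne'
  change 0 < sinE E (Real.pi - 0) ^ 2
  rw [sub_zero]
  positivity

theorem eigenspace_eq_bot_of_abs_xi_le (hβ : ∀ᶠ j in cofinite, β j = α)
    (hS : sinE E Real.pi ≠ 0) (hc : Real.cos (A * Real.pi) ≠ 0)
    (hξ : |xi α E| ≤ |Real.cos (A * Real.pi)|) : eigenspace (hamiltonian A β) (E : ℂ) = ⊥ := by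
  refine (Submodule.eq_bot_iff _).2 fun f hf => ?_
  obtain ⟨u, v, g, H⟩ := mem_eigenspace_hamiltonian_iff.1 hf
  have hvertex := eq_zero_of_jacobi_eq_zero_of_ne (k := 0) hc hξ hβ H.memℓp_vertex fun j _ _ =>
    H.jacobi_eq_zero j
  exact H.eq_zero hS (congrFun hvertex)

/-- A source on a single edge admits no square integrable solution: its vertex values vanish off
the edge, hence everywhere, which contradicts the Jacobi equation at the end of the edge. -/
theorem mem_spectrum_of_abs_xi_le (hβ : ∀ᶠ j in cofinite, β j = α) (hS : sinE E Real.pi ≠ 0)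
    (hc : Real.cos (A * Real.pi) ≠ 0) (hξ : |xi α E| ≤ |Real.cos (A * Real.pi)|) :
    (E : ℂ) ∈ spectrum (hamiltonian A β) := by
  intro hres
  obtain ⟨r, hr⟩ := exists_sourceValue_ne_zero A hS
  let ρ : ChainL2 := lp.single 2 ((0, true) : Edge) r
  obtain ⟨R, hR, -⟩ := hres
  obtain ⟨hdom, hsol⟩ := hR ρ
  obtain ⟨u, v, g, H⟩ := exists_isAction_domain (⟨R ρ, hdom⟩ : (hamiltonian A β).domain)
  rw [sub_eq_iff_eq_add'.1 hsol] at H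
  have hvertex := eq_zero_of_jacobi_eq_zero_of_ne (k := 0) hc hξ hβ H.memℓp_vertex
    fun j hj hj' => by rw [H.jacobi_eq, source_single_of_ne hj hj', neg_zero]
  have hjacobi := H.jacobi_eq 0
  rw [hvertex, source_single_self, jacobi, Pi.zero_apply, Pi.zero_apply, Pi.zero_apply, add_zero,
    mul_zero, mul_zero, sub_zero, zero_eq_neg] at hjacobi
  exact hr hjacobi

end EssentialSpectrum

section FlatBands

theorem IsEdgeAction.initial_eq_zero {a : ℝ} {h g : EdgeL2} {u v : ℝ → ℂ}
    (H : IsEdgeAction a 0 h u v g) : v 0 + Complex.I * a * u 0 = 0 := by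
  have hu : EqOn u 0 (Icc 0 Real.pi) := eqOn_Icc_pi_of_ae_eq
    (H.repr.symm.trans (Lp.coeFn_zero ℂ 2 edgeMeasure))
    (uIcc_zero_pi ▸ H.sobolev.isPrimitive.continuousOn) continuousOn_const
  have hv : v 0 = 0 := (uniqueDiffOn_Icc Real.pi_pos 0 zero_mem_Icc_pi).eq_deriv _
    (H.sobolev.deriv 0 zero_mem_Icc_pi)
    ((hasDerivWithinAt_const 0 _ (0 : ℂ)).congr (fun x hx => hu hx) (hu zero_mem_Icc_pi))
  rw [hv, hu zero_mem_Icc_pi, Pi.zero_apply, mul_zero, add_zero]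

variable {A : ℝ} {s : ℂ}

/-- Initial values of the quasiderivatives of an eigenfunction which vanishes at all vertices and
lives on the rings `m` and `m + 1`; `s` is the sign of `cos (n π)` for the eigenvalue `n²`. -/
noncomputable def flatCoeff (A : ℝ) (s : ℂ) (m : ℤ) (e : Edge) : ℂ :=
  if e.1 = m then (if e.2 then 1 else -1)
  else if e.1 = m + 1 then (if e.2 then -s * phase A Real.pi else s * phase (-A) Real.pi) else 0

theorem memℓp_flatCoeff (A : ℝ) (s : ℂ) (m : ℤ) : Memℓp (flatCoeff A s m) 2 := by
  refine (memℓp_zero ?_).of_exponent_ge (zero_le : (0 : ENNReal) ≤ 2)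
  refine (((finite_singleton m).insert (m + 1)).prod finite_univ).subset fun e he => ?_
  simp only [mem_prod, mem_insert_iff, mem_singleton_iff, mem_univ, and_true]
  by_contra! h
  exact he (by rw [flatCoeff, if_neg h.2, if_neg h.1])

theorem flatCoeff_coupling (A : ℝ) (s : ℂ) (m j : ℤ) :
    flatCoeff A s m (j, true) + flatCoeff A s m (j, false) =
      s * (phase (-A) Real.pi * flatCoeff A s m (j - 1, true) +
        phase A Real.pi * flatCoeff A s m (j - 1, false)) := by
  simp only [flatCoeff, if_true, Bool.false_eq_true, if_false]
  split_ifs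
  all_goals first | omega | ring

theorem mem_essentialSpectrum_sq (A : ℝ) (β : ℤ → ℝ) {n : ℕ} (hn : n ≠ 0) :
    (((n : ℝ) ^ 2 : ℝ) : ℂ) ∈ essentialSpectrum (hamiltonian A β) := by
  have hsol (k : ℤ) := exists_isAction (E := (n : ℝ) ^ 2) (A := A) (β := β) (r := (0 : ChainL2))
    (y := fun _ => 0)
    zero_memℓp (memℓp_flatCoeff A ((-1) ^ n) (2 * k))
    (fun e => by
      simp only [sinE_sq_pi hn, lp.coeFn_zero, Pi.zero_apply, sourceValue_zero, mul_zero,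
        Complex.ofReal_zero, zero_mul, add_zero, sub_zero])
    (fun j => by
      rw [flatCoeff_coupling, sinE_sq_pi hn, cosE_sq_pi]
      simp only [lp.coeFn_zero, Pi.zero_apply, sourceDeriv_zero, mul_zero, zero_add, sub_zero]
      push_cast
      ring)
  choose F u v g H hu hDu using hsol
  simp only [add_zero] at H
  refine mem_essentialSpectrum_of_not_finiteDimensional (not_finiteDimensional_of_disjoint
    (fun k => mem_eigenspace_hamiltonian_iff.2 ⟨u k, v k, g k, H k⟩) (fun k hF => ?_)
    (ρ := fun e : Edge => e.1 / 2) Function.injective_id fun k e he => ?_)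
  · have hedge := (H k).edge (2 * k, true)
    rw [hF] at hedge
    have hzero := (hDu k (2 * k, true)).symm.trans hedge.initial_eq_zero
    rw [flatCoeff, if_pos rfl, if_pos rfl] at hzero
    exact one_ne_zero hzero
  · refine ((H k).edge e).eq_zero (hu k e) ((hDu k e).trans ?_)
    rw [flatCoeff, if_neg (by dsimp only [id] at he; omega),
      if_neg (by dsimp only [id] at he; omega)]

end FlatBands

section FinitelyManyImpurities

variable {α : ℝ} {β : ℤ → ℝ} {s : Finset ℤ}

theorem essentialSpectrum_eq (A : ℝ) (hβ : ∀ j ∉ s, β j = α) :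
    essentialSpectrum (hamiltonian A β) = Complex.ofReal '' bandSet A α := by
  refine (essentialSpectrum_subset A hβ).antisymm ?_
  rintro _ ⟨E, hE, rfl⟩
  by_cases hS : sinE E Real.pi = 0
  · obtain ⟨n, hn, rfl⟩ := sinE_pi_eq_zero_iff.1 hS
    exact mem_essentialSpectrum_sq A β hn
  have hξ := hE.resolve_right hS
  by_cases hc : Real.cos (A * Real.pi) = 0
  · refine mem_essentialSpectrum_of_cos_eq_zero hβ hS hc (abs_nonpos_iff.1 (hξ.trans ?_))
    rw [hc, abs_zero]
  · have hβ' := s.eventually_cofinite_notMem.mono hβ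
    exact ⟨mem_spectrum_of_abs_xi_le hβ' hS hc hξ,
      fun hd => hd.2.2.1 (eigenspace_eq_bot_of_abs_xi_le hβ' hS hc hξ)⟩

theorem realEssentialSpectrum_eq (A : ℝ) (hβ : ∀ j ∉ s, β j = α) :
    realEssentialSpectrum (hamiltonian A β) = bandSet A α := by
  rw [realEssentialSpectrum, essentialSpectrum_eq A hβ]
  exact preimage_image_eq _ Complex.ofReal_injective

end FinitelyManyImpurities

section Cells

variable {α t x E E' : ℝ} {K : Set ℝ} {n : ℕ}

theorem cosE_add_div_sinE_eq_half (hC : cosE E x ≠ 0) (hS : sinE E x ≠ 0) :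
    (cosE E (x + x) + t) / sinE E (x + x) =
      (1 + t) / 2 * (cosE E x / sinE E x) + (1 - t) / 2 * (-E * sinE E x / cosE E x) := by
  have hpyth := cosE_sq_add E x
  rw [sinE_add, cosE_add, mul_comm (cosE E x) (sinE E x), ← two_mul]
  field_simp
  linear_combination -t * hpyth

/-- The half-angle formula writes the quotient as a convex combination of the logarithmic
derivatives of `sinE` and `cosE`. -/
theorem strictAntiOn_cosE_add_div_sinE (ht : |t| ≤ 1) (hx : 0 < x) (hK : K.OrdConnected)
    (hS : ∀ E ∈ K, sinE E (x + x) ≠ 0) :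
    StrictAntiOn (fun E => (cosE E (x + x) + t) / sinE E (x + x)) K := by
  obtain ⟨ht₁, ht₂⟩ := abs_le.1 ht
  have hsin (E) (hE : E ∈ K) : sinE E x ≠ 0 := fun h => hS E hE (by rw [sinE_add, h]; ring)
  have hcos (E) (hE : E ∈ K) : cosE E x ≠ 0 := fun h => hS E hE (by rw [sinE_add, h]; ring)
  have hcot := strictAntiOn_logDeriv hx continuous_uncurry_sinE hasDerivAt_sinE hasDerivAt_cosE
    (fun _ _ => by simp only [sinE_zero_right]; ring) hK hsin
  have htan := strictAntiOn_logDeriv (p := fun E x => -E * sinE E x) hx continuous_uncurry_cosE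
    hasDerivAt_cosE (fun E x => (hasDerivAt_sinE E x).const_mul (-E))
    (fun _ _ => by simp only [sinE_zero_right]; ring) hK hcos
  intro E hE E' hE' hlt
  simp only [cosE_add_div_sinE_eq_half (hcos _ hE) (hsin _ hE),
    cosE_add_div_sinE_eq_half (hcos _ hE') (hsin _ hE')]
  have hcot' : cosE E' x / sinE E' x < cosE E x / sinE E x := hcot hE hE' hlt
  have htan' : -E' * sinE E' x / cosE E' x < -E * sinE E x / cosE E x := htan hE hE' hlt
  rcases lt_or_ge 0 t with h | h
  · exact add_lt_add_of_lt_of_le (mul_lt_mul_of_pos_left hcot' (by linarith))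
      (mul_le_mul_of_nonneg_left htan'.le (by linarith))
  · exact add_lt_add_of_le_of_lt (mul_le_mul_of_nonneg_left hcot'.le (by linarith))
      (mul_lt_mul_of_pos_left htan' (by linarith))

/-- The `n`-th interval between consecutive Dirichlet eigenvalues of an edge: `(-∞, 1)` for
`n = 0` and `(n², (n + 1)²)` for `n ≥ 1`. -/
def cell (n : ℕ) : Set ℝ := {E | (n ≠ 0 → (n : ℝ) ^ 2 < E) ∧ E < ((n : ℝ) + 1) ^ 2}

theorem cell_zero : cell 0 = Iio 1 := by
  ext E
  simp [cell]

theorem Ioo_sq_subset_cell (n : ℕ) : Ioo ((n : ℝ) ^ 2) (((n : ℝ) + 1) ^ 2) ⊆ cell n :=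
  fun _ hE => ⟨fun _ => hE.1, hE.2⟩

theorem ordConnected_cell (n : ℕ) : (cell n).OrdConnected :=
  ⟨fun _ hx _ hy _ hz => ⟨fun hn => (hx.1 hn).trans_le hz.1, hz.2.trans_lt hy.2⟩⟩

theorem exists_mem_cell (hE : sinE E Real.pi ≠ 0) : ∃ n, E ∈ cell n := by
  rcases lt_or_ge E 1 with h | h
  · exact ⟨0, cell_zero ▸ h⟩
  · obtain ⟨n, hn, hle, hlt⟩ := exists_nat_sq_le h
    exact ⟨n, fun _ => lt_of_le_of_ne' hle fun he => hE (he ▸ sinE_sq_pi hn), hlt⟩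

theorem neg_one_pow_mul_sinE_pos_of_mem_cell (hE : E ∈ cell n) :
    0 < (-1) ^ n * sinE E Real.pi := by
  rcases eq_or_ne n 0 with rfl | hn
  · rw [cell_zero] at hE
    rw [pow_zero, one_mul]
    exact sinE_pi_pos_of_lt_one hE
  · exact neg_one_pow_mul_sinE_pi_pos (hE.1 hn) hE.2

theorem sinE_ne_zero_of_mem_cell (hE : E ∈ cell n) : sinE E Real.pi ≠ 0 :=
  right_ne_zero_of_mul (neg_one_pow_mul_sinE_pos_of_mem_cell hE).ne'

theorem neg_one_pow_mul_self (n : ℕ) : (-1 : ℝ) ^ n * (-1) ^ n = 1 := by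
  rw [← mul_pow, neg_one_mul, neg_neg, one_pow]

theorem neg_one_pow_mul_xi_sq (α : ℝ) (hn : n ≠ 0) : (-1) ^ n * xi α ((n : ℝ) ^ 2) = 1 := by
  rw [xi, cosE_sq_pi, sinE_sq_pi hn, mul_zero, add_zero, neg_one_pow_mul_self]

theorem neg_one_pow_mul_xi_add_one_sq (α : ℝ) (n : ℕ) :
    (-1) ^ n * xi α (((n : ℝ) + 1) ^ 2) = -1 := by
  have h := neg_one_pow_mul_xi_sq α n.succ_ne_zero
  rw [pow_succ, Nat.cast_succ] at h
  linear_combination -h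

theorem lt_neg_one_pow_mul_xi_of_lt (ht : |t| ≤ 1) (hE : E ∈ cell n) (hE' : E' ∈ cell n)
    (hlt : E < E') (h : t ≤ (-1) ^ n * xi α E') : t < (-1) ^ n * xi α E := by
  have hquot {E : ℝ} (hE : E ∈ cell n) : (-1) ^ n * xi α E - t = ((-1) ^ n * sinE E Real.pi) *
      ((cosE E Real.pi + -((-1) ^ n * t)) / sinE E Real.pi + α / 4) := by
    have hS := sinE_ne_zero_of_mem_cell hE
    rw [xi]
    field_simp
    linear_combination 4 * t * neg_one_pow_mul_self n
  have hanti := strictAntiOn_cosE_add_div_sinE (t := -((-1) ^ n * t)) (x := Real.pi / 2)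
    (by rwa [abs_neg, abs_mul, abs_neg_one_pow, one_mul]) (by positivity) (ordConnected_cell n)
    (fun E hE => by rw [add_halves]; exact sinE_ne_zero_of_mem_cell hE)
  simp only [add_halves] at hanti
  rw [← sub_nonneg, hquot hE'] at h
  rw [← sub_pos, hquot hE]
  have hnonneg := nonneg_of_mul_nonneg_right h (neg_one_pow_mul_sinE_pos_of_mem_cell hE')
  have hdecr := hanti hE hE' hlt
  simp only at hdecr
  exact mul_pos (neg_one_pow_mul_sinE_pos_of_mem_cell hE) (by linarith)

theorem lt_neg_one_pow_mul_xi_iff (ht : |t| ≤ 1) (hE : E ∈ cell n) (hE' : E' ∈ cell n)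
    (h : (-1) ^ n * xi α E' = t) : t < (-1) ^ n * xi α E ↔ E < E' := by
  refine ⟨fun hlt => ?_, fun hlt => lt_neg_one_pow_mul_xi_of_lt ht hE hE' hlt h.ge⟩
  by_contra! hle
  rcases hle.lt_or_eq with hlt' | rfl
  · exact (lt_neg_one_pow_mul_xi_of_lt ht hE' hE hlt' hlt.le).ne' h
  · exact hlt.ne' h

theorem neg_one_pow_mul_xi_lt_iff (ht : |t| ≤ 1) (hE : E ∈ cell n) (hE' : E' ∈ cell n)
    (h : (-1) ^ n * xi α E' = t) : (-1) ^ n * xi α E < t ↔ E' < E := by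
  constructor
  · intro hlt
    by_contra! hle
    rcases hle.lt_or_eq with hlt' | rfl
    · exact hlt.asymm (lt_neg_one_pow_mul_xi_of_lt ht hE hE' hlt' h.ge)
    · exact hlt.ne h
  · intro hlt
    by_contra! hle
    exact (lt_neg_one_pow_mul_xi_of_lt ht hE' hE hlt hle).ne' h

theorem exists_mem_cell_gt (α : ℝ) (ht : t < 1) (n : ℕ) :
    ∃ E ∈ cell n, t < (-1) ^ n * xi α E := by
  rcases eq_or_ne n 0 with rfl | hn
  · refine ⟨-(|α| / 4 + 1) ^ 2, ?_, ?_⟩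
    · rw [cell_zero, mem_Iio]
      nlinarith
    · rw [pow_zero, one_mul]
      exact ht.trans (one_lt_xi le_rfl)
  · have hev : ∀ᶠ E in 𝓝[>] ((n : ℝ) ^ 2), t < (-1) ^ n * xi α E :=
      nhdsWithin_le_nhds (continuousAt_const.eventually_lt
        ((continuous_xi α).const_mul _).continuousAt (by rwa [neg_one_pow_mul_xi_sq α hn]))
    have hcell := Ioo_mem_nhdsGT (by gcongr; linarith : (n : ℝ) ^ 2 < ((n : ℝ) + 1) ^ 2)
    obtain ⟨E, hE, hlt⟩ := Filter.nonempty_of_mem (inter_mem hcell hev)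
    exact ⟨E, Ioo_sq_subset_cell n hE, hlt⟩

theorem exists_mem_cell_lt (α : ℝ) (ht : -1 < t) (n : ℕ) :
    ∃ E ∈ cell n, (-1) ^ n * xi α E < t := by
  have hev : ∀ᶠ E in 𝓝[<] (((n : ℝ) + 1) ^ 2), (-1) ^ n * xi α E < t :=
    nhdsWithin_le_nhds (((continuous_xi α).const_mul _).continuousAt.eventually_lt
      continuousAt_const (by rwa [neg_one_pow_mul_xi_add_one_sq]))
  have hcell := Ioo_mem_nhdsLT (by gcongr; linarith : (n : ℝ) ^ 2 < ((n : ℝ) + 1) ^ 2)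
  obtain ⟨E, hE, hlt⟩ := Filter.nonempty_of_mem (inter_mem hcell hev)
  exact ⟨E, Ioo_sq_subset_cell n hE, hlt⟩

theorem exists_mem_cell_eq (α : ℝ) (ht : |t| < 1) (n : ℕ) :
    ∃ E ∈ cell n, (-1) ^ n * xi α E = t := by
  obtain ⟨ht₁, ht₂⟩ := abs_lt.1 ht
  obtain ⟨E₁, hE₁, h₁⟩ := exists_mem_cell_lt α ht₁ n
  obtain ⟨E₂, hE₂, h₂⟩ := exists_mem_cell_gt α ht₂ n
  exact (ordConnected_cell n).isPreconnected.intermediate_value hE₁ hE₂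
    ((continuous_xi α).const_mul _).continuousOn ⟨h₁.le, h₂.le⟩

end Cells

section BandEdges

/-- `a n` and `b n` are the lower and the upper edge of the band in the `n`-th cell. -/
structure IsBandEdges (A α : ℝ) (a b : ℕ → ℝ) : Prop where
  left_mem : ∀ n, a n ∈ cell n
  right_mem : ∀ n, b n ∈ cell n
  left_eq : ∀ n, (-1) ^ n * xi α (a n) = |Real.cos (A * Real.pi)|
  right_eq : ∀ n, (-1) ^ n * xi α (b n) = -|Real.cos (A * Real.pi)|

/-- The sequence `a 0, 1, a 1, 4, a 2, 9, …`: applied to the lower and to the upper edges of the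
bands, it lists the lower and the upper ends of all bands, flat ones included, in increasing
order. -/
noncomputable def interleaveSq (a : ℕ → ℝ) (m : ℕ) : ℝ :=
  if Even m then a (m / 2) else (((m / 2 : ℕ) : ℝ) + 1) ^ 2

theorem interleaveSq_even (a : ℕ → ℝ) (k : ℕ) : interleaveSq a (2 * k) = a k := by
  rw [interleaveSq, if_pos (even_two_mul k), Nat.mul_div_cancel_left k two_pos]

theorem interleaveSq_odd (a : ℕ → ℝ) (k : ℕ) :
    interleaveSq a (2 * k + 1) = ((k : ℝ) + 1) ^ 2 := by
  rw [interleaveSq, if_neg (Nat.not_even_two_mul_add_one k), show (2 * k + 1) / 2 = k by omega]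

theorem exists_lt_interleaveSq (a : ℕ → ℝ) (x : ℝ) : ∃ m, x < interleaveSq a m := by
  obtain ⟨k, hk⟩ := exists_nat_gt x
  refine ⟨2 * k + 1, ?_⟩
  rw [interleaveSq_odd]
  nlinarith

variable {A α E : ℝ} {a b : ℕ → ℝ}

theorem exists_isBandEdges (hA : |Real.cos (A * Real.pi)| < 1) (α : ℝ) :
    ∃ a b, IsBandEdges A α a b := by
  choose a ha ha' using exists_mem_cell_eq α (t := |Real.cos (A * Real.pi)|) (by rwa [abs_abs])
  choose b hb hb' using exists_mem_cell_eq α (t := -|Real.cos (A * Real.pi)|)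
    (by rwa [abs_neg, abs_abs])
  exact ⟨a, b, ha, hb, ha', hb'⟩

namespace IsBandEdges

theorem abs_cos_lt_iff (h : IsBandEdges A α a b) {n : ℕ} (hE : E ∈ cell n) :
    |Real.cos (A * Real.pi)| < (-1) ^ n * xi α E ↔ E < a n :=
  lt_neg_one_pow_mul_xi_iff (by rw [abs_abs]; exact Real.abs_cos_le_one _) hE (h.left_mem n)
    (h.left_eq n)

theorem lt_neg_abs_cos_iff (h : IsBandEdges A α a b) {n : ℕ} (hE : E ∈ cell n) :
    (-1) ^ n * xi α E < -|Real.cos (A * Real.pi)| ↔ b n < E :=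
  neg_one_pow_mul_xi_lt_iff (by rw [abs_neg, abs_abs]; exact Real.abs_cos_le_one _) hE
    (h.right_mem n) (h.right_eq n)

theorem le (h : IsBandEdges A α a b) (n : ℕ) : a n ≤ b n := by
  by_contra! hlt
  have hcos := (h.abs_cos_lt_iff (h.right_mem n)).2 hlt
  rw [h.right_eq] at hcos
  linarith [abs_nonneg (Real.cos (A * Real.pi))]

theorem interleaveSq_le (h : IsBandEdges A α a b) (m : ℕ) :
    interleaveSq a m ≤ interleaveSq b m := by
  obtain ⟨k, rfl | rfl⟩ := Nat.even_or_odd' m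
  · rw [interleaveSq_even, interleaveSq_even]
    exact h.le k
  · rw [interleaveSq_odd, interleaveSq_odd]

theorem interleaveSq_lt (h : IsBandEdges A α a b) (m : ℕ) :
    interleaveSq b m < interleaveSq a (m + 1) := by
  obtain ⟨k, rfl | rfl⟩ := Nat.even_or_odd' m
  · rw [interleaveSq_even, interleaveSq_odd]
    exact (h.right_mem k).2
  · rw [interleaveSq_odd, show 2 * k + 1 + 1 = 2 * (k + 1) by ring, interleaveSq_even]
    exact_mod_cast (h.left_mem (k + 1)).1 k.succ_ne_zero

theorem abs_xi_le_iff (h : IsBandEdges A α a b) {n : ℕ} (hE : E ∈ cell n) :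
    |xi α E| ≤ |Real.cos (A * Real.pi)| ↔ E ∈ Icc (a n) (b n) := by
  have habs : |(-1 : ℝ) ^ n * xi α E| = |xi α E| := by rw [abs_mul, abs_neg_one_pow, one_mul]
  rw [← habs, abs_le, mem_Icc, ← not_lt, ← not_lt, h.lt_neg_abs_cos_iff hE, h.abs_cos_lt_iff hE,
    not_lt, not_lt, and_comm]

theorem bandSet_eq (h : IsBandEdges A α a b) :
    bandSet A α = ⋃ m, Icc (interleaveSq a m) (interleaveSq b m) := by
  refine Subset.antisymm (fun E hE => mem_iUnion.2 ?_) (iUnion_subset fun m E hE => ?_)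
  · by_cases hS : sinE E Real.pi = 0
    · obtain ⟨n, hn, rfl⟩ := sinE_pi_eq_zero_iff.1 hS
      obtain ⟨k, rfl⟩ := Nat.exists_eq_succ_of_ne_zero hn
      refine ⟨2 * k + 1, ?_⟩
      rw [interleaveSq_odd, interleaveSq_odd, Icc_self, Nat.cast_succ]
      rfl
    · obtain ⟨n, hn⟩ := exists_mem_cell hS
      refine ⟨2 * n, ?_⟩
      rw [interleaveSq_even, interleaveSq_even]
      exact (h.abs_xi_le_iff hn).1 (hE.resolve_right hS)
  · obtain ⟨k, rfl | rfl⟩ := Nat.even_or_odd' m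
    · rw [interleaveSq_even, interleaveSq_even] at hE
      exact Or.inl ((h.abs_xi_le_iff
        ((ordConnected_cell k).out (h.left_mem k) (h.right_mem k) hE)).2 hE)
    · rw [interleaveSq_odd, interleaveSq_odd, Icc_self] at hE
      exact Or.inr (sinE_pi_eq_zero_iff.2 ⟨k + 1, k.succ_ne_zero, hE.trans (by push_cast; rfl)⟩)

theorem exists_eq_gapSet (h : IsBandEdges A α a b) {n : ℕ} {I : Set ℝ}
    (hI : IsNthGap (bandSet A α) n I) :
    ∃ m, n = m + 1 ∧ I = gapSet (interleaveSq a) (interleaveSq b) m :=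
  (h.bandSet_eq ▸ hI).exists_eq_gapSet h.interleaveSq_le h.interleaveSq_lt
    (exists_lt_interleaveSq a)

theorem disjoint_gapSet (h : IsBandEdges A α a b) (m : ℕ) :
    Disjoint (gapSet (interleaveSq a) (interleaveSq b) m) (bandSet A α) := by
  rw [h.bandSet_eq]
  exact _root_.disjoint_gapSet h.interleaveSq_le h.interleaveSq_lt m

theorem gapSet_even (h : IsBandEdges A α a b) (k : ℕ) :
    gapSet (interleaveSq a) (interleaveSq b) (2 * k) = cell k ∩ Iio (a k) := by
  ext E
  rcases k with _ | k
  · change E < interleaveSq a (2 * 0) ↔ E ∈ cell 0 ∩ Iio (a 0)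
    have ha := h.left_mem 0
    rw [cell_zero] at ha ⊢
    rw [interleaveSq_even]
    exact ⟨fun hE => ⟨hE.trans ha, hE⟩, And.right⟩
  · change interleaveSq b (2 * k + 1) < E ∧ E < interleaveSq a (2 * (k + 1)) ↔ _
    rw [interleaveSq_odd, interleaveSq_even, ← Nat.cast_succ]
    exact ⟨fun hE => ⟨⟨fun _ => hE.1, hE.2.trans (h.left_mem _).2⟩, hE.2⟩,
      fun hE => ⟨hE.1.1 k.succ_ne_zero, hE.2⟩⟩

theorem gapSet_odd (h : IsBandEdges A α a b) (k : ℕ) :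
    gapSet (interleaveSq a) (interleaveSq b) (2 * k + 1) = cell k ∩ Ioi (b k) := by
  ext E
  change interleaveSq b (2 * k) < E ∧ E < interleaveSq a (2 * k + 1) ↔ _
  rw [interleaveSq_odd, interleaveSq_even]
  exact ⟨fun hE => ⟨⟨fun hk => ((h.right_mem k).1 hk).trans hE.1, hE.2⟩, hE.1⟩,
    fun hE => ⟨hE.2, hE.1.2⟩⟩

end IsBandEdges

end BandEdges

section Secular

variable {c X T γ₁ γ₂ : ℝ}

/-- The larger root of `μ ^ 2 - 2 * X * μ + c ^ 2 = 0`, for `|c| ≤ X`. With `c = cos (A π)` and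
`X = ± ξ(E)`, the vertex values of a decaying solution are multiplied by `± c / μ` from one
vertex to the next. -/
noncomputable def decay (c X : ℝ) : ℝ := X + √(X ^ 2 - c ^ 2)

/-- The secular function of two neighbouring impurities, evaluated at `X = ± ξ(E)` and `T = ± S(E)`
with a common sign: `E` is an eigenvalue where it vanishes. It is the larger of the two factors of
`(μ + γ₁ / 2 * T) * (μ + γ₂ / 2 * T) - c ^ 2`, which is quadratic in `μ = decay c X`. -/
noncomputable def secular (c γ₁ γ₂ X T : ℝ) : ℝ :=
  decay c X + (γ₁ + γ₂) / 4 * T - √(((γ₁ - γ₂) / 4 * T) ^ 2 + c ^ 2)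

theorem abs_lt_decay (h : |c| < X) : |c| < decay c X :=
  h.trans_le (le_add_of_nonneg_right (Real.sqrt_nonneg _))

theorem decay_sq_add_sq (h : |c| ≤ X) : decay c X ^ 2 + c ^ 2 = 2 * X * decay c X := by
  rw [decay]
  linear_combination Real.sq_sqrt (sub_nonneg.2 (sq_le_sq' (neg_le_of_abs_le h) (le_of_abs_le h)))

theorem mul_eq_sq_of_secular_eq_zero (h : secular c γ₁ γ₂ X T = 0) :
    (decay c X + γ₁ / 2 * T) * (decay c X + γ₂ / 2 * T) = c ^ 2 := by
  have hroot := Real.sq_sqrt (show 0 ≤ ((γ₁ - γ₂) / 4 * T) ^ 2 + c ^ 2 by positivity)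
  rw [← sub_eq_zero.1 h] at hroot
  linear_combination hroot

theorem secular_abs_neg (h : (γ₁ + γ₂) * T < 0) : secular c γ₁ γ₂ |c| T < 0 := by
  have hroot : |c| ≤ √(((γ₁ - γ₂) / 4 * T) ^ 2 + c ^ 2) :=
    Real.abs_le_sqrt (le_add_of_nonneg_left (sq_nonneg _))
  rw [secular, decay, sq_abs, sub_self, Real.sqrt_zero]
  linarith

theorem secular_pos (h : |c| < X - (|γ₁ + γ₂| + |γ₁ - γ₂|) / 4 * |T|) :
    0 < secular c γ₁ γ₂ X T := by
  have hroot : √(((γ₁ - γ₂) / 4 * T) ^ 2 + c ^ 2) ≤ |γ₁ - γ₂| / 4 * |T| + |c| := by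
    refine Real.sqrt_le_iff.2 ⟨by positivity, ?_⟩
    rw [add_sq, mul_pow, mul_pow, div_pow, div_pow, sq_abs, sq_abs, sq_abs]
    exact add_le_add_left (le_add_of_nonneg_right (by positivity)) _
  have hsum := neg_abs_le ((γ₁ + γ₂) * T)
  rw [abs_mul] at hsum
  rw [secular, decay]
  linarith [Real.sqrt_nonneg (X ^ 2 - c ^ 2)]

theorem continuous_secular (s c α γ₁ γ₂ : ℝ) :
    Continuous fun E => secular c γ₁ γ₂ (s * xi α E) (s * sinE E Real.pi) := by
  have hxi := continuous_xi α
  have hsin := continuous_sinE_left Real.pi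
  unfold secular decay
  fun_prop

end Secular

section SecularZeros

variable {A α γ₁ γ₂ : ℝ} {a b : ℕ → ℝ}

theorem exists_le_secular_pos {c : ℝ} (hc : |c| < 1) (α γ₁ γ₂ : ℝ) (k : ℕ) {a : ℝ}
    (ha : a ∈ cell k) : ∃ e ≤ a, (k ≠ 0 → (k : ℝ) ^ 2 ≤ e) ∧
      0 < secular c γ₁ γ₂ ((-1) ^ k * xi α e) ((-1) ^ k * sinE e Real.pi) := by
  rcases eq_or_ne k 0 with rfl | hk
  · set K := |α| / 4 + (|γ₁ + γ₂| + |γ₁ - γ₂|) / 4 with hK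
    refine ⟨min (-(K + 1) ^ 2) a, min_le_right _ _, fun h => absurd rfl h, secular_pos ?_⟩
    set e := min (-(K + 1) ^ 2) a
    have he : e ≤ -(K + 1) ^ 2 := min_le_left _ _
    have hS : 0 < sinE e Real.pi := sinE_pi_pos_of_lt_one (by nlinarith)
    have hα := mul_le_mul_of_nonneg_right (neg_abs_le α) hS.le
    have hdom := one_lt_cosE_sub_mul_sinE he
    rw [hK] at hdom
    rw [pow_zero, one_mul, one_mul, abs_of_pos hS, xi]
    linarith
  · refine ⟨(k : ℝ) ^ 2, (ha.1 hk).le, fun _ => le_rfl, secular_pos ?_⟩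
    rwa [neg_one_pow_mul_xi_sq α hk, sinE_sq_pi hk, mul_zero, abs_zero, mul_zero, sub_zero]

theorem IsBandEdges.exists_secular_eq_zero_even (h : IsBandEdges A α a b)
    (hA : |Real.cos (A * Real.pi)| < 1) (hγ : γ₁ + γ₂ < 0) (k : ℕ) :
    ∃ E ∈ cell k ∩ Iio (a k), secular (Real.cos (A * Real.pi)) γ₁ γ₂
      ((-1) ^ k * xi α E) ((-1) ^ k * sinE E Real.pi) = 0 := by
  have hneg : secular (Real.cos (A * Real.pi)) γ₁ γ₂
      ((-1) ^ k * xi α (a k)) ((-1) ^ k * sinE (a k) Real.pi) < 0 := by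
    rw [h.left_eq]
    exact secular_abs_neg (mul_neg_of_neg_of_pos hγ
      (neg_one_pow_mul_sinE_pos_of_mem_cell (h.left_mem k)))
  obtain ⟨e, hle, he, hpos⟩ := exists_le_secular_pos hA α γ₁ γ₂ k (h.left_mem k)
  obtain ⟨E, hE, hzero⟩ :=
    intermediate_value_Ioo' hle (continuous_secular _ _ _ _ _).continuousOn ⟨hneg, hpos⟩
  exact ⟨E, ⟨⟨fun hk => (he hk).trans_lt hE.1, hE.2.trans (h.left_mem k).2⟩, hE.2⟩, hzero⟩

theorem IsBandEdges.exists_secular_eq_zero_odd (h : IsBandEdges A α a b)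
    (hA : |Real.cos (A * Real.pi)| < 1) (hγ : 0 < γ₁ + γ₂) (k : ℕ) :
    ∃ E ∈ cell k ∩ Ioi (b k), secular (Real.cos (A * Real.pi)) γ₁ γ₂
      (-(-1) ^ k * xi α E) (-(-1) ^ k * sinE E Real.pi) = 0 := by
  have hneg : secular (Real.cos (A * Real.pi)) γ₁ γ₂
      (-(-1) ^ k * xi α (b k)) (-(-1) ^ k * sinE (b k) Real.pi) < 0 := by
    rw [neg_mul, neg_mul, h.right_eq, neg_neg]
    exact secular_abs_neg (mul_neg_of_pos_of_neg hγ (neg_lt_zero.2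
      (neg_one_pow_mul_sinE_pos_of_mem_cell (h.right_mem k))))
  have hpos : 0 < secular (Real.cos (A * Real.pi)) γ₁ γ₂
      (-(-1) ^ k * xi α (((k : ℝ) + 1) ^ 2)) (-(-1) ^ k * sinE (((k : ℝ) + 1) ^ 2) Real.pi) := by
    refine secular_pos ?_
    have hsin := sinE_sq_pi k.succ_ne_zero
    rw [Nat.cast_succ] at hsin
    rwa [neg_mul, neg_one_pow_mul_xi_add_one_sq, neg_neg, hsin, mul_zero, abs_zero, mul_zero,
      sub_zero]
  obtain ⟨E, hE, hzero⟩ := intermediate_value_Ioo (h.right_mem k).2.le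
    (continuous_secular _ _ _ _ _).continuousOn ⟨hneg, hpos⟩
  exact ⟨E, ⟨⟨fun hk => ((h.right_mem k).1 hk).trans hE.1, hE.2⟩, hE.1⟩, hzero⟩

end SecularZeros

section Bump

/-- The sequence with values `y₁` at `1` and `y₂` at `2` that decays geometrically with ratio `q`
away from these two vertices. -/
noncomputable def bump (q y₁ y₂ : ℂ) (j : ℤ) : ℂ :=
  if 2 ≤ j then q ^ (j - 2).toNat * y₂ else q ^ (1 - j).toNat * y₁

variable {q y₁ y₂ : ℂ}

theorem bump_two_add (q y₁ y₂ : ℂ) (k : ℕ) : bump q y₁ y₂ (2 + k) = q ^ k * y₂ := by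
  rw [bump, if_pos (by omega), add_sub_cancel_left, Int.toNat_natCast]

theorem bump_one_sub (q y₁ y₂ : ℂ) (k : ℕ) : bump q y₁ y₂ (1 - k) = q ^ k * y₁ := by
  rw [bump, if_neg (by omega), sub_sub_cancel, Int.toNat_natCast]

theorem bump_one (q y₁ y₂ : ℂ) : bump q y₁ y₂ 1 = y₁ := by
  simpa using bump_one_sub q y₁ y₂ 0

theorem bump_two (q y₁ y₂ : ℂ) : bump q y₁ y₂ 2 = y₂ := by
  simpa using bump_two_add q y₁ y₂ 0

theorem bump_zero (q y₁ y₂ : ℂ) : bump q y₁ y₂ 0 = q * y₁ := by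
  simpa using bump_one_sub q y₁ y₂ 1

theorem bump_three (q y₁ y₂ : ℂ) : bump q y₁ y₂ 3 = q * y₂ := by
  simpa using bump_two_add q y₁ y₂ 1

theorem memℓp_bump (hq : ‖q‖ < 1) (y₁ y₂ : ℂ) :
    Memℓp (E := fun _ : ℤ => ℂ) (bump q y₁ y₂) 2 := by
  refine memℓp_gen ?_
  simp only [ENNReal.toReal_ofNat, Real.rpow_ofNat]
  have hgeom : Summable fun k : ℕ => (‖q‖ ^ 2) ^ k :=
    summable_geometric_of_lt_one (by positivity) (pow_lt_one₀ (norm_nonneg q) hq two_ne_zero)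
  refine Summable.of_nat_of_neg ?_ ?_
  · refine (summable_nat_add_iff 2).1 ((hgeom.mul_right (‖y₂‖ ^ 2)).congr fun k => ?_)
    rw [Nat.cast_add, Nat.cast_two, add_comm, bump_two_add, norm_mul, norm_pow]
    ring
  · refine (hgeom.mul_right (‖q‖ ^ 2 * ‖y₁‖ ^ 2)).congr fun k => ?_
    rw [show -(k : ℤ) = 1 - ((k + 1 : ℕ) : ℤ) by push_cast; ring, bump_one_sub, norm_mul, norm_pow]
    ring

theorem twoImpurities_of_notMem {j : ℤ} (hj : j ∉ ({1, 2} : Finset ℤ)) (α γ₁ γ₂ : ℝ) :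
    twoImpurities α γ₁ γ₂ j = α := by
  simp only [Finset.mem_insert, Finset.mem_singleton, not_or] at hj
  rw [twoImpurities, if_neg hj.1, if_neg hj.2]

theorem four_mul_cosE_add_mul_sinE (α γ E : ℝ) :
    4 * cosE E Real.pi + (α + γ) * sinE E Real.pi = 4 * xi α E + γ * sinE E Real.pi := by
  rw [xi]
  ring

theorem jacobi_bump_eq_zero {A α γ₁ γ₂ E : ℝ}
    (hq : 2 * xi α E * q = Real.cos (A * Real.pi) * (q ^ 2 + 1))
    (h₁ : 2 * Real.cos (A * Real.pi) * (y₂ + q * y₁) = (4 * xi α E + γ₁ * sinE E Real.pi) * y₁)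
    (h₂ : 2 * Real.cos (A * Real.pi) * (q * y₂ + y₁) = (4 * xi α E + γ₂ * sinE E Real.pi) * y₂)
    (j : ℤ) : jacobi A (twoImpurities α γ₁ γ₂) E (bump q y₁ y₂) j = 0 := by
  rcases eq_or_ne j 1 with rfl | hj₁
  · rw [jacobi, show twoImpurities α γ₁ γ₂ 1 = α + γ₁ from rfl, four_mul_cosE_add_mul_sinE,
      one_add_one_eq_two, sub_self, bump_zero, bump_one, bump_two]
    simp only [Complex.ofReal_add, Complex.ofReal_mul, Complex.ofReal_ofNat]
    linear_combination h₁
  rcases eq_or_ne j 2 with rfl | hj₂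
  · rw [jacobi, show twoImpurities α γ₁ γ₂ 2 = α + γ₂ from rfl, four_mul_cosE_add_mul_sinE,
      two_add_one_eq_three, show (2 : ℤ) - 1 = 1 from rfl, bump_one, bump_two, bump_three]
    simp only [Complex.ofReal_add, Complex.ofReal_mul, Complex.ofReal_ofNat]
    linear_combination h₂
  have hcoeff := four_mul_cosE_add_mul_sinE α 0 E
  rw [add_zero, zero_mul, add_zero] at hcoeff
  rw [jacobi, twoImpurities_of_notMem (by simp [hj₁, hj₂]), hcoeff,
    Complex.ofReal_mul, Complex.ofReal_ofNat]
  rcases lt_or_ge 2 j with hj | hj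
  · obtain ⟨k, rfl⟩ : ∃ k : ℕ, j = 2 + (k + 1 : ℕ) := ⟨(j - 3).toNat, by omega⟩
    rw [add_assoc, ← Nat.cast_succ, add_sub_assoc, ← Nat.cast_pred k.succ_pos, bump_two_add,
      bump_two_add, bump_two_add, Nat.succ_sub_one, pow_succ, pow_succ]
    linear_combination -2 * q ^ k * y₂ * hq
  · obtain ⟨k, rfl⟩ : ∃ k : ℕ, j = 1 - (k + 1 : ℕ) := ⟨(-j).toNat, by omega⟩
    rw [sub_sub, ← Nat.cast_succ, sub_add, ← Nat.cast_pred k.succ_pos, bump_one_sub,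
      bump_one_sub, bump_one_sub, Nat.succ_sub_one, pow_succ, pow_succ]
    linear_combination -2 * q ^ k * y₁ * hq

end Bump

section Eigenvalues

theorem exists_mul_eq_mul_of_mul_eq_sq {p₁ p₂ d : ℝ} (h : p₁ * p₂ = d ^ 2) :
    ∃ y₁ y₂ : ℝ, (y₁ ≠ 0 ∨ y₂ ≠ 0) ∧ p₁ * y₁ = d * y₂ ∧ p₂ * y₂ = d * y₁ := by
  by_cases hne : d ≠ 0 ∨ p₁ ≠ 0
  · exact ⟨d, p₁, hne, mul_comm _ _, by linarith⟩
  · push Not at hne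
    exact ⟨1, 0, Or.inl one_ne_zero, by rw [hne.1, hne.2]; ring, by rw [hne.1]; ring⟩

theorem exists_bump_of_secular_eq_zero {c s ξ S γ₁ γ₂ : ℝ} (hs : s * s = 1)
    (h : |c| < s * ξ) (hzero : secular c γ₁ γ₂ (s * ξ) (s * S) = 0) :
    ∃ q y₁ y₂ : ℝ, |q| < 1 ∧ (y₁ ≠ 0 ∨ y₂ ≠ 0) ∧ 2 * ξ * q = c * (q ^ 2 + 1) ∧
      2 * c * (y₂ + q * y₁) = (4 * ξ + γ₁ * S) * y₁ ∧
      2 * c * (q * y₂ + y₁) = (4 * ξ + γ₂ * S) * y₂ := by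
  set μ := decay c (s * ξ)
  have hlt : |c| < μ := abs_lt_decay h
  have hμ : μ ≠ 0 := ((abs_nonneg c).trans_lt hlt).ne'
  have hquad : μ ^ 2 + c ^ 2 = 2 * (s * ξ) * μ := decay_sq_add_sq h.le
  have hmul : s * c / μ * μ = s * c := div_mul_cancel₀ _ hμ
  have hdet : (μ + γ₁ / 2 * (s * S)) * (μ + γ₂ / 2 * (s * S)) = (s * c) ^ 2 := by
    rw [mul_eq_sq_of_secular_eq_zero hzero]
    linear_combination -c ^ 2 * hs
  obtain ⟨y₁, y₂, hy, h₁, h₂⟩ := exists_mul_eq_mul_of_mul_eq_sq hdet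
  have hstep : 2 * ξ - c * (s * c / μ) = s * μ := by
    refine mul_right_cancel₀ hμ ?_
    linear_combination -s * hquad - c * hmul - 2 * ξ * μ * hs
  refine ⟨s * c / μ, y₁, y₂, ?_, hy, ?_, ?_, ?_⟩
  · rw [abs_div, abs_mul, (abs_eq zero_le_one).2 (mul_self_eq_one_iff.1 hs), one_mul,
      div_lt_one (abs_pos.2 hμ)]
    exact hlt.trans_le (le_abs_self μ)
  · linear_combination (s * c / μ) * hstep + s * hmul + c * hs
  · linear_combination -2 * y₁ * hstep - 2 * s * h₁ + (γ₁ * S * y₁ - 2 * c * y₂) * hs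
  · linear_combination -2 * y₂ * hstep - 2 * s * h₂ + (γ₂ * S * y₂ - 2 * c * y₁) * hs

theorem eigenspace_ne_bot_of_secular_eq_zero {A α γ₁ γ₂ s E : ℝ} (hs : s * s = 1)
    (hS : sinE E Real.pi ≠ 0) (h : |Real.cos (A * Real.pi)| < s * xi α E)
    (hzero : secular (Real.cos (A * Real.pi)) γ₁ γ₂ (s * xi α E) (s * sinE E Real.pi) = 0) :
    eigenspace (hamiltonian A (twoImpurities α γ₁ γ₂)) (E : ℂ) ≠ ⊥ := by
  obtain ⟨q, y₁, y₂, hq, hy, hrec, h₁, h₂⟩ := exists_bump_of_secular_eq_zero hs h hzero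
  intro hbot
  have hbump : bump q y₁ y₂ = 0 :=
    jacobi_injective_of_eigenspace_eq_bot hS hbot
      (memℓp_bump (by rwa [Complex.norm_real]) _ _)
      (jacobi_bump_eq_zero (by exact_mod_cast hrec) (by exact_mod_cast h₁) (by exact_mod_cast h₂))
  have hy₁ := congrFun hbump 1
  have hy₂ := congrFun hbump 2
  rw [bump_one, Pi.zero_apply, Complex.ofReal_eq_zero] at hy₁
  rw [bump_two, Pi.zero_apply, Complex.ofReal_eq_zero] at hy₂
  exact hy.elim (absurd hy₁) (absurd hy₂)

variable {A α γ₁ γ₂ : ℝ} {a b : ℕ → ℝ}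

theorem hasOneOrTwoEigenvaluesIn {I : Set ℝ} (hI : IsOpen I) (hIc : I.OrdConnected)
    (hd : Disjoint I (bandSet A α)) {E : ℝ} (hE : E ∈ I)
    (h : eigenspace (hamiltonian A (twoImpurities α γ₁ γ₂)) (E : ℂ) ≠ ⊥) :
    HasOneOrTwoEigenvaluesIn (hamiltonian A (twoImpurities α γ₁ γ₂)) I := by
  have hrank := rank_eigenfunctionsIn_le_card
    (fun _ hj => twoImpurities_of_notMem hj α γ₁ γ₂) hI hIc hd
  exact ⟨one_le_encard_iff_nonempty.2 ⟨E, hE, h⟩,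
    (isSymmetric_hamiltonian _ _).encard_eigenvaluesIn_le hrank, hrank⟩

theorem abs_cos_mul_pi_lt_one (hA : ∀ n : ℤ, A ≠ n) : |Real.cos (A * Real.pi)| < 1 := by
  refine (Real.abs_cos_le_one _).lt_of_ne fun h => ?_
  obtain ⟨n, hn⟩ := Real.abs_cos_eq_one_iff.1 h
  exact hA n (mul_right_cancel₀ Real.pi_ne_zero hn).symm

theorem IsBandEdges.hasOneOrTwoEigenvaluesIn_even (h : IsBandEdges A α a b)
    (hA : |Real.cos (A * Real.pi)| < 1) (hγ : γ₁ + γ₂ < 0) (k : ℕ) :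
    HasOneOrTwoEigenvaluesIn (hamiltonian A (twoImpurities α γ₁ γ₂))
      (gapSet (interleaveSq a) (interleaveSq b) (2 * k)) := by
  obtain ⟨E, hE, hzero⟩ := h.exists_secular_eq_zero_even hA hγ k
  refine hasOneOrTwoEigenvaluesIn (isOpen_gapSet _ _ _) (ordConnected_gapSet _ _ _)
    (h.disjoint_gapSet _) (h.gapSet_even k ▸ hE) ?_
  exact eigenspace_ne_bot_of_secular_eq_zero (neg_one_pow_mul_self k)
    (sinE_ne_zero_of_mem_cell hE.1) ((h.abs_cos_lt_iff hE.1).2 hE.2) hzero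

theorem IsBandEdges.hasOneOrTwoEigenvaluesIn_odd (h : IsBandEdges A α a b)
    (hA : |Real.cos (A * Real.pi)| < 1) (hγ : 0 < γ₁ + γ₂) (k : ℕ) :
    HasOneOrTwoEigenvaluesIn (hamiltonian A (twoImpurities α γ₁ γ₂))
      (gapSet (interleaveSq a) (interleaveSq b) (2 * k + 1)) := by
  obtain ⟨E, hE, hzero⟩ := h.exists_secular_eq_zero_odd hA hγ k
  refine hasOneOrTwoEigenvaluesIn (isOpen_gapSet _ _ _) (ordConnected_gapSet _ _ _)
    (h.disjoint_gapSet _) (h.gapSet_odd k ▸ hE) ?_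
  refine eigenspace_ne_bot_of_secular_eq_zero (by rw [neg_mul_neg, neg_one_pow_mul_self])
    (sinE_ne_zero_of_mem_cell hE.1) ?_ hzero
  rw [neg_mul]
  exact lt_neg_of_lt_neg ((h.lt_neg_abs_cos_iff hE.1).2 hE.2)

end Eigenvalues

end MagneticChain

theorem mainTheorem7 (A α γ₁ γ₂ : ℝ) (hA : ∀ n : ℤ, A ≠ n) :
    UnboundedOperator.essentialSpectrum
        (MagneticChain.hamiltonian A (MagneticChain.twoImpurities α γ₁ γ₂)) =
      UnboundedOperator.essentialSpectrum (MagneticChain.hamiltonian A (fun _ => α)) ∧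
    (γ₁ + γ₂ < 0 → ∀ (n : ℕ) (I : Set ℝ), Odd n →
      IsNthGap (UnboundedOperator.realEssentialSpectrum
        (MagneticChain.hamiltonian A (MagneticChain.twoImpurities α γ₁ γ₂))) n I →
      UnboundedOperator.HasOneOrTwoEigenvaluesIn
        (MagneticChain.hamiltonian A (MagneticChain.twoImpurities α γ₁ γ₂)) I) ∧
    (0 < γ₁ + γ₂ → ∀ (n : ℕ) (I : Set ℝ), Even n →
      IsNthGap (UnboundedOperator.realEssentialSpectrum
        (MagneticChain.hamiltonian A (MagneticChain.twoImpurities α γ₁ γ₂))) n I →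
      UnboundedOperator.HasOneOrTwoEigenvaluesIn
        (MagneticChain.hamiltonian A (MagneticChain.twoImpurities α γ₁ γ₂)) I) := by
  have hcos := MagneticChain.abs_cos_mul_pi_lt_one hA
  have himp := fun j (hj : j ∉ ({1, 2} : Finset ℤ)) =>
    MagneticChain.twoImpurities_of_notMem hj α γ₁ γ₂
  obtain ⟨a, b, h⟩ := MagneticChain.exists_isBandEdges hcos α
  rw [MagneticChain.realEssentialSpectrum_eq A himp]
  refine ⟨?_, fun hγ n I hn hI => ?_, fun hγ n I hn hI => ?_⟩
  · rw [MagneticChain.essentialSpectrum_eq A himp,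
      MagneticChain.essentialSpectrum_eq (s := ∅) A fun _ _ => rfl]
  · obtain ⟨m, rfl, rfl⟩ := h.exists_eq_gapSet hI
    obtain ⟨k, rfl⟩ := Nat.not_odd_iff_even.1 (Nat.odd_add_one.1 hn)
    rw [← two_mul]
    exact h.hasOneOrTwoEigenvaluesIn_even hcos hγ k
  · obtain ⟨m, rfl, rfl⟩ := h.exists_eq_gapSet hI
    obtain ⟨k, rfl⟩ := Nat.not_even_iff_odd.1 (Nat.even_add_one.1 hn)
    exact h.hasOneOrTwoEigenvaluesIn_odd hcos hγ k
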